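/- Let $M$ be a smooth real $4$-dimensional manifold with a CR-structure of CR-dimension $1$ (so of codimension $2$), that is, a smooth complex line subbundle $L\subset\mathbb{C}\otimes TM$ with $L\cap\overline L=0$ (and $[L,L]\subset L$). Suppose that $M$ belongs to general class $\mathsf{II}$ (is an Engel CR-manifold), i.e. at every point $$\mathbb{C}\otimes TM = L+\overline L+[L,\overline L]+[L,[L,\overline L]].$$ Then there are a $5$-dimensional smooth embedded subbundle $P$ of the bundle $\mathbb{C}\otimes F(M)$ of complex coframes of $M$, with structure group $\{\mathrm{diag}(a^3,a^2,a,a) : a\in\mathbb{R}\setminus\{0\}\}$ (locally, $P$ consists of the coframes $(a^3\sigma_3,a^2\rho_3,a\zeta_3,a\overline\zeta_3)$ for one smooth local coframe $(\sigma_3,\rho_3,\zeta_3,\overline\zeta_3)$), a smooth coframe $\omega=(\Lambda,\sigma,\rho,\zeta,\overline\zeta)$ of complex $1$-forms on $P$, and smooth functions $\mathfrak{J}_0,\dots,\mathfrak{J}_5:P\to\mathbb{C}$, such that the following hold. 1. Every coframe $(\sigma,\rho,\zeta,\overline\zeta)\in P$ is adapted to the CR-structure: $\sigma$ and $\rho$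 are real, the fourth component is the conjugate of $\zeta$, and $L=\ker\sigma\cap\ker\rho\cap\ker\overline\zeta$. The forms $\sigma,\rho,\zeta,\overline\zeta$ on $P$ are the tautological forms of $P$ (the value at $p\in P$ on a vector $v$ is given by the coframe $p$ applied to the projection of $v$ to $M$), and $\Lambda$ is real. 2. On $P$, $$\begin{aligned} d\sigma &= 3\,\Lambda\wedge\sigma+\rho\wedge\zeta+\rho\wedge\overline\zeta,\\ d\rho &= 2\,\Lambda\wedge\rho+i\,\zeta\wedge\overline\zeta,\\ d\zeta &= \Lambda\wedge\zeta+\mathfrak{J}_1\,\sigma\wedge\rho+\mathfrak{J}_2\,\sigma\wedge\zeta+\mathfrak{J}_3\,\sigma\wedge\overline\zeta+\mathfrak{J}_4\,\rho\wedge\zeta+\mathfrak{J}_5\,\rho\wedge\overline\zeta,\\ d\overline\zeta &= \Lambda\wedge\overline\zeta+\overline{\mathfrak{J}_1}\,\sigma\wedge\rho+\overline{\mathfrak{J}_3}\,\sigma\wedge\zeta+\overline{\mathfrak{J}_2}\,\sigma\wedge\overline\zeta+\overline{\mathfrak{J}_5}\,\rho\wedge\zeta+\overline{\mathfrak{J}_4}\,\rho\wedge\overline\zeta,\\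 d\Lambda &= \tfrac i2\mathfrak{J}_1\,\sigma\wedge\overline\zeta-\tfrac i2\overline{\mathfrak{J}_1}\,\sigma\wedge\zeta-\tfrac13\bigl(\mathfrak{J}_2+\overline{\mathfrak{J}_3}\bigr)\rho\wedge\zeta-\tfrac13\bigl(\overline{\mathfrak{J}_2}+\mathfrak{J}_3\bigr)\rho\wedge\overline\zeta+\mathfrak{J}_0\,\sigma\wedge\rho. \end{aligned}$$ 3. Every CR-diffeomorphism $h$ of $M$ (a diffeomorphism whose complexified differential maps $L$ onto $L$) lifts to a bundle isomorphism $\hat h$ of $P$, namely the restriction to $P$ of the natural action of $h$ on coframes, and $\hat h^*\omega=\omega$ and $\mathfrak{J}_k\circ\hat h=\mathfrak{J}_k$ for $k=0,\dots,5$. -/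

import Mathlib

open scoped Manifold ContDiff TensorProduct
open Bundle

noncomputable section

namespace EngelCR

section General

variable {E : Type*} [NormedAddCommGroup E] [NormedSpace ℝ E]
  {H : Type*} [TopologicalSpace H] (I : ModelWithCorners ℝ E H)
  {M : Type*} [TopologicalSpace M] [ChartedSpace H M]

/-! ### Complex tangent vectors and complex vector fields -/

/-- The complexified tangent space `ℂ ⊗ T_x M`. -/
abbrev CTangent (x : M) : Type _ := ℂ ⊗[ℝ] TangentSpace I x

/-- The complex tangent vector `X + i Y`. -/
def cmk {x : M} (X Y : TangentSpace I x) : CTangent I x :=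
  (1 : ℂ) ⊗ₜ[ℝ] X + Complex.I ⊗ₜ[ℝ] Y

/-- Real part of a complex tangent vector. -/
def cre {x : M} : CTangent I x →ₗ[ℝ] TangentSpace I x :=
  (TensorProduct.lid ℝ (TangentSpace I x)).toLinearMap ∘ₗ
    Complex.reLm.rTensor (TangentSpace I x)

/-- Imaginary part of a complex tangent vector. -/
def cim {x : M} : CTangent I x →ₗ[ℝ] TangentSpace I x :=
  (TensorProduct.lid ℝ (TangentSpace I x)).toLinearMap ∘ₗ
    Complex.imLm.rTensor (TangentSpace I x)

/-- Complex conjugation of a complex tangent vector. -/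
def cconj {x : M} (Z : CTangent I x) : CTangent I x :=
  cmk I (cre I Z) (-cim I Z)

/-- The complex vector field `Z` is smooth on `U`: its real and imaginary parts are. -/
def SmoothFieldOn [IsManifold I 1 M] (Z : ∀ x : M, CTangent I x) (U : Set M) : Prop :=
  ContMDiffOn I I.tangent ∞ (fun x => (⟨x, cre I (Z x)⟩ : TangentBundle I M)) U ∧
  ContMDiffOn I I.tangent ∞ (fun x => (⟨x, cim I (Z x)⟩ : TangentBundle I M)) U

/-- The conjugate of a complex vector field. -/
def conjField (Z : ∀ x : M, CTangent I x) : ∀ x : M, CTangent I x :=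
  fun x => cconj I (Z x)

/-- The complex bilinear extension of the Lie bracket to complex vector fields. -/
def cbracket (Z W : ∀ x : M, CTangent I x) : ∀ x : M, CTangent I x := fun x =>
  cmk I
    (VectorField.mlieBracket I (fun y => cre I (Z y)) (fun y => cre I (W y)) x -
      VectorField.mlieBracket I (fun y => cim I (Z y)) (fun y => cim I (W y)) x)
    (VectorField.mlieBracket I (fun y => cre I (Z y)) (fun y => cim I (W y)) x +
      VectorField.mlieBracket I (fun y => cim I (Z y)) (fun y => cre I (W y)) x)

/-- `Z` is a smooth section over `U` of the family `L` of subspaces of `ℂ ⊗ TM`. -/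
def IsSectionOn [IsManifold I 1 M] (L : ∀ x : M, Submodule ℂ (CTangent I x)) (Z : ∀ x : M, CTangent I x)
    (U : Set M) : Prop :=
  SmoothFieldOn I Z U ∧ ∀ x ∈ U, Z x ∈ L x

/-! ### CR-structures -/

/-- A CR-structure of CR-dimension `n` on `M`: a smooth complex subbundle `L` of `ℂ ⊗ TM` of
complex rank `n` with `L ∩ L̄ = 0` and `[L, L] ⊆ L`. -/
structure CRStructure (M : Type*) [TopologicalSpace M] [ChartedSpace H M]
    [IsManifold I 1 M] (n : ℕ) where
  /-- The fibres of the CR-bundle. -/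
  L : ∀ x : M, Submodule ℂ (CTangent I x)
  exists_frame : ∀ x₀ : M, ∃ U : Set M, IsOpen U ∧ x₀ ∈ U ∧
    ∃ Z : Fin n → ∀ x : M, CTangent I x, (∀ j, SmoothFieldOn I (Z j) U) ∧
      ∀ x ∈ U, LinearIndependent ℂ (fun j => Z j x) ∧
        L x = Submodule.span ℂ (Set.range fun j => Z j x)
  eq_zero_of_mem_conj : ∀ (x : M) (v : CTangent I x), v ∈ L x → cconj I v ∈ L x → v = 0
  bracket_mem : ∀ (U : Set M) (Z W : ∀ x : M, CTangent I x), IsOpen U →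
    IsSectionOn I L Z U → IsSectionOn I L W U → ∀ x ∈ U, cbracket I Z W x ∈ L x

/-- The non-degeneracy condition that defines general class II (among CR-manifolds of dimension `4`
and CR-dimension `1`):
`ℂ ⊗ TM = L + L̄ + [L, L̄] + [L, [L, L̄]]`, at every point, with brackets of local smooth
sections of `L` and `L̄`. -/
def CRStructure.SpansUpToOrderThree {I : ModelWithCorners ℝ E H} [IsManifold I 1 M] {n : ℕ}
    (S : CRStructure I M n) : Prop :=
  ∀ x : M, Submodule.span ℂ {v : CTangent I x | ∃ (U : Set M) (Z Z' W : ∀ y : M, CTangent I y),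
    IsOpen U ∧ x ∈ U ∧ IsSectionOn I S.L Z U ∧ IsSectionOn I S.L Z' U ∧ IsSectionOn I S.L W U ∧
    (v = Z x ∨ v = conjField I W x ∨ v = cbracket I Z (conjField I W) x ∨
      v = cbracket I Z' (cbracket I Z (conjField I W)) x)} = ⊤

/-- A diffeomorphism of `M` is a CR-diffeomorphism if its complexified differential maps the
CR-bundle onto the CR-bundle. -/
def CRStructure.IsCRDiffeo {I : ModelWithCorners ℝ E H} [IsManifold I 1 M] {n : ℕ}
    (S : CRStructure I M n) (h : M ≃ₘ^∞⟮I, I⟯ M) : Prop :=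
  ∀ x : M, (S.L x).map
    ((mfderiv I I h x : TangentSpace I x →ₗ[ℝ] TangentSpace I (h x)).baseChange ℂ) = S.L (h x)

/-! ### Complex-valued `1`-forms, exterior derivative, wedge product -/

/-- Extension of a real-linear `ℂᵏ`-valued form on `T_x M` to a complex-linear map on
`ℂ ⊗ T_x M`. -/
def cext {k : ℕ} {x : M} (φ : TangentSpace I x →L[ℝ] (Fin k → ℂ)) :
    CTangent I x →ₗ[ℂ] (Fin k → ℂ) :=
  (φ : TangentSpace I x →ₗ[ℝ] (Fin k → ℂ)).liftBaseChange ℂ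

/-- The `k` components of `φ` form a complex coframe at `x`, that is, a basis of the dual of
`ℂ ⊗ T_x M`. -/
def IsCoframeAt {k : ℕ} {x : M} (φ : TangentSpace I x →L[ℝ] (Fin k → ℂ)) : Prop :=
  Function.Bijective (cext I φ)

/-- The smooth vector bundle `Hom(TM, ℂᵏ)` over `M`, whose elements are `k`-tuples of complex
covectors. When `k` is the dimension of `M`, the bundle `ℂ ⊗ F(M)` of complex coframes is the
open subset of those `k`-tuples that satisfy `IsCoframeAt`. -/
abbrev CovectorTuples (M : Type*) [TopologicalSpace M] [ChartedSpace H M]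
    [IsManifold I 1 M] (k : ℕ) : Type _ :=
  TotalSpace (E →L[ℝ] (Fin k → ℂ))
    (fun x : M => TangentSpace I x →L[ℝ] Trivial M (Fin k → ℂ) x)

/-- A `k`-tuple of complex `1`-forms `θ` is smooth on `U`. -/
def SmoothFormsOn [IsManifold I 1 M] {k : ℕ}
    (θ : ∀ x : M, TangentSpace I x →L[ℝ] (Fin k → ℂ)) (U : Set M) : Prop :=
  ContMDiffOn I (I.prod 𝓘(ℝ, E →L[ℝ] (Fin k → ℂ))) ∞
    (fun x => (⟨x, θ x⟩ : CovectorTuples I M k)) U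

/-- The `j`-th component of a `k`-tuple of complex `1`-forms. -/
def comp {k : ℕ} (θ : ∀ x : M, TangentSpace I x →L[ℝ] (Fin k → ℂ)) (j : Fin k) :
    ∀ x : M, TangentSpace I x →L[ℝ] ℂ :=
  fun x => (ContinuousLinearMap.proj j : (Fin k → ℂ) →L[ℝ] ℂ).comp (θ x)

/-- The `1`-form `η` written in the chart at `x₀`. -/
def inChart (η : ∀ x : M, TangentSpace I x →L[ℝ] ℂ) (x₀ : M) (y : E) : E →L[ℝ] ℂ :=
  (η ((extChartAt I x₀).symm y)).comp
    (mfderivWithin 𝓘(ℝ, E) I (extChartAt I x₀).symm (Set.range I) y)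

/-- The exterior derivative of a complex `1`-form, computed at `x₀` in the chart at `x₀`. It is
normalized by `dη(X, Y) = X(η(Y)) - Y(η(X)) - η([X, Y])`. -/
def extD (η : ∀ x : M, TangentSpace I x →L[ℝ] ℂ) (x₀ : M) (u v : TangentSpace I x₀) : ℂ :=
  let D : E →L[ℝ] E →L[ℝ] ℂ :=
    fderivWithin ℝ (inChart I η x₀) (Set.range I) (extChartAt I x₀ x₀)
  let c : TangentSpace I x₀ →L[ℝ] E := mfderiv I 𝓘(ℝ, E) (extChartAt I x₀) x₀
  D (c u) (c v) - D (c v) (c u)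

/-- The wedge product of two complex `1`-forms. -/
def wedge (α β : ∀ x : M, TangentSpace I x →L[ℝ] ℂ) (x : M) (u v : TangentSpace I x) : ℂ :=
  α x u * β x v - α x v * β x u

/-! ### Coframe bundles with structure group `ℝ \ {0}` -/

/-- The action of `a` in the group of matrices `diag(a³, a², a, a)` on
coframes `(σ, ρ, ζ, ζ̄)`. -/
def weightAct (a : ℝ) {x : M} (φ : TangentSpace I x →L[ℝ] (Fin 4 → ℂ)) :
    TangentSpace I x →L[ℝ] (Fin 4 → ℂ) :=
  ContinuousLinearMap.pi fun j =>
    (((a ^ (![3, 2, 1, 1] : Fin 4 → ℕ) j : ℝ) : ℂ) •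
      (ContinuousLinearMap.proj j : (Fin 4 → ℂ) →L[ℝ] ℂ).comp φ)

/-- `P` is a smooth subbundle of the bundle of complex coframes of `M` with structure group
`{diag(a³, a², a, a) | a ∈ ℝ \ {0}}`: locally, `P` consists of the multiples by this group of one
smooth coframe. -/
def IsWeightedReduction [IsManifold I 1 M] (P : Set (CovectorTuples I M 4)) : Prop :=
  ∀ x₀ : M, ∃ U : Set M, IsOpen U ∧ x₀ ∈ U ∧
    ∃ s : ∀ x : M, TangentSpace I x →L[ℝ] (Fin 4 → ℂ), SmoothFormsOn I s U ∧
      ∀ x ∈ U, IsCoframeAt I (s x) ∧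
        ∀ φ : TangentSpace I x →L[ℝ] (Fin 4 → ℂ),
          (⟨x, φ⟩ : CovectorTuples I M 4) ∈ P ↔ ∃ a : ℝ, a ≠ 0 ∧ φ = weightAct I a (s x)

/-- The coframe `φ = (σ, ρ, ζ, ζ̄)` at `x` is adapted to the CR-structure: `σ` and `ρ` are real, the
fourth component is the conjugate of `ζ`, and the fibre of the CR-bundle is the common kernel
of `σ`, `ρ` and `ζ̄`. -/
def CRStructure.IsAdapted {I : ModelWithCorners ℝ E H} [IsManifold I 1 M] {n : ℕ}
    (S : CRStructure I M n) {x : M}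
    (φ : TangentSpace I x →L[ℝ] (Fin 4 → ℂ)) : Prop :=
  (∀ v, (φ v 0).im = 0 ∧ (φ v 1).im = 0 ∧ φ v 3 = star (φ v 2)) ∧
  ∀ w : CTangent I x, w ∈ S.L x ↔ cext I φ w 0 = 0 ∧ cext I φ w 1 = 0 ∧ cext I φ w 3 = 0

/-- The natural lift of a diffeomorphism `h` of `M` to tuples of covectors: a tuple `φ` at `x` is
sent to the tuple `φ ∘ (dh_x)⁻¹` at `h x`. -/
def naturalLift [IsManifold I 1 M] {k : ℕ} (h : M ≃ₘ^∞⟮I, I⟯ M) (p : CovectorTuples I M k) :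
    CovectorTuples I M k :=
  ⟨h p.proj, ContinuousLinearMap.comp (p.snd : TangentSpace I p.proj →L[ℝ] (Fin k → ℂ))
    (h.mfderivToContinuousLinearEquiv (by simp) p.proj).symm.toContinuousLinearMap⟩

end General

/-! ### The objects of the theorem -/

/-- The model of the `5`-dimensional manifolds that carry a bundle with `1`-dimensional fibres
over a `4`-dimensional base. -/
abbrev J5 : ModelWithCorners ℝ (EuclideanSpace ℝ (Fin 4) × ℝ)
    (ModelProd (EuclideanSpace ℝ (Fin 4)) ℝ) :=
  (𝓡 4).prod 𝓘(ℝ, ℝ)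

/-- The structure equations of a coframe `θ = (Λ, σ, ρ, ζ, ζ̄)` with coefficients `𝔍 0, …, 𝔍 5`. -/
def StructureEquations {N : Type*} [TopologicalSpace N]
    [ChartedSpace (ModelProd (EuclideanSpace ℝ (Fin 4)) ℝ) N]
    (θ : ∀ p : N, TangentSpace J5 p →L[ℝ] (Fin 5 → ℂ)) (𝔍 : Fin 6 → N → ℂ) : Prop :=
  let Λ := comp J5 θ 0
  let σ := comp J5 θ 1
  let ρ := comp J5 θ 2
  let ζ := comp J5 θ 3
  let ζb := comp J5 θ 4
  ∀ (p : N) (u v : TangentSpace J5 p),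
    extD J5 σ p u v = 3 * wedge J5 Λ σ p u v + wedge J5 ρ ζ p u v + wedge J5 ρ ζb p u v ∧
    extD J5 ρ p u v = 2 * wedge J5 Λ ρ p u v + Complex.I * wedge J5 ζ ζb p u v ∧
    extD J5 ζ p u v = wedge J5 Λ ζ p u v
      + 𝔍 1 p * wedge J5 σ ρ p u v + 𝔍 2 p * wedge J5 σ ζ p u v
      + 𝔍 3 p * wedge J5 σ ζb p u v + 𝔍 4 p * wedge J5 ρ ζ p u v
      + 𝔍 5 p * wedge J5 ρ ζb p u v ∧
    extD J5 ζb p u v = wedge J5 Λ ζb p u v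
      + star (𝔍 1 p) * wedge J5 σ ρ p u v + star (𝔍 3 p) * wedge J5 σ ζ p u v
      + star (𝔍 2 p) * wedge J5 σ ζb p u v + star (𝔍 5 p) * wedge J5 ρ ζ p u v
      + star (𝔍 4 p) * wedge J5 ρ ζb p u v ∧
    extD J5 Λ p u v = Complex.I / 2 * 𝔍 1 p * wedge J5 σ ζb p u v
      - Complex.I / 2 * star (𝔍 1 p) * wedge J5 σ ζ p u v
      - 1 / 3 * (𝔍 2 p + star (𝔍 3 p)) * wedge J5 ρ ζ p u v
      - 1 / 3 * (star (𝔍 2 p) + 𝔍 3 p) * wedge J5 ρ ζb p u v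
      + 𝔍 0 p * wedge J5 σ ρ p u v

/-- `σ, ρ, ζ, ζ̄` are the tautological `1`-forms of the set `P` of coframes: their values at
`p ∈ P` are the components of the coframe `p`, applied to projections to `M` of
tangent vectors. -/
def IsTautological {M : Type*} [TopologicalSpace M] [ChartedSpace (EuclideanSpace ℝ (Fin 4)) M]
    [IsManifold (𝓡 4) 1 M] (P : Set (CovectorTuples (𝓡 4) M 4))
    [ChartedSpace (ModelProd (EuclideanSpace ℝ (Fin 4)) ℝ) P]
    (θ : ∀ p : P, TangentSpace J5 p →L[ℝ] (Fin 5 → ℂ)) : Prop :=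
  ∀ (p : P) (v : TangentSpace J5 p) (j : Fin 4),
    θ p v j.succ = (p.1.snd : TangentSpace (𝓡 4) p.1.proj →L[ℝ] (Fin 4 → ℂ))
      (mfderiv J5 (𝓡 4) (fun q : P => q.1.proj) p v) j

end EngelCR

end

/-! The proof is Cartan's method of equivalence. Put ζ = ξ + iη, so that all forms become real. A
real tuple t = (Λ, σ, ρ, ξ, η) on M is called normalized if it is adapted to L and satisfies dσ =
3Λ∧σ + 2ρ∧ξ, dρ = 2Λ∧ρ + 2ξ∧η and dη ≡ Λ∧η modulo σ, ρ. The remaining structure equations are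
consequences of d²σ = 0 and d²ρ = 0: the former gives dξ ≡ Λ∧ξ modulo σ, ρ, and together they
determine dΛ except for its coefficient of σ∧ρ (`structureRel_structureCoeff`). Below, E₀, E₁, E₂,
E₃ denote the fields `fr t` dual to σ, ρ, ξ, η.

Existence (`CRStructure.exists_normalized`). Let X + iY span L locally and let T = [X, Y]. The Engel
condition says that [X, T] + i[Y, T], T, X, Y are independent over ℂ, so [X, T] or [Y, T] completes
T, X, Y to a real frame. A rescaling of the dual coframe satisfies the first two equations up to
lower terms. Adding multiples of σ and ρ, and choosing Λ, makes them exact by solving linear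
equations; one free function b remains, in ρ + bσ, and the equation for dη fixes it.

Uniqueness (`CRStructure.IsNormalizedAt.eq_vscale`). For two normalized tuples, ζ' ≡ cζ modulo σ, ρ.
The equation for dρ gives ρ' ≡ |c|²ρ modulo σ, and the one for dσ forces c to be real with σ' = c³σ.
Once this scaling is removed the change is unipotent, and the same linear equations show that it is
trivial. Hence t' arises from t by the weights 3, 2, 1, 1 and Λ' = Λ + d log|c|.

The coframes of normalized tuples therefore form a bundle P with group ℝ \ {0}. In terms of the
fibre coordinate a defined by t, the forms on P are a³σ, a²ρ, aζ, aζ̄ and Λ + d log|a|. Uniqueness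
makes them independent of t, and they satisfy the structure equations because these are homogeneous
for the weights. Everything commutes with pullback, so a CR-diffeomorphism permutes the normalized
tuples and its lift preserves the forms and the coefficients. -/

open scoped Topology

noncomputable section

namespace EngelCR

/-! ### Vector-valued forms -/

section Forms

variable {E : Type*} [NormedAddCommGroup E] [NormedSpace ℝ E]
  {H : Type*} [TopologicalSpace H] (I : ModelWithCorners ℝ E H)
  {M : Type*} [TopologicalSpace M] [ChartedSpace H M]
  {F : Type*} [NormedAddCommGroup F] [NormedSpace ℝ F]
  {F' : Type*} [NormedAddCommGroup F'] [NormedSpace ℝ F']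

/-- A family of real-linear maps from the tangent spaces to `F`. -/
abbrev VForm (M : Type*) [TopologicalSpace M] [ChartedSpace H M] (F : Type*)
    [NormedAddCommGroup F] [NormedSpace ℝ F] : Type _ :=
  ∀ x : M, TangentSpace I x →L[ℝ] F

/-- The vector-valued form `η` written in the chart at `x₀`. -/
def vInChart (η : VForm I M F) (x₀ : M) (y : E) : E →L[ℝ] F :=
  (η ((extChartAt I x₀).symm y)).comp
    (mfderivWithin 𝓘(ℝ, E) I (extChartAt I x₀).symm (Set.range I) y)

/-- The exterior derivative of a vector-valued form. -/
def vD (η : VForm I M F) (x₀ : M) (u v : TangentSpace I x₀) : F :=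
  let D : E →L[ℝ] E →L[ℝ] F :=
    fderivWithin ℝ (vInChart I η x₀) (Set.range I) (extChartAt I x₀ x₀)
  let c : TangentSpace I x₀ →L[ℝ] E := mfderiv I 𝓘(ℝ, E) (extChartAt I x₀) x₀
  D (c u) (c v) - D (c v) (c u)

/-- Smoothness at a point of a vector-valued form. -/
def FormSmoothAt [IsManifold I 1 M] (η : VForm I M F) (x : M) : Prop :=
  ContMDiffAt I (I.prod 𝓘(ℝ, E →L[ℝ] F)) ∞
    (fun x => (⟨x, η x⟩ : TotalSpace (E →L[ℝ] F)
      (fun x : M => TangentSpace I x →L[ℝ] Trivial M F x))) x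

/-- The coordinate expression of a form in the tangent trivialization at `x₀`. -/
def coordForm [IsManifold I 1 M] (η : VForm I M F) (x₀ : M) (x : M) : E →L[ℝ] F :=
  (η x).comp ((trivializationAt E (TangentSpace I) x₀).symmL ℝ x)

variable [IsManifold I ∞ M]

theorem hom_trivializationAt_snd (x₀ : M) (q : TotalSpace (E →L[ℝ] F)
      (fun x : M => TangentSpace I x →L[ℝ] Trivial M F x)) :
    (trivializationAt (E →L[ℝ] F) (fun x : M => TangentSpace I x →L[ℝ] Trivial M F x) x₀ q).2 =
      (q.2 : TangentSpace I q.1 →L[ℝ] F).comp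
        ((trivializationAt E (TangentSpace I) x₀).symmL ℝ q.1) := by
  rw [hom_trivializationAt_apply]
  ext v
  simp [ContinuousLinearMap.inCoordinates]

/-- The trivialization may be centred at any point whose chart contains x; one fixed centre is
needed when smoothness is checked at all nearby points. -/
theorem formSmoothAt_iff {η : VForm I M F} {x₀ x : M} (hx : x ∈ (chartAt H x₀).source) :
    FormSmoothAt I η x ↔ ContMDiffAt I 𝓘(ℝ, E →L[ℝ] F) ∞ (coordForm I η x₀) x := by
  have hx' : x ∈ (trivializationAt (E →L[ℝ] F)
      (fun x : M => TangentSpace I x →L[ℝ] Trivial M F x) x₀).baseSet := by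
    simpa using hx
  have := (trivializationAt (E →L[ℝ] F)
      (fun x : M => TangentSpace I x →L[ℝ] Trivial M F x) x₀).contMDiffAt_section_iff
      (IB := I) (n := ∞) (s := η) hx'
  refine this.trans ?_
  have h2 : (fun x => (trivializationAt (E →L[ℝ] F)
      (fun x : M => TangentSpace I x →L[ℝ] Trivial M F x) x₀ ⟨x, η x⟩).2) = coordForm I η x₀ := by
    funext y
    exact hom_trivializationAt_snd I x₀ ⟨y, η y⟩
  rw [← h2]

theorem formSmoothAt_iff_self {η : VForm I M F} {x : M} :
    FormSmoothAt I η x ↔ ContMDiffAt I 𝓘(ℝ, E →L[ℝ] F) ∞ (coordForm I η x) x :=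
  formSmoothAt_iff I (mem_chart_source H x)

variable {I}

theorem FormSmoothAt.clm_comp {η : VForm I M F} {x : M} (h : FormSmoothAt I η x) (L : F →L[ℝ] F') :
    FormSmoothAt I (fun x => L.comp (η x)) x := by
  rw [formSmoothAt_iff_self] at h ⊢
  exact contMDiffAt_const.clm_comp (g := fun _ => L) h

theorem FormSmoothAt.add {η ξ : VForm I M F} {x : M} (h : FormSmoothAt I η x)
    (h' : FormSmoothAt I ξ x) : FormSmoothAt I (fun x => η x + ξ x) x := by
  rw [formSmoothAt_iff_self] at h h' ⊢
  exact (h.add h').congr_of_eventuallyEq (Filter.Eventually.of_forall fun y => by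
    ext v; simp [coordForm])

theorem FormSmoothAt.smul {f : M → ℝ} {η : VForm I M F} {x : M} (hf : ContMDiffAt I 𝓘(ℝ, ℝ) ∞ f x)
    (h : FormSmoothAt I η x) : FormSmoothAt I (fun x => f x • η x) x := by
  rw [formSmoothAt_iff_self] at h ⊢
  exact (hf.smul h).congr_of_eventuallyEq (Filter.Eventually.of_forall fun y => by
    ext v; simp [coordForm])

theorem FormSmoothAt.congr {η ξ : VForm I M F} {x : M} (h : FormSmoothAt I η x)
    (h' : ∀ᶠ y in 𝓝 x, ξ y = η y) : FormSmoothAt I ξ x := by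
  rw [formSmoothAt_iff_self] at h ⊢
  refine h.congr_of_eventuallyEq ?_
  filter_upwards [h'] with y hy
  simp [coordForm, hy]

theorem formSmoothAt_zero {x : M} : FormSmoothAt I (fun _ => 0 : VForm I M F) x := by
  rw [formSmoothAt_iff_self]
  have : coordForm I (fun _ => 0 : VForm I M F) x = fun _ => 0 := by
    funext y; simp [coordForm]
  rw [this]
  exact contMDiffAt_const

theorem FormSmoothAt.sum {ι : Type*} {s : Finset ι} {η : ι → VForm I M F} {x : M}
    (h : ∀ i ∈ s, FormSmoothAt I (η i) x) : FormSmoothAt I (fun x => ∑ i ∈ s, η i x) x := by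
  classical
  induction s using Finset.induction_on with
  | empty => simpa using formSmoothAt_zero
  | insert a s ha ih =>
    simp only [Finset.sum_insert ha]
    exact (h a (by simp)).add (ih fun i hi => h i (by simp [hi]))

theorem formSmoothAt_pi {k : ℕ} {η : VForm I M (Fin k → ℝ)} {x : M}
    (h : ∀ j, FormSmoothAt I (fun x => (ContinuousLinearMap.proj j : (Fin k → ℝ) →L[ℝ] ℝ).comp (η x)) x) :
    FormSmoothAt I η x := by
  have := FormSmoothAt.sum (s := Finset.univ) (η := fun j x =>
    (ContinuousLinearMap.single ℝ (fun _ : Fin k => ℝ) j).comp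
      ((ContinuousLinearMap.proj j : (Fin k → ℝ) →L[ℝ] ℝ).comp (η x)))
    (fun j _ => (h j).clm_comp (ContinuousLinearMap.single ℝ (fun _ : Fin k => ℝ) j))
  refine this.congr (Filter.Eventually.of_forall fun y => ?_)
  ext v i
  simp [Finset.sum_apply, Pi.single_apply]

theorem formSmoothAt_mvfderiv {f : M → F} {x : M} (hf : ContMDiffAt I 𝓘(ℝ, F) ∞ f x) :
    FormSmoothAt I (mvfderiv I f) x := by
  rw [formSmoothAt_iff_self]
  have := hf.mfderiv_const (m := ∞) (by simp)
  refine this.congr_of_eventuallyEq (Filter.Eventually.of_forall fun y => ?_)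
  ext v
  simp [coordForm, inTangentCoordinates, ContinuousLinearMap.inCoordinates, mvfderiv]
  rfl

variable {E' : Type*} [NormedAddCommGroup E'] [NormedSpace ℝ E']
  {H' : Type*} [TopologicalSpace H'] {I' : ModelWithCorners ℝ E' H'}
  {N : Type*} [TopologicalSpace N] [ChartedSpace H' N]
  {E'' : Type*} [NormedAddCommGroup E''] [NormedSpace ℝ E'']
  {H'' : Type*} [TopologicalSpace H''] {I'' : ModelWithCorners ℝ E'' H''}
  {K : Type*} [TopologicalSpace K] [ChartedSpace H'' K]

variable (I I') in
/-- The pullback of a form. -/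
def vpull (f : N → M) (η : VForm I M F) : VForm I' N F :=
  fun x => (η (f x)).comp (mfderiv I' I f x)

omit [IsManifold I ∞ M] in
theorem vpull_apply (f : N → M) (η : VForm I M F) (x : N) (v : TangentSpace I' x) :
    vpull I I' f η x v = η (f x) (mfderiv I' I f x v) := rfl

omit [IsManifold I ∞ M] in
theorem vpull_congr {f g : N → M} (η : VForm I M F) {x : N} (h : f =ᶠ[𝓝 x] g) :
    vpull I I' f η x = vpull I I' g η x := by
  -- The tangent space depends on the base point, so the equality f x = g x can be substituted only
  -- after the maps are read on the model spaces.
  have key : ∀ (p q : M) (A B : E' →L[ℝ] E), p = q → A = B →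
      ContinuousLinearMap.comp (η p : E →L[ℝ] F) A = ContinuousLinearMap.comp (η q : E →L[ℝ] F) B := by
    rintro p q A B rfl rfl; rfl
  exact key _ _ _ _ h.eq_of_nhds h.mfderiv_eq

omit [IsManifold I ∞ M] in
theorem vpull_comp {f : N → M} {g : K → N} (η : VForm I M F) {x : K}
    (hf : MDifferentiableAt I' I f (g x)) (hg : MDifferentiableAt I'' I' g x) :
    vpull I I'' (f ∘ g) η x = vpull I' I'' g (vpull I I' f η) x := by
  unfold vpull
  rw [mfderiv_comp x hf hg]
  rfl

/-- In the trivializations at x and f x, the pullback is the composite of the coordinate expressions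
of η and of the differential of f, both smooth. -/
theorem FormSmoothAt.vpull [IsManifold I' ∞ N] {f : N → M} {η : VForm I M F} {x : N}
    (hf : ContMDiffAt I' I ∞ f x) (h : FormSmoothAt I η (f x)) :
    FormSmoothAt I' (vpull I I' f η) x := by
  rw [formSmoothAt_iff_self] at h ⊢
  have h1 := hf.mfderiv_const (m := ∞) (by simp)
  have h2 := h.comp x hf
  refine (h2.clm_comp h1).congr_of_eventuallyEq ?_
  filter_upwards [hf.continuousAt.preimage_mem_nhds (chart_source_mem_nhds H (f x)),
    chart_source_mem_nhds H' x] with y hy hy'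
  ext v
  have hb : f y ∈ (trivializationAt E (TangentSpace I) (f x)).baseSet := by simpa using hy
  simp only [coordForm, EngelCR.vpull, inTangentCoordinates, ContinuousLinearMap.inCoordinates,
    ContinuousLinearMap.comp_apply, Function.comp_apply, id]
  congr 1
  exact ((trivializationAt E (TangentSpace I) (f x)).symmL_continuousLinearMapAt hb _).symm

theorem FormSmoothAt.apply {η : VForm I M F} {X : ∀ x : M, TangentSpace I x} {x : M}
    (h : FormSmoothAt I η x)
    (hX : ContMDiffAt I I.tangent ∞ (fun x => (⟨x, X x⟩ : TangentBundle I M)) x) :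
    ContMDiffAt I 𝓘(ℝ, F) ∞ (fun x => η x (X x)) x := by
  rw [formSmoothAt_iff_self] at h
  have hb : x ∈ (trivializationAt E (TangentSpace I) x).baseSet := by simp
  have h2 := ((trivializationAt E (TangentSpace I) x).contMDiffAt_section_iff
      (IB := I) (n := ∞) (s := X) hb).1 hX
  refine (h.clm_apply h2).congr_of_eventuallyEq ?_
  filter_upwards [chart_source_mem_nhds H x] with y hy
  have hb : y ∈ (trivializationAt E (TangentSpace I) x).baseSet := by simpa using hy
  simp only [coordForm, ContinuousLinearMap.comp_apply]
  congr 1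
  have := (trivializationAt E (TangentSpace I) x).symmL_continuousLinearMapAt (R := ℝ) hb (X y)
  rw [Bundle.Trivialization.continuousLinearMapAt_apply,
    Bundle.Trivialization.linearMapAt_apply, if_pos hb] at this
  exact this.symm

end Forms

/-! ### The exterior derivative of vector-valued forms -/

section Calculus

variable {E : Type*} [NormedAddCommGroup E] [NormedSpace ℝ E]
  {H : Type*} [TopologicalSpace H] {I : ModelWithCorners ℝ E H} [I.Boundaryless]
  {M : Type*} [TopologicalSpace M] [ChartedSpace H M] [IsManifold I ∞ M]
  {F : Type*} [NormedAddCommGroup F] [NormedSpace ℝ F]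
  {F' : Type*} [NormedAddCommGroup F'] [NormedSpace ℝ F']
  {E' : Type*} [NormedAddCommGroup E'] [NormedSpace ℝ E']
  {H' : Type*} [TopologicalSpace H'] {I' : ModelWithCorners ℝ E' H'} [I'.Boundaryless]
  {N : Type*} [TopologicalSpace N] [ChartedSpace H' N] [IsManifold I' ∞ N]

-- Without boundary, the chart expression of a form is its pullback under the inverse chart. This
-- reduces statements about the exterior derivative to functoriality of pullback and calculus on a
-- vector space.
omit [IsManifold I ∞ M] in
theorem vInChart_eq_vpull (η : VForm I M F) (x₀ : M) :
    vInChart I η x₀ = vpull I 𝓘(ℝ, E) (extChartAt I x₀).symm η := by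
  funext y
  unfold vInChart vpull
  rw [ModelWithCorners.Boundaryless.range_eq_univ, mfderivWithin_univ]
  rfl

/-- A form on a vector space, as a form on a manifold. -/
def ofFlat (g : E → E →L[ℝ] F) : VForm 𝓘(ℝ, E) E F := g

theorem formSmoothAt_ofFlat_iff {η : E → E →L[ℝ] F} {y : E} :
    FormSmoothAt 𝓘(ℝ, E) (ofFlat η) y ↔ ContDiffAt ℝ ∞ η y := by
  rw [formSmoothAt_iff_self, ← contMDiffAt_iff_contDiffAt]
  have : coordForm 𝓘(ℝ, E) (ofFlat η) y = η := by
    funext z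
    unfold coordForm
    erw [TangentBundle.symmL_model_space]
    ext v
    rfl
  rw [this]

theorem FormSmoothAt.contDiffAt_vInChart {η : VForm I M F} {x₀ : M} {y : E}
    (hy : y ∈ (extChartAt I x₀).target) (h : FormSmoothAt I η ((extChartAt I x₀).symm y)) :
    ContDiffAt ℝ ∞ (vInChart I η x₀) y := by
  rw [vInChart_eq_vpull]
  refine (formSmoothAt_ofFlat_iff (η := EngelCR.vpull I 𝓘(ℝ, E) (extChartAt I x₀).symm η)).1
    (FormSmoothAt.vpull (I := I) ?_ h)
  exact (contMDiffOn_extChartAt_symm x₀).contMDiffAt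
    ((isOpen_extChartAt_target x₀).mem_nhds hy)

theorem FormSmoothAt.contDiffAt_vInChart_self {η : VForm I M F} {x : M}
    (h : FormSmoothAt I η x) :
    ContDiffAt ℝ ∞ (vInChart I η x) (extChartAt I x x) :=
  FormSmoothAt.contDiffAt_vInChart (mem_extChartAt_target x) (by rwa [extChartAt_to_inv])

/-- The exterior derivative of a form on a vector space. -/
def flatD (g : E → E →L[ℝ] F) (y : E) (u v : E) : F := fderiv ℝ g y u v - fderiv ℝ g y v u

omit [IsManifold I ∞ M] in
theorem vD_eq_flatD [IsManifold I 1 M] (η : VForm I M F) (x : M) :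
    (vD I η x : E → E → F) = flatD (vInChart I η x) (extChartAt I x x) := by
  unfold vD flatD
  rw [mfderiv_extChartAt_self]
  simp only [ModelWithCorners.Boundaryless.range_eq_univ, fderivWithin_univ]
  rfl

theorem vD_ofFlat (g : E → E →L[ℝ] F) (y : E) :
    (vD 𝓘(ℝ, E) (ofFlat g) y : E → E → F) = flatD g y := by
  rw [vD_eq_flatD]
  have : vInChart 𝓘(ℝ, E) (ofFlat g) y = g := by
    funext z
    ext v
    unfold vInChart ofFlat
    simp only [extChartAt_model_space_eq_id, PartialEquiv.refl_symm, PartialEquiv.refl_coe]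
    erw [mfderivWithin_id (UniqueDiffWithinAt.uniqueMDiffWithinAt (by simp))]
    rfl
  rw [this]
  rfl

/-- The derivative of the composite contains the extra term g(Φ y) ∘ D²Φ, which is symmetric and
drops out after antisymmetrization. -/
theorem flatD_vpull {Φ : E' → E} {g : E → E →L[ℝ] F} {y : E'} (hΦ : ContDiffAt ℝ ∞ Φ y)
    (hg : DifferentiableAt ℝ g (Φ y)) (u v : E') :
    flatD (fun y => (g (Φ y)).comp (fderiv ℝ Φ y)) y u v =
      flatD g (Φ y) (fderiv ℝ Φ y u) (fderiv ℝ Φ y v) := by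
  have h1 : DifferentiableAt ℝ Φ y := hΦ.differentiableAt (by simp)
  have h2 : DifferentiableAt ℝ (fderiv ℝ Φ) y :=
    (hΦ.fderiv_right (m := ∞) (by simp)).differentiableAt (by simp)
  have h3 : HasFDerivAt (fun y => (g (Φ y)).comp (fderiv ℝ Φ y)) _ y :=
    (hg.hasFDerivAt.comp y h1.hasFDerivAt).clm_comp h2.hasFDerivAt
  have hs : IsSymmSndFDerivAt ℝ Φ y := hΦ.isSymmSndFDerivAt (by simp; exact WithTop.coe_le_coe.2 le_top)
  unfold flatD
  rw [h3.fderiv]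
  simp [hs.eq u v]

theorem vD_congr {η ξ : VForm I M F} {x : M} (h : ∀ᶠ y in 𝓝 x, η y = ξ y) :
    vD I η x = vD I ξ x := by
  refine (vD_eq_flatD η x).trans (Eq.trans ?_ (vD_eq_flatD ξ x).symm)
  have : vInChart I η x =ᶠ[𝓝 (extChartAt I x x)] vInChart I ξ x := by
    have h1 := (continuousAt_extChartAt_symm (I := I) x).eventually (p := fun y => η y = ξ y)
      (by rwa [extChartAt_to_inv])
    filter_upwards [h1] with y hy
    unfold vInChart
    rw [hy]
  unfold flatD
  rw [this.fderiv_eq]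

/-- Naturality of d. Let Φ be the expression of f in the charts at x and f x. Near the image of x
the chart expression of the pullback is the flat pullback under Φ, so `flatD_vpull` applies. -/
theorem vD_vpull {f : N → M} {η : VForm I M F} {x : N} (hf : ContMDiffAt I' I ∞ f x)
    (h : FormSmoothAt I η (f x)) (u v : TangentSpace I' x) :
    vD I' (vpull I I' f η) x u v = vD I η (f x) (mfderiv I' I f x u) (mfderiv I' I f x v) := by
  set Φ : E' → E := (extChartAt I (f x)) ∘ f ∘ (extChartAt I' x).symm with hΦdef
  set y₀ := extChartAt I' x x with hy₀
  have hΦ : ContDiffAt ℝ ∞ Φ y₀ := by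
    have := (contMDiffAt_iff.1 hf).2
    rw [ModelWithCorners.Boundaryless.range_eq_univ, contDiffWithinAt_univ] at this
    exact this
  have hΦy : Φ y₀ = extChartAt I (f x) (f x) := by simp [hΦdef, hy₀]
  have hf1 : ∀ᶠ z in 𝓝 x, ContMDiffAt I' I 1 f z :=
    (contMDiffAt_iff_contMDiffAt_nhds (by simp)).1 (hf.of_le (by simp : (1 : ℕ∞ω) ≤ ∞))
  have hcont := continuousAt_extChartAt_symm (I := I') x
  have hev : ∀ᶠ y in 𝓝 y₀, vInChart I' (vpull I I' f η) x y =
      (vInChart I η (f x) (Φ y)).comp (fderiv ℝ Φ y) := by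
    have e1 : ∀ᶠ y in 𝓝 y₀, ContMDiffAt I' I 1 f ((extChartAt I' x).symm y) :=
      hcont.eventually (by rw [extChartAt_to_inv]; exact hf1)
    have e2 : ∀ᶠ y in 𝓝 y₀, f ((extChartAt I' x).symm y) ∈ (extChartAt I (f x)).source :=
      hcont.eventually (p := fun z => f z ∈ (extChartAt I (f x)).source) (by
        rw [extChartAt_to_inv]
        exact hf.continuousAt.preimage_mem_nhds (extChartAt_source_mem_nhds (f x)))
    have e3 : ∀ᶠ y in 𝓝 y₀, y ∈ (extChartAt I' x).target :=
      (isOpen_extChartAt_target x).mem_nhds (mem_extChartAt_target x)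
    have e4 : ∀ᶠ y in 𝓝 y₀, DifferentiableAt ℝ Φ y :=
      ((hΦ.of_le (by simp : (1 : ℕ∞ω) ≤ ∞)).eventually (by simp)).mono
        fun y hy => hy.differentiableAt (by simp)
    filter_upwards [e1, e2.eventually_nhds, e2, e3, e4] with y h1 h2 h2' h3 h4
    have hsymm : ∀ {y : E'} (hy : y ∈ (extChartAt I' x).target),
        MDifferentiableAt 𝓘(ℝ, E') I' (extChartAt I' x).symm y := fun hy =>
      ((contMDiffOn_extChartAt_symm (n := ∞) x).contMDiffAt
        ((isOpen_extChartAt_target x).mem_nhds hy)).mdifferentiableAt (by simp)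
    have hΦt : Φ y ∈ (extChartAt I (f x)).target := (extChartAt I (f x)).map_source h2'
    have hsymm' : MDifferentiableAt 𝓘(ℝ, E) I (extChartAt I (f x)).symm (Φ y) :=
      ((contMDiffOn_extChartAt_symm (n := ∞) (f x)).contMDiffAt
        ((isOpen_extChartAt_target (f x)).mem_nhds hΦt)).mdifferentiableAt (by simp)
    rw [vInChart_eq_vpull, vInChart_eq_vpull,
      ← vpull_comp η (h1.mdifferentiableAt (by simp)) (hsymm h3),
      vpull_congr (g := (extChartAt I (f x)).symm ∘ Φ) η, vpull_comp η hsymm' h4.mdifferentiableAt]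
    · unfold vpull
      rw [mfderiv_eq_fderiv]
      rfl
    · filter_upwards [h2] with z hz
      simp only [hΦdef, Function.comp_apply]
      exact ((extChartAt I (f x)).left_inv hz).symm
  have hg : DifferentiableAt ℝ (vInChart I η (f x)) (Φ y₀) := by
    rw [hΦy]
    exact h.contDiffAt_vInChart_self.differentiableAt (by simp)
  have hder : (mfderiv I' I f x : E' →L[ℝ] E) = fderiv ℝ Φ y₀ := by
    rw [(hf.mdifferentiableAt (by simp)).mfderiv, ModelWithCorners.Boundaryless.range_eq_univ,
      fderivWithin_univ]
    rfl
  refine (congrFun₂ (vD_eq_flatD (vpull I I' f η) x) u v).trans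
    (Eq.trans ?_ (congrFun₂ (vD_eq_flatD η (f x)) _ _).symm)
  have : flatD (vInChart I' (vpull I I' f η) x) y₀ =
      flatD (fun y => (vInChart I η (f x) (Φ y)).comp (fderiv ℝ Φ y)) y₀ := by
    unfold flatD
    rw [Filter.EventuallyEq.fderiv_eq hev]
  rw [this]
  refine (flatD_vpull hΦ hg _ _).trans ?_
  rw [hΦy, ← hder]
  rfl

theorem vD_clm_comp {η : VForm I M F} {x : M} (h : FormSmoothAt I η x) (L : F →L[ℝ] F')
    (u v : TangentSpace I x) : vD I (fun x => L.comp (η x)) x u v = L (vD I η x u v) := by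
  have h1 : HasFDerivAt (vInChart I η x) _ (extChartAt I x x) :=
    (h.contDiffAt_vInChart_self.differentiableAt (by simp)).hasFDerivAt
  have h2 := (hasFDerivAt_const L (extChartAt I x x)).clm_comp h1
  have key : ∀ u v : E, flatD (fun y => L.comp (vInChart I η x y)) (extChartAt I x x) u v =
      L (flatD (vInChart I η x) (extChartAt I x x) u v) := by
    intro u v
    unfold flatD
    rw [h2.fderiv]
    simp
  exact (congrFun₂ (vD_eq_flatD (fun x => L.comp (η x)) x) u v).trans
    ((key u v).trans (congrArg L (congrFun₂ (vD_eq_flatD η x) u v).symm))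

theorem vD_add {η ξ : VForm I M F} {x : M} (h : FormSmoothAt I η x) (h' : FormSmoothAt I ξ x)
    (u v : TangentSpace I x) :
    vD I (fun x => η x + ξ x) x u v = vD I η x u v + vD I ξ x u v := by
  have h1 : HasFDerivAt (vInChart I η x) _ (extChartAt I x x) :=
    (h.contDiffAt_vInChart_self.differentiableAt (by simp)).hasFDerivAt
  have h2 : HasFDerivAt (vInChart I ξ x) _ (extChartAt I x x) :=
    (h'.contDiffAt_vInChart_self.differentiableAt (by simp)).hasFDerivAt
  have e : vInChart I (fun x => η x + ξ x) x = vInChart I η x + vInChart I ξ x := by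
    funext y; ext v; rfl
  have key : ∀ u v : E, flatD (vInChart I η x + vInChart I ξ x) (extChartAt I x x) u v =
      flatD (vInChart I η x) (extChartAt I x x) u v +
        flatD (vInChart I ξ x) (extChartAt I x x) u v := by
    intro u v
    unfold flatD
    rw [(h1.add h2).fderiv, add_apply, add_apply,
      add_apply, add_apply]
    abel
  refine (congrFun₂ (vD_eq_flatD (fun x => η x + ξ x) x) u v).trans ?_
  rw [e]
  exact (key u v).trans (congrArg₂ _ (congrFun₂ (vD_eq_flatD η x) u v).symm
    (congrFun₂ (vD_eq_flatD ξ x) u v).symm)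

omit [IsManifold I ∞ M] in
theorem mvfderiv_eq_fderiv_chart {f : M → F} {x : M} (hf : MDifferentiableAt I 𝓘(ℝ, F) f x)
    (u : TangentSpace I x) :
    mvfderiv I f x u = fderiv ℝ (f ∘ (extChartAt I x).symm) (extChartAt I x x) (u : E) := by
  unfold mvfderiv
  rw [hf.mfderiv, ModelWithCorners.Boundaryless.range_eq_univ, fderivWithin_univ]
  rfl

theorem vD_smul {f : M → ℝ} {η : VForm I M F} {x : M} (hf : ContMDiffAt I 𝓘(ℝ, ℝ) ∞ f x)
    (h : FormSmoothAt I η x) (u v : TangentSpace I x) :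
    vD I (fun x => f x • η x) x u v =
      mvfderiv I f x u • η x v - mvfderiv I f x v • η x u + f x • vD I η x u v := by
  have hfd : DifferentiableAt ℝ (f ∘ (extChartAt I x).symm) (extChartAt I x x) := by
    have := (contMDiffAt_iff.1 hf).2
    rw [ModelWithCorners.Boundaryless.range_eq_univ, contDiffWithinAt_univ] at this
    exact this.differentiableAt (by simp)
  have h1 : HasFDerivAt (vInChart I η x) _ (extChartAt I x x) :=
    (h.contDiffAt_vInChart_self.differentiableAt (by simp)).hasFDerivAt
  have h3 := hfd.hasFDerivAt.smul h1
  have e : vInChart I (fun x => f x • η x) x =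
      (f ∘ (extChartAt I x).symm) • vInChart I η x := by
    funext y; ext v; rfl
  have hx : ∀ w : E, vInChart I η x (extChartAt I x x) w = (η x : E →L[ℝ] F) w := by
    intro w
    unfold vInChart
    rw [mfderivWithin_range_extChartAt_symm, extChartAt_to_inv]
    rfl
  have key : ∀ u v : E, flatD ((f ∘ (extChartAt I x).symm) • vInChart I η x)
      (extChartAt I x x) u v =
      fderiv ℝ (f ∘ (extChartAt I x).symm) (extChartAt I x x) u • (η x : E →L[ℝ] F) v -
      fderiv ℝ (f ∘ (extChartAt I x).symm) (extChartAt I x x) v • (η x : E →L[ℝ] F) u +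
        f x • flatD (vInChart I η x) (extChartAt I x x) u v := by
    intro u v
    rw [← hx, ← hx]
    unfold flatD
    rw [h3.fderiv]
    simp only [add_apply, smul_apply,
      ContinuousLinearMap.smulRight_apply, Function.comp_apply, extChartAt_to_inv, smul_sub]
    abel
  refine (congrFun₂ (vD_eq_flatD (fun x => f x • η x) x) u v).trans ?_
  rw [e, mvfderiv_eq_fderiv_chart (hf.mdifferentiableAt (by simp)),
    mvfderiv_eq_fderiv_chart (hf.mdifferentiableAt (by simp))]
  exact (key u v).trans (congrArg (fun z => _ + f x • z) (congrFun₂ (vD_eq_flatD η x) u v).symm)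

/-- The differential of f is the pullback under f of the constant form id on F, which is closed. -/
theorem vD_mvfderiv {f : M → F} {x : M} (hf : ContMDiffAt I 𝓘(ℝ, F) ∞ f x)
    (u v : TangentSpace I x) : vD I (mvfderiv I f) x u v = 0 := by
  have : mvfderiv I f = vpull 𝓘(ℝ, F) I f (ofFlat fun _ => ContinuousLinearMap.id ℝ F) := rfl
  rw [this, vD_vpull hf (formSmoothAt_ofFlat_iff.2 contDiffAt_const)]
  refine (congrFun₂ (vD_ofFlat _ _) _ _).trans ?_
  simp [flatD]
  exact sub_self 0

omit [I.Boundaryless] [IsManifold I ∞ M] in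
theorem vD_swap (η : VForm I M F) (x : M) (u v : TangentSpace I x) :
    vD I η x u v = - vD I η x v u := by
  simp [vD]

/-- The triple formula that expresses `d (α₁ ∧ β₁ + α₂ ∧ β₂) = 0` for an exact form
`α₁ ∧ β₁ + α₂ ∧ β₂`. -/
theorem vD_wedge_cyclic {η α₁ β₁ α₂ β₂ : VForm I M ℝ} {x : M}
    (hη : ∀ᶠ y in 𝓝 x, FormSmoothAt I η y)
    (hα₁ : FormSmoothAt I α₁ x) (hβ₁ : FormSmoothAt I β₁ x)
    (hα₂ : FormSmoothAt I α₂ x) (hβ₂ : FormSmoothAt I β₂ x)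
    (h : ∀ᶠ y in 𝓝 x, ∀ u v : TangentSpace I y, vD I η y u v =
      (α₁ y u * β₁ y v - α₁ y v * β₁ y u) + (α₂ y u * β₂ y v - α₂ y v * β₂ y u))
    (u v w : TangentSpace I x) :
    (vD I α₁ x u v * β₁ x w + vD I α₁ x v w * β₁ x u + vD I α₁ x w u * β₁ x v
      - (α₁ x u * vD I β₁ x v w + α₁ x v * vD I β₁ x w u + α₁ x w * vD I β₁ x u v)) +
    (vD I α₂ x u v * β₂ x w + vD I α₂ x v w * β₂ x u + vD I α₂ x w u * β₂ x v
      - (α₂ x u * vD I β₂ x v w + α₂ x v * vD I β₂ x w u + α₂ x w * vD I β₂ x u v)) = 0 := by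
  set y₀ := extChartAt I x x with hy₀
  set g := vInChart I η x with hg
  set a₁ := vInChart I α₁ x with ha₁
  set b₁ := vInChart I β₁ x with hb₁
  set a₂ := vInChart I α₂ x with ha₂
  set b₂ := vInChart I β₂ x with hb₂
  have hcont := continuousAt_extChartAt_symm (I := I) x
  have hsymm : ∀ {y : E} (hy : y ∈ (extChartAt I x).target),
      ContMDiffAt 𝓘(ℝ, E) I ∞ (extChartAt I x).symm y := fun hy =>
    (contMDiffOn_extChartAt_symm (n := ∞) x).contMDiffAt
      ((isOpen_extChartAt_target x).mem_nhds hy)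
  have htarget : ∀ᶠ y in 𝓝 y₀, y ∈ (extChartAt I x).target :=
    (isOpen_extChartAt_target x).mem_nhds (mem_extChartAt_target x)
  -- The hypothesis on dη, transported by naturality to the chart at x.
  have hev : ∀ᶠ y in 𝓝 y₀, ∀ u v : E, fderiv ℝ g y u v - fderiv ℝ g y v u =
      (a₁ y u * b₁ y v - a₁ y v * b₁ y u) + (a₂ y u * b₂ y v - a₂ y v * b₂ y u) := by
    have e1 := hcont.eventually (p := fun y => ∀ u v : TangentSpace I y, vD I η y u v =
      (α₁ y u * β₁ y v - α₁ y v * β₁ y u) + (α₂ y u * β₂ y v - α₂ y v * β₂ y u))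
      (by rw [extChartAt_to_inv]; exact h)
    have e2 := hcont.eventually (p := fun y => FormSmoothAt I η y)
      (by rw [extChartAt_to_inv]; exact hη)
    filter_upwards [e1, e2, htarget] with y h1 h2 h3 u v
    have h4 := vD_vpull (hsymm h3) h2 (u : E) (v : E)
    rw [← vInChart_eq_vpull] at h4
    have h5 := (congrFun₂ (vD_ofFlat g y) u v)
    refine (h5.symm.trans h4).trans ((h1 _ _).trans ?_)
    simp only [ha₁, hb₁, ha₂, hb₂, vInChart_eq_vpull]
    rfl
  have hgs : ContDiffAt ℝ ∞ g y₀ := hη.self_of_nhds.contDiffAt_vInChart_self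
  have hd : ∀ {ξ : VForm I M ℝ}, FormSmoothAt I ξ x → HasFDerivAt (vInChart I ξ x)
      (fderiv ℝ (vInChart I ξ x) y₀) y₀ := fun hξ =>
    (hξ.contDiffAt_vInChart_self.differentiableAt (by simp)).hasFDerivAt
  have hg2 : HasFDerivAt (fderiv ℝ g) (fderiv ℝ (fderiv ℝ g) y₀) y₀ :=
    ((hgs.fderiv_right (m := ∞) (by simp)).differentiableAt (by simp)).hasFDerivAt
  have hs : IsSymmSndFDerivAt ℝ g y₀ :=
    hgs.isSymmSndFDerivAt (by simp; exact WithTop.coe_le_coe.2 le_top)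
  have hval : ∀ (ξ : VForm I M ℝ) (w : E), vInChart I ξ x y₀ w = (ξ x : E →L[ℝ] ℝ) w := by
    intro ξ w
    unfold vInChart
    rw [hy₀, mfderivWithin_range_extChartAt_symm, extChartAt_to_inv]
    rfl
  -- The identity in the chart, differentiated in the direction w.
  have hder : ∀ u v w : E,
      fderiv ℝ (fderiv ℝ g) y₀ w u v - fderiv ℝ (fderiv ℝ g) y₀ w v u =
      (fderiv ℝ a₁ y₀ w u * b₁ y₀ v + a₁ y₀ u * fderiv ℝ b₁ y₀ w v
        - (fderiv ℝ a₁ y₀ w v * b₁ y₀ u + a₁ y₀ v * fderiv ℝ b₁ y₀ w u)) +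
      (fderiv ℝ a₂ y₀ w u * b₂ y₀ v + a₂ y₀ u * fderiv ℝ b₂ y₀ w v
        - (fderiv ℝ a₂ y₀ w v * b₂ y₀ u + a₂ y₀ v * fderiv ℝ b₂ y₀ w u)) := by
    intro u v w
    have ev : ∀ {ψ : E → E →L[ℝ] ℝ} {ψ' : E →L[ℝ] E →L[ℝ] ℝ}, HasFDerivAt ψ ψ' y₀ → ∀ u : E,
        HasFDerivAt (fun y => ψ y u) (ψ'.flip u) y₀ := fun hψ u => by
      simpa using hψ.clm_apply (hasFDerivAt_const u y₀)
    have ev2 : ∀ u v : E, HasFDerivAt (fun y => fderiv ℝ g y u v)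
        (((fderiv ℝ (fderiv ℝ g) y₀).flip u).flip v) y₀ := fun u v => by
      have := (hg2.clm_apply (hasFDerivAt_const u y₀)).clm_apply (hasFDerivAt_const v y₀)
      simpa using this
    have hL := (ev2 u v).sub (ev2 v u)
    have hR := ((((ev (hd hα₁) u).mul (ev (hd hβ₁) v)).sub
        ((ev (hd hα₁) v).mul (ev (hd hβ₁) u))).add
      (((ev (hd hα₂) u).mul (ev (hd hβ₂) v)).sub
        ((ev (hd hα₂) v).mul (ev (hd hβ₂) u))))
    have heq : (fun y => fderiv ℝ g y u v - fderiv ℝ g y v u) =ᶠ[𝓝 y₀]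
        fun y => (a₁ y u * b₁ y v - a₁ y v * b₁ y u) + (a₂ y u * b₂ y v - a₂ y v * b₂ y u) :=
      hev.mono fun y hy => hy u v
    have := congrArg (fun L : E →L[ℝ] ℝ => L w) (hL.unique (hR.congr_of_eventuallyEq heq))
    simp only [add_apply, sub_apply, smul_apply, ContinuousLinearMap.flip_apply,
      smul_eq_mul] at this
    rw [this]
    simp only [ha₁, hb₁, ha₂, hb₂]
    ring
  have hvD : ∀ (ξ : VForm I M ℝ) (u v : E), (vD I ξ x : E → E → ℝ) u v =
      fderiv ℝ (vInChart I ξ x) y₀ u v - fderiv ℝ (vInChart I ξ x) y₀ v u := fun ξ u v =>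
    congrFun₂ (vD_eq_flatD ξ x) u v
  have key : ∀ u v w : E,
    ((vD I α₁ x : E → E → ℝ) u v * (β₁ x : E →L[ℝ] ℝ) w
      + (vD I α₁ x : E → E → ℝ) v w * (β₁ x : E →L[ℝ] ℝ) u
      + (vD I α₁ x : E → E → ℝ) w u * (β₁ x : E →L[ℝ] ℝ) v
      - ((α₁ x : E →L[ℝ] ℝ) u * (vD I β₁ x : E → E → ℝ) v w
        + (α₁ x : E →L[ℝ] ℝ) v * (vD I β₁ x : E → E → ℝ) w u
        + (α₁ x : E →L[ℝ] ℝ) w * (vD I β₁ x : E → E → ℝ) u v)) +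
    ((vD I α₂ x : E → E → ℝ) u v * (β₂ x : E →L[ℝ] ℝ) w
      + (vD I α₂ x : E → E → ℝ) v w * (β₂ x : E →L[ℝ] ℝ) u
      + (vD I α₂ x : E → E → ℝ) w u * (β₂ x : E →L[ℝ] ℝ) v
      - ((α₂ x : E →L[ℝ] ℝ) u * (vD I β₂ x : E → E → ℝ) v w
        + (α₂ x : E →L[ℝ] ℝ) v * (vD I β₂ x : E → E → ℝ) w u
        + (α₂ x : E →L[ℝ] ℝ) w * (vD I β₂ x : E → E → ℝ) u v)) = 0 := by
    intro u v w
    simp only [hvD, ← hval]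
    simp only [← ha₁, ← hb₁, ← ha₂, ← hb₂]
    have h1 := hder u v w
    have h2 := hder v w u
    have h3 := hder w u v
    have s1 := congrArg (fun L : E →L[ℝ] ℝ => L w) (hs.eq u v)
    have s2 := congrArg (fun L : E →L[ℝ] ℝ => L u) (hs.eq v w)
    have s3 := congrArg (fun L : E →L[ℝ] ℝ => L v) (hs.eq w u)
    -- In the sum over cyclic permutations of u, v, w, the second derivatives of g cancel by
    -- symmetry.
    linarith
  exact key u v w

/-- Cartan's formula for forms that are constant on two vector fields. -/
theorem vD_apply_of_const {η : VForm I M F} {X Y : ∀ x : M, TangentSpace I x} {x : M}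
    [CompleteSpace E] {a b : F}
    (h : FormSmoothAt I η x)
    (hX : MDifferentiableAt I I.tangent (fun x => (⟨x, X x⟩ : TangentBundle I M)) x)
    (hY : MDifferentiableAt I I.tangent (fun x => (⟨x, Y x⟩ : TangentBundle I M)) x)
    (ha : ∀ᶠ y in 𝓝 x, η y (X y) = a) (hb : ∀ᶠ y in 𝓝 x, η y (Y y) = b) :
    vD I η x (X x) (Y x) = - η x (VectorField.mlieBracket I X Y x) := by
  set y₀ := extChartAt I x x with hy₀
  set g := vInChart I η x with hg
  let Xc : E → E := VectorField.mpullbackWithin 𝓘(ℝ, E) I (extChartAt I x).symm X (Set.range I)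
  let Yc : E → E := VectorField.mpullbackWithin 𝓘(ℝ, E) I (extChartAt I x).symm Y (Set.range I)
  have hcont := continuousAt_extChartAt_symm (I := I) x
  have hgd : HasFDerivAt g (fderiv ℝ g y₀) y₀ :=
    (h.contDiffAt_vInChart_self.differentiableAt (by simp)).hasFDerivAt
  have hdiff : ∀ {Z : ∀ x : M, TangentSpace I x},
      MDifferentiableAt I I.tangent (fun x => (⟨x, Z x⟩ : TangentBundle I M)) x →
      DifferentiableAt ℝ (VectorField.mpullbackWithin 𝓘(ℝ, E) I (extChartAt I x).symm Z
        (Set.range I) : E → E) y₀ := by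
    intro Z hZ
    have := (mdifferentiableWithinAt_univ.2 hZ).differentiableWithinAt_mpullbackWithin_vectorField
    rw [ModelWithCorners.Boundaryless.range_eq_univ] at this ⊢
    simp only [Set.preimage_univ, Set.univ_inter] at this
    exact DifferentiableWithinAt.differentiableAt this Filter.univ_mem
  have hpair : ∀ {Z : ∀ x : M, TangentSpace I x} {c : F}, (∀ᶠ y in 𝓝 x, η y (Z y) = c) →
      ∀ᶠ y in 𝓝 y₀, g y ((VectorField.mpullbackWithin 𝓘(ℝ, E) I (extChartAt I x).symm Z
        (Set.range I) : E → E) y) = c := by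
    intro Z c hZ
    have e1 := hcont.eventually (p := fun y => η y (Z y) = c)
      (by rw [extChartAt_to_inv]; exact hZ)
    filter_upwards [e1, (isOpen_extChartAt_target x).mem_nhds (mem_extChartAt_target x)]
      with y h1 h2
    rw [← h1]
    have h3 := isInvertible_mfderivWithin_extChartAt_symm (I := I) h2
    change (η ((extChartAt I x).symm y)) _ = _
    congr 1
    exact h3.self_apply_inverse _
  have hval : ∀ w : E, g y₀ w = (η x : E →L[ℝ] F) w := by
    intro w
    rw [hg]
    unfold vInChart
    rw [hy₀, mfderivWithin_range_extChartAt_symm, extChartAt_to_inv]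
    rfl
  have hval2 : ∀ Z : ∀ x : M, TangentSpace I x,
      (VectorField.mpullbackWithin 𝓘(ℝ, E) I (extChartAt I x).symm Z
        (Set.range I) : E → E) y₀ = Z x := by
    intro Z
    have := mfderivWithin_extChartAt_symm_inverse_apply (I := I) (x := x) (Z x)
    refine Eq.trans ?_ this
    unfold VectorField.mpullbackWithin
    rw [hy₀]
    congr 1
    rw [extChartAt_to_inv]
  -- Differentiating the constant η(Z) trades the derivative of the form for the derivative of the
  -- field.
  have hder : ∀ {Z : ∀ x : M, TangentSpace I x} {c : F},
      MDifferentiableAt I I.tangent (fun x => (⟨x, Z x⟩ : TangentBundle I M)) x →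
      (∀ᶠ y in 𝓝 x, η y (Z y) = c) → ∀ w : E,
      fderiv ℝ g y₀ w (Z x : E) = - g y₀ (fderiv ℝ (VectorField.mpullbackWithin 𝓘(ℝ, E) I
        (extChartAt I x).symm Z (Set.range I) : E → E) y₀ w) := by
    intro Z c hZ hc w
    have h1 := hgd.clm_apply (hdiff hZ).hasFDerivAt
    have h2 := (hasFDerivAt_const (𝕜 := ℝ) (E := E) c y₀).congr_of_eventuallyEq (hpair hc)
    have h3 := congrArg (fun L : E →L[ℝ] F => L w) (h1.unique h2)
    simp only [add_apply, ContinuousLinearMap.comp_apply, zero_apply] at h3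
    rw [hval2] at h3
    exact eq_neg_of_add_eq_zero_right h3
  -- At its centre the chart has the identity as differential, so the bracket is the flat bracket of
  -- the chart expressions.
  have hbr : (VectorField.mlieBracket I X Y x : E) = fderiv ℝ Yc y₀ (X x : E) - fderiv ℝ Xc y₀ (Y x : E) := by
    rw [← VectorField.mlieBracketWithin_univ, VectorField.mlieBracketWithin_apply,
      mfderiv_extChartAt_self]
    erw [ContinuousLinearMap.inverse_id]
    refine (ContinuousLinearMap.id_apply (R₁ := ℝ) (M₁ := E) _).trans ?_
    unfold VectorField.lieBracketWithin
    have hset : ((extChartAt I x).symm ⁻¹' Set.univ ∩ Set.range I : Set E) = Set.univ := by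
      simp [ModelWithCorners.Boundaryless.range_eq_univ]
    rw [hset]
    change fderivWithin ℝ Yc Set.univ y₀ (Xc y₀) - fderivWithin ℝ Xc Set.univ y₀ (Yc y₀) = _
    rw [fderivWithin_univ, fderivWithin_univ]
    exact congrArg₂ _ (congrArg _ (hval2 X)) (congrArg _ (hval2 Y))
  have h1 : (vD I η x : E → E → F) (X x : E) (Y x : E) =
      fderiv ℝ g y₀ (X x : E) (Y x : E) - fderiv ℝ g y₀ (Y x : E) (X x : E) :=
    congrFun₂ (vD_eq_flatD η x) _ _
  have key : ∀ X₀ Y₀ B : E, (∀ w, fderiv ℝ g y₀ w Y₀ = - g y₀ (fderiv ℝ Yc y₀ w)) →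
      (∀ w, fderiv ℝ g y₀ w X₀ = - g y₀ (fderiv ℝ Xc y₀ w)) →
      B = fderiv ℝ Yc y₀ X₀ - fderiv ℝ Xc y₀ Y₀ →
      fderiv ℝ g y₀ X₀ Y₀ - fderiv ℝ g y₀ Y₀ X₀ = - g y₀ B := by
    rintro X₀ Y₀ _ hY₀ hX₀ rfl
    rw [hX₀, hY₀, map_sub]
    abel
  exact h1.trans ((key _ _ _ (hder hY hb) (hder hX ha) hbr).trans (congrArg Neg.neg (hval _)))

end Calculus

/-! ### Dual frames -/

section Frames

variable {E : Type*} [NormedAddCommGroup E] [NormedSpace ℝ E]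
  {H : Type*} [TopologicalSpace H] {I : ModelWithCorners ℝ E H}
  {M : Type*} [TopologicalSpace M] [ChartedSpace H M]
  {F : Type*} [NormedAddCommGroup F] [NormedSpace ℝ F]

/-- Smoothness at a point of a vector field. -/
def FieldSmoothAt [IsManifold I 1 M] (X : ∀ x : M, TangentSpace I x) (x : M) : Prop :=
  ContMDiffAt I I.tangent ∞ (fun x => (⟨x, X x⟩ : TangentBundle I M)) x

/-- The vector fields dual to the components of a coframe. -/
def dualFrame {k : ℕ} (R : VForm I M (Fin k → ℝ)) (j : Fin k) (x : M) : TangentSpace I x :=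
  (R x).inverse (Pi.single j 1)

theorem apply_dualFrame {k : ℕ} {R : VForm I M (Fin k → ℝ)} {x : M}
    (h : (R x).IsInvertible) (j : Fin k) : R x (dualFrame R j x) = Pi.single j 1 :=
  h.self_apply_inverse _

theorem eq_sum_dualFrame {k : ℕ} {R : VForm I M (Fin k → ℝ)} {x : M}
    (h : (R x).IsInvertible) (v : TangentSpace I x) :
    v = ∑ j, R x v j • dualFrame R j x := by
  have : R x v = ∑ j, R x v j • (Pi.single j 1 : Fin k → ℝ) := by
    ext i; simp [Pi.single_apply]
  rw [← h.inverse_apply_self v]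
  conv_lhs => rw [this]
  rw [map_sum]
  simp [dualFrame, h.inverse_apply_self]

theorem isInvertible_of_injective [FiniteDimensional ℝ E] {k : ℕ} (hk : Module.finrank ℝ E = k)
    {x : M} {φ : TangentSpace I x →L[ℝ] (Fin k → ℝ)} (h : Function.Injective φ) :
    φ.IsInvertible := by
  have key : ∀ φ : E →L[ℝ] (Fin k → ℝ), Function.Injective φ → φ.IsInvertible := by
    intro φ h
    refine ⟨(LinearEquiv.ofInjectiveOfFinrankEq (φ : E →ₗ[ℝ] (Fin k → ℝ)) h
      (by simp [hk])).toContinuousLinearEquiv, ?_⟩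
    ext v
    rfl
  exact key φ h

/-- The frame is the inverse of the coframe applied to constant vectors, and inversion of continuous
linear maps is smooth at invertible ones. -/
theorem fieldSmoothAt_dualFrame [CompleteSpace E] [IsManifold I ∞ M] {k : ℕ} {R : VForm I M (Fin k → ℝ)}
    {x : M} (hR : FormSmoothAt I R x) (h : (R x).IsInvertible) (j : Fin k) :
    FieldSmoothAt (dualFrame R j) x := by
  have hb : x ∈ (trivializationAt E (TangentSpace I) x).baseSet := by simp
  refine ((trivializationAt E (TangentSpace I) x).contMDiffAt_section_iff
      (IB := I) (n := ∞) (s := dualFrame R j) hb).2 ?_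
  rw [formSmoothAt_iff_self] at hR
  have hinv : ∀ {y}, y ∈ (trivializationAt E (TangentSpace I) x).baseSet →
      ((trivializationAt E (TangentSpace I) x).symmL ℝ y).IsInvertible := fun {y} hy =>
    ⟨((trivializationAt E (TangentSpace I) x).continuousLinearEquivAt ℝ y hy).symm, (trivializationAt E (TangentSpace I) x).symm_continuousLinearEquivAt_eq' hy⟩
  have hi : (coordForm I R x x).IsInvertible := h.comp (hinv hb)
  have h1 : ContMDiffAt 𝓘(ℝ, E →L[ℝ] (Fin k → ℝ)) 𝓘(ℝ, (Fin k → ℝ) →L[ℝ] E) ∞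
      ContinuousLinearMap.inverse (coordForm I R x x) :=
    hi.contDiffAt_map_inverse.contMDiffAt
  have h2 := (h1.comp x hR).clm_apply (contMDiffAt_const (c := (Pi.single j 1 : Fin k → ℝ)))
  refine h2.congr_of_eventuallyEq ?_
  filter_upwards [(trivializationAt E (TangentSpace I) x).open_baseSet.mem_nhds hb] with y hy
  have h3 : (coordForm I R x y).inverse = ((trivializationAt E (TangentSpace I) x).symmL ℝ y).inverse.comp (R y).inverse :=
    (hinv hy).inverse_comp_of_right
  have h4 : ((trivializationAt E (TangentSpace I) x).symmL ℝ y).inverse =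
      (trivializationAt E (TangentSpace I) x).continuousLinearMapAt ℝ y := by
    rw [← (trivializationAt E (TangentSpace I) x).symm_continuousLinearEquivAt_eq' hy,
      ← (trivializationAt E (TangentSpace I) x).coe_continuousLinearEquivAt_eq' hy]
    exact ContinuousLinearMap.inverse_equiv
      ((trivializationAt E (TangentSpace I) x).continuousLinearEquivAt ℝ y hy).symm
  simp only [Function.comp_apply, h3, h4]
  rw [ContinuousLinearMap.comp_apply, Bundle.Trivialization.continuousLinearMapAt_apply,
    Bundle.Trivialization.linearMapAt_apply, if_pos hy]
  rfl

/-- By definition `vD` at y is computed in the chart at y, which does not vary smoothly with y.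
Naturality allows it to be computed for all y near x in the single chart at x. -/
theorem contMDiffAt_vD_apply [I.Boundaryless] [IsManifold I ∞ M] {η : VForm I M F} {X Y : ∀ x : M, TangentSpace I x}
    {x : M} (hη : ∀ᶠ y in 𝓝 x, FormSmoothAt I η y) (hX : FieldSmoothAt X x)
    (hY : FieldSmoothAt Y x) :
    ContMDiffAt I 𝓘(ℝ, F) ∞ (fun y => vD I η y (X y) (Y y)) x := by
  set g := vInChart I η x
  have hφ : ∀ {y}, y ∈ (chartAt H x).source → ContMDiffAt I 𝓘(ℝ, E) ∞ (extChartAt I x) y :=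
    fun hy => contMDiffAt_extChartAt' hy
  have hx := mem_chart_source H x
  have hXc := (formSmoothAt_mvfderiv (hφ hx)).apply hX
  have hYc := (formSmoothAt_mvfderiv (hφ hx)).apply hY
  have hg : ContDiffAt ℝ ∞ g (extChartAt I x x) := hη.self_of_nhds.contDiffAt_vInChart_self
  have hg' : ContMDiffAt I 𝓘(ℝ, E →L[ℝ] E →L[ℝ] F) ∞ (fun y => fderiv ℝ g (extChartAt I x y)) x :=
    ContMDiffAt.comp x (hg.fderiv_right (m := ∞) (by simp)).contMDiffAt (hφ hx)
  have hmain := ((hg'.clm_apply hXc).clm_apply hYc).sub ((hg'.clm_apply hYc).clm_apply hXc)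
  refine hmain.congr_of_eventuallyEq ?_
  filter_upwards [hη, hη.eventually_nhds, chart_source_mem_nhds H x] with y h1 h2 h3
  have h4 : y ∈ (extChartAt I x).source := by simpa using h3
  have hsymm : ∀ {z : E} (hz : z ∈ (extChartAt I x).target),
      ContMDiffAt 𝓘(ℝ, E) I ∞ (extChartAt I x).symm z := fun hz =>
    (contMDiffOn_extChartAt_symm (n := ∞) x).contMDiffAt
      ((isOpen_extChartAt_target x).mem_nhds hz)
  -- Near y the form is recovered as the pullback of its own expression in the chart at x.
  have hev : ∀ᶠ z in 𝓝 y, η z = vpull 𝓘(ℝ, E) I (extChartAt I x) (ofFlat g) z := by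
    filter_upwards [(chartAt H x).open_source.mem_nhds h3] with z hz
    have hz' : z ∈ (extChartAt I x).source := by simpa using hz
    have e1 : (ofFlat g : VForm 𝓘(ℝ, E) E F) = vpull I 𝓘(ℝ, E) (extChartAt I x).symm η :=
      vInChart_eq_vpull η x
    rw [e1, ← vpull_comp η ((hsymm ((extChartAt I x).map_source hz')).mdifferentiableAt (by simp))
      ((hφ hz).mdifferentiableAt (by simp)), vpull_congr (g := id) η]
    · unfold vpull
      rw [mfderiv_id]
      rfl
    · filter_upwards [(isOpen_extChartAt_source x).mem_nhds hz'] with w hw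
      exact (extChartAt I x).left_inv hw
  have hgs : FormSmoothAt 𝓘(ℝ, E) (ofFlat g) (extChartAt I x y) :=
    formSmoothAt_ofFlat_iff.2 (FormSmoothAt.contDiffAt_vInChart ((extChartAt I x).map_source h4)
      (by rwa [(extChartAt I x).left_inv h4]))
  rw [vD_congr hev, vD_vpull (hφ h3) hgs]
  exact congrFun₂ (vD_ofFlat g _) _ _

end Frames

/-! ### Submanifolds given by local parametrizations -/

section Submanifold

variable {EQ : Type*} [NormedAddCommGroup EQ] [NormedSpace ℝ EQ]
  {HQ : Type*} [TopologicalSpace HQ] (IQ : ModelWithCorners ℝ EQ HQ)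
  {Q : Type*} [TopologicalSpace Q] [ChartedSpace HQ Q]
  {E : Type*} [NormedAddCommGroup E] [NormedSpace ℝ E]
  {H : Type*} [TopologicalSpace H] (I : ModelWithCorners ℝ E H)

/-- A local parametrization of a subset `P` of a manifold, with a smooth local retraction. -/
structure SubChart (P : Set Q) where
  /-- The open set on which the parametrization describes `P`. -/
  dom : Set Q
  /-- The domain of the parameters. -/
  cod : Set H
  isOpen_dom : IsOpen dom
  isOpen_cod : IsOpen cod
  /-- The coordinates. -/
  Φ : Q → H
  /-- The parametrization. -/
  Ψ : H → Q
  map_Φ : ∀ q ∈ P, q ∈ dom → Φ q ∈ cod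
  map_Ψ : ∀ h ∈ cod, Ψ h ∈ P
  map_Ψ_dom : ∀ h ∈ cod, Ψ h ∈ dom
  left_inv : ∀ q ∈ P, q ∈ dom → Ψ (Φ q) = q
  right_inv : ∀ h ∈ cod, Φ (Ψ h) = h
  smooth_Φ : ContMDiffOn IQ I ∞ Φ dom
  smooth_Ψ : ContMDiffOn I IQ ∞ Ψ cod

variable {IQ I} {P : Set Q}

open Classical in
/-- The chart of the subset that is given by a local parametrization. -/
def SubChart.chart (c : SubChart IQ I P) (p₀ : P) : OpenPartialHomeomorph P H where
  toFun p := c.Φ p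
  -- Outside `cod` the value is irrelevant; p₀ only makes the inverse total.
  invFun h := if hh : h ∈ c.cod then ⟨c.Ψ h, c.map_Ψ h hh⟩ else p₀
  source := Subtype.val ⁻¹' c.dom
  target := c.cod
  map_source' p hp := c.map_Φ p p.2 hp
  map_target' h hh := by simpa [hh] using c.map_Ψ_dom h hh
  left_inv' p hp := by
    have := c.map_Φ p p.2 hp
    simp only [this, dif_pos]
    exact Subtype.ext (c.left_inv p p.2 hp)
  right_inv' h hh := by simp [hh, c.right_inv h hh]
  open_source := c.isOpen_dom.preimage continuous_subtype_val
  open_target := c.isOpen_cod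
  continuousOn_toFun := c.smooth_Φ.continuousOn.comp continuous_subtype_val.continuousOn
    fun _ h => h
  continuousOn_invFun := by
    rw [Topology.IsInducing.subtypeVal.continuousOn_iff]
    exact c.smooth_Ψ.continuousOn.congr fun h hh => by simp [hh]

theorem SubChart.val_chart_symm (c : SubChart IQ I P) (p₀ : P) {h : H} (hh : h ∈ c.cod) :
    (((c.chart p₀).symm h : P) : Q) = c.Ψ h := by
  simp [SubChart.chart, hh]

/-- The charts of a subset that is covered by local parametrizations. -/
abbrev subChartedSpace (c : P → SubChart IQ I P) (hc : ∀ p : P, (p : Q) ∈ (c p).dom) :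
    ChartedSpace H P where
  atlas := Set.range fun p => (c p).chart p
  chartAt p := (c p).chart p
  mem_chart_source p := hc p
  chart_mem_atlas p := ⟨p, rfl⟩

theorem contDiffOn_of_contMDiffOn_model {f : H → H} {s : Set H} (h : ContMDiffOn I I ∞ f s) :
    ContDiffOn ℝ ∞ (I ∘ f ∘ I.symm) (I.symm ⁻¹' s ∩ Set.range I) := by
  rcases s.eq_empty_or_nonempty with rfl | ⟨x, hx⟩
  · simp [contDiffOn_empty]
  have := (contMDiffOn_iff.1 h).2 x (f x)
  simpa [chartAt_self_eq, Set.inter_assoc, Set.inter_comm] using this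

section

variable (c : P → SubChart IQ I P) (hc : ∀ p : P, (p : Q) ∈ (c p).dom)

/-- A transition map is the parametrization of one chart followed by the ambient coordinates of the
other, hence smooth. -/
theorem isManifold_sub : letI := subChartedSpace c hc; IsManifold I ∞ P := by
  let _ := subChartedSpace c hc
  refine isManifold_of_contDiffOn I ∞ P ?_
  rintro _ _ ⟨p, rfl⟩ ⟨p', rfl⟩
  refine contDiffOn_of_contMDiffOn_model (f := ((c p).chart p).symm.trans ((c p').chart p')) ?_
  have h1 := (c p').smooth_Φ.comp (s := ((c p).chart p).symm.trans ((c p').chart p') |>.source)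
    ((c p).smooth_Ψ.mono fun h hh => hh.1) (by
      rintro h ⟨hh, hh'⟩
      have := (c p).val_chart_symm p hh
      change (((c p).chart p).symm h : P).1 ∈ (c p').dom at hh'
      rwa [this] at hh')
  refine h1.congr ?_
  rintro h ⟨hh, hh'⟩
  change (c p').Φ (((c p).chart p).symm h : P).1 = _
  rw [(c p).val_chart_symm p hh]
  rfl

theorem contMDiff_val_sub : letI := subChartedSpace c hc; haveI := isManifold_sub c hc
    ContMDiff I IQ ∞ (Subtype.val : P → Q) := by
  let _ := subChartedSpace c hc
  have := isManifold_sub c hc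
  intro p
  have h1 : ContMDiffAt I I ∞ (chartAt H p) p :=
    (contMDiffOn_chart (x := p)).contMDiffAt ((chartAt H p).open_source.mem_nhds (mem_chart_source H p))
  have h2 : ContMDiffAt I IQ ∞ (c p).Ψ (chartAt H p p) :=
    (c p).smooth_Ψ.contMDiffAt ((c p).isOpen_cod.mem_nhds ((c p).map_Φ p p.2 (hc p)))
  refine (h2.comp p h1).congr_of_eventuallyEq ?_
  filter_upwards [(chartAt H p).open_source.mem_nhds (mem_chart_source H p)] with q hq
  exact ((c p).left_inv q q.2 hq).symm

/-- The map in question is the preferred chart at p. -/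
theorem mfderiv_coord_injective_sub : letI := subChartedSpace c hc; haveI := isManifold_sub c hc
    ∀ p : P, Function.Injective (mfderiv I I (fun q : P => (c p).Φ q) p) := by
  let _ := subChartedSpace c hc
  have := isManifold_sub c hc
  intro p
  exact (mdifferentiable_chart (I := I) p).mfderiv_injective (mem_chart_source H p)

/-- The coordinates on P factor through the inclusion, so the injective differential of the
composite makes the inclusion an immersion. -/
theorem mfderiv_val_injective_sub : letI := subChartedSpace c hc; haveI := isManifold_sub c hc
    ∀ p : P, Function.Injective (mfderiv I IQ (Subtype.val : P → Q) p) := by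
  let _ := subChartedSpace c hc
  have := isManifold_sub c hc
  intro p
  have h1 := mfderiv_coord_injective_sub c hc p
  have h2 : MDifferentiableAt IQ I (c p).Φ p :=
    ((c p).smooth_Φ.contMDiffAt ((c p).isOpen_dom.mem_nhds (hc p))).mdifferentiableAt (by simp)
  have h3 := (contMDiff_val_sub c hc p).mdifferentiableAt (by simp)
  have h4 := mfderiv_comp p h2 h3
  have h5 : (fun q : P => (c p).Φ q) = (c p).Φ ∘ Subtype.val := rfl
  rw [h5, h4] at h1
  exact Function.Injective.of_comp h1

/-- P is embedded: it has the subspace topology, and its charts are restrictions of smooth maps on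
open sets of the ambient manifold. -/
theorem contMDiffAt_into_sub {E' : Type*} [NormedAddCommGroup E'] [NormedSpace ℝ E']
    {H' : Type*} [TopologicalSpace H'] {I' : ModelWithCorners ℝ E' H'}
    {N : Type*} [TopologicalSpace N] [ChartedSpace H' N] :
    letI := subChartedSpace c hc; haveI := isManifold_sub c hc
    ∀ {f : N → P} {x : N}, ContMDiffAt I' IQ ∞ (fun y => (f y : Q)) x → ContMDiffAt I' I ∞ f x := by
  let _ := subChartedSpace c hc
  have := isManifold_sub c hc
  intro f x hf
  have hcont : ContinuousAt f x :=
    (Topology.IsInducing.subtypeVal.continuousAt_iff).2 hf.continuousAt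
  have h1 : ContMDiffAt IQ I ∞ (c (f x)).Φ (f x) :=
    (c (f x)).smooth_Φ.contMDiffAt ((c (f x)).isOpen_dom.mem_nhds (hc (f x)))
  have h2 : ContMDiffAt I' I ∞ (fun y => (c (f x)).Φ (f y)) x := h1.comp x hf
  have h3 : ContMDiffAt I I ∞ (chartAt H (f x)).symm (chartAt H (f x) (f x)) :=
    (contMDiffOn_chart_symm (x := f x)).contMDiffAt ((chartAt H (f x)).open_target.mem_nhds
      ((chartAt H (f x)).map_source (mem_chart_source H (f x))))
  refine (h3.comp x h2).congr_of_eventuallyEq ?_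
  filter_upwards [hcont.preimage_mem_nhds ((chartAt H (f x)).open_source.mem_nhds
    (mem_chart_source H (f x)))] with y hy
  exact ((chartAt H (f x)).left_inv hy).symm

end

end Submanifold

/-! ### The structure equations in real form -/

section Structure

/-- The real form of the structure equations for the values `a`, `b` of a tuple of forms
`(Λ, σ, ρ, ξ, η)` on two vectors and the values `τ` of its exterior derivative, with `ζ = ξ + i η`. -/
def StructureRel (J : Fin 6 → ℂ) (τ a b : Fin 5 → ℝ) : Prop :=
  let w : Fin 5 → Fin 5 → ℝ := fun i j => a i * b j - a j * b i
  τ 1 = 3 * w 0 1 + 2 * w 2 3 ∧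
  τ 2 = 2 * w 0 2 + 2 * w 3 4 ∧
  (τ 3 + τ 4 * Complex.I : ℂ) = (w 0 3 + w 0 4 * Complex.I) + J 1 * w 1 2
    + J 2 * (w 1 3 + w 1 4 * Complex.I) + J 3 * (w 1 3 - w 1 4 * Complex.I)
    + J 4 * (w 2 3 + w 2 4 * Complex.I) + J 5 * (w 2 3 - w 2 4 * Complex.I) ∧
  (τ 0 : ℂ) = Complex.I / 2 * J 1 * (w 1 3 - w 1 4 * Complex.I)
    - Complex.I / 2 * star (J 1) * (w 1 3 + w 1 4 * Complex.I)
    - 1 / 3 * (J 2 + star (J 3)) * (w 2 3 + w 2 4 * Complex.I)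
    - 1 / 3 * (star (J 2) + J 3) * (w 2 3 - w 2 4 * Complex.I)
    + J 0 * w 1 2

/-- The weights of `(Λ, σ, ρ, ξ, η)`. -/
def formWeight : Fin 5 → ℕ := ![0, 3, 2, 1, 1]

/-- The weights of the coefficients. -/
def coeffWeight : Fin 6 → ℕ := ![5, 4, 3, 3, 2, 2]

/-- Here l and m are the values of d log|f| on the two vectors. A form θ of weight w satisfies d(f^w
θ) = f^w (w d log|f| ∧ θ + dθ), and the first term is absorbed by the replacement of Λ by Λ + d
log|f| in w Λ∧θ. All other terms scale by their weights, so each coefficient has weight equal to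
that of its 2-form minus that of the equation: 3 + 2 - 1 = 4 for J 1, and 3 + 2 - 0 = 5 for J 0. -/
theorem StructureRel.scale {J : Fin 6 → ℂ} {τ a b τ' a' b' : Fin 5 → ℝ} (h : StructureRel J τ a b)
    {f l m : ℝ} (hf : f ≠ 0)
    (ha : ∀ j, a' j = f ^ formWeight j * a j + (Pi.single 0 1 : Fin 5 → ℝ) j * l)
    (hb : ∀ j, b' j = f ^ formWeight j * b j + (Pi.single 0 1 : Fin 5 → ℝ) j * m)
    (hτ : ∀ j, τ' j = formWeight j * f ^ formWeight j * (l * b j - m * a j) +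
      f ^ formWeight j * τ j) :
    StructureRel (fun k => ((f ^ coeffWeight k)⁻¹ : ℝ) * J k) τ' a' b' := by
  have hfc : (f : ℂ) ≠ 0 := by exact_mod_cast hf
  obtain ⟨h1, h2, h3, h4⟩ := h
  have ha0 := ha 0
  have ha1 := ha 1
  have ha2 := ha 2
  have ha3 := ha 3
  have ha4 := ha 4
  have hb0 := hb 0
  have hb1 := hb 1
  have hb2 := hb 2
  have hb3 := hb 3
  have hb4 := hb 4
  have ht0 := hτ 0
  have ht1 := hτ 1
  have ht2 := hτ 2
  have ht3 := hτ 3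
  have ht4 := hτ 4
  simp [formWeight] at ha0 ha1 ha2 ha3 ha4 hb0 hb1 hb2 hb3 hb4 ht0 ht1 ht2 ht3 ht4
  refine ⟨?_, ?_, ?_, ?_⟩
  · simp only [ha0, ha1, ha2, ha3, hb0, hb1, hb2, hb3, ht1, h1]
    ring
  · simp only [ha0, ha2, ha3, ha4, hb0, hb2, hb3, hb4, ht2, h2]
    ring
  · simp only [ha0, ha1, ha2, ha3, ha4, hb0, hb1, hb2, hb3, hb4, ht3, ht4, coeffWeight]
    simp
    push_cast at h3
    field_simp
    linear_combination h3
  · simp only [ha1, ha2, ha3, ha4, hb1, hb2, hb3, hb4, ht0, coeffWeight]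
    simp
    push_cast at h4
    simp at h4
    field_simp
    linear_combination 6 * h4

variable {E : Type*} [NormedAddCommGroup E] [NormedSpace ℝ E]
  {H : Type*} [TopologicalSpace H] {I : ModelWithCorners ℝ E H} [I.Boundaryless]
  {M : Type*} [TopologicalSpace M] [ChartedSpace H M] [IsManifold I ∞ M]

/-- The component of a tuple of real forms. -/
def rcomp {k : ℕ} (t : VForm I M (Fin k → ℝ)) (j : Fin k) : VForm I M ℝ :=
  fun x => (ContinuousLinearMap.proj j : (Fin k → ℝ) →L[ℝ] ℝ).comp (t x)

omit [I.Boundaryless] [IsManifold I ∞ M] in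
theorem rcomp_apply {k : ℕ} (t : VForm I M (Fin k → ℝ)) (j : Fin k) (x : M)
    (u : TangentSpace I x) : rcomp t j x u = t x u j := rfl

theorem vD_rcomp {k : ℕ} {t : VForm I M (Fin k → ℝ)} {x : M} (h : FormSmoothAt I t x) (j : Fin k)
    (u v : TangentSpace I x) : vD I (rcomp t j) x u v = vD I t x u v j :=
  vD_clm_comp h _ u v

omit [I.Boundaryless] in
theorem FormSmoothAt.rcomp {k : ℕ} {t : VForm I M (Fin k → ℝ)} {x : M} (h : FormSmoothAt I t x)
    (j : Fin k) : FormSmoothAt I (rcomp t j) x := h.clm_comp _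

variable (I) in
/-- The action of a nonvanishing function `f` on tuples `(Λ, σ, ρ, ξ, η)`. -/
def vscale (f : M → ℝ) (t : VForm I M (Fin 5 → ℝ)) : VForm I M (Fin 5 → ℝ) := fun x =>
  ContinuousLinearMap.pi fun j => f x ^ formWeight j • rcomp t j x +
    (Pi.single 0 1 : Fin 5 → ℝ) j • mvfderiv I (fun y => Real.log (f y)) x

omit [I.Boundaryless] [IsManifold I ∞ M] in
theorem vscale_apply (f : M → ℝ) (t : VForm I M (Fin 5 → ℝ)) (x : M) (u : TangentSpace I x)
    (j : Fin 5) : vscale I f t x u j = f x ^ formWeight j * t x u j +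
      (Pi.single 0 1 : Fin 5 → ℝ) j * mvfderiv I (fun y => Real.log (f y)) x u := rfl

omit [I.Boundaryless] [IsManifold I ∞ M] in
theorem mvfderiv_real_comp {f : M → ℝ} {g : ℝ → ℝ} {g' : ℝ} {x : M}
    (hf : MDifferentiableAt I 𝓘(ℝ, ℝ) f x) (hg : HasDerivAt g g' (f x)) (u : TangentSpace I x) :
    mvfderiv I (fun y => g (f y)) x u = g' * mvfderiv I f x u := by
  have h1 : HasMFDerivAt 𝓘(ℝ, ℝ) 𝓘(ℝ, ℝ) g (f x) (ContinuousLinearMap.toSpanSingleton ℝ g') :=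
    hg.hasFDerivAt.hasMFDerivAt
  have h2 := h1.comp x hf.hasMFDerivAt
  have h3 : mfderiv I 𝓘(ℝ, ℝ) (fun y => g (f y)) x = _ := h2.mfderiv
  unfold mvfderiv
  rw [h3]
  exact mul_comm _ _

-- Negative f are allowed because `Real.log` is log |·|. Thus the full group ℝ \ {0} acts, not only
-- its identity component.
omit [I.Boundaryless] [IsManifold I ∞ M] in
theorem contMDiffAt_log {f : M → ℝ} {x : M} (hf : ContMDiffAt I 𝓘(ℝ, ℝ) ∞ f x) (h0 : f x ≠ 0) :
    ContMDiffAt I 𝓘(ℝ, ℝ) ∞ (fun y => Real.log (f y)) x :=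
  ContMDiffAt.comp x (Real.contDiffAt_log.2 h0).contMDiffAt hf

-- The logarithmic form of the power rule exhibits the weight n as the factor of d log|f|, ready to
-- be absorbed in n Λ.
omit [I.Boundaryless] [IsManifold I ∞ M] in
theorem mvfderiv_pow {f : M → ℝ} {x : M} (hf : MDifferentiableAt I 𝓘(ℝ, ℝ) f x) (h0 : f x ≠ 0)
    (n : ℕ) (u : TangentSpace I x) : mvfderiv I (fun y => f y ^ n) x u =
      n * f x ^ n * mvfderiv I (fun y => Real.log (f y)) x u := by
  rw [mvfderiv_real_comp hf (hasDerivAt_pow n (f x)),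
    mvfderiv_real_comp hf (Real.hasDerivAt_log h0)]
  cases n with
  | zero => simp
  | succ n =>
    field_simp
    simp
    ring

omit [I.Boundaryless] in
theorem FormSmoothAt.vscale {f : M → ℝ} {t : VForm I M (Fin 5 → ℝ)} {x : M}
    (hf : ContMDiffAt I 𝓘(ℝ, ℝ) ∞ f x) (h0 : f x ≠ 0) (h : FormSmoothAt I t x) :
    FormSmoothAt I (vscale I f t) x := by
  refine formSmoothAt_pi fun j => ?_
  exact FormSmoothAt.add (FormSmoothAt.smul (hf.pow _) (h.rcomp j))
    (FormSmoothAt.smul (f := fun _ => (Pi.single 0 1 : Fin 5 → ℝ) j) contMDiffAt_const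
      (formSmoothAt_mvfderiv (contMDiffAt_log hf h0)))

theorem vD_vscale {f : M → ℝ} {t : VForm I M (Fin 5 → ℝ)} {x : M}
    (hf : ContMDiffAt I 𝓘(ℝ, ℝ) ∞ f x) (h0 : f x ≠ 0) (h : FormSmoothAt I t x)
    (u v : TangentSpace I x) (j : Fin 5) :
    vD I (vscale I f t) x u v j =
      formWeight j * f x ^ formWeight j *
        (mvfderiv I (fun y => Real.log (f y)) x u * t x v j -
          mvfderiv I (fun y => Real.log (f y)) x v * t x u j) +
      f x ^ formWeight j * vD I t x u v j := by
  rw [← vD_rcomp (h.vscale hf h0)]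
  have e : rcomp (vscale I f t) j = fun x => f x ^ formWeight j • rcomp t j x +
    (Pi.single 0 1 : Fin 5 → ℝ) j • mvfderiv I (fun y => Real.log (f y)) x := rfl
  have s1 := FormSmoothAt.smul (hf.pow (formWeight j)) (h.rcomp j)
  have s2 := FormSmoothAt.smul (f := fun _ => (Pi.single 0 1 : Fin 5 → ℝ) j) contMDiffAt_const
      (formSmoothAt_mvfderiv (contMDiffAt_log hf h0))
  rw [e, vD_add s1 s2, vD_smul (hf.pow (formWeight j)) (h.rcomp j), vD_smul contMDiffAt_const
    (formSmoothAt_mvfderiv (contMDiffAt_log hf h0)), vD_mvfderiv (contMDiffAt_log hf h0),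
    vD_rcomp h, rcomp_apply, rcomp_apply]
  simp only [mvfderiv_pow (hf.mdifferentiableAt (by simp)) h0, mvfderiv_const]
  simp
  ring

theorem structureRel_vscale {f : M → ℝ} {t : VForm I M (Fin 5 → ℝ)} {x : M} {J : Fin 6 → ℂ}
    (hf : ContMDiffAt I 𝓘(ℝ, ℝ) ∞ f x) (h0 : f x ≠ 0) (h : FormSmoothAt I t x)
    {u v : TangentSpace I x} (hs : StructureRel J (vD I t x u v) (t x u) (t x v)) :
    StructureRel (fun k => ((f x ^ coeffWeight k)⁻¹ : ℝ) * J k) (vD I (vscale I f t) x u v)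
      (vscale I f t x u) (vscale I f t x v) :=
  hs.scale h0 (fun j => vscale_apply f t x u j) (fun j => vscale_apply f t x v j)
    (fun j => vD_vscale hf h0 h u v j)

end Structure

/-! ### Real tuples of forms on four-dimensional manifolds -/

section Bilinear

variable {E : Type*} [NormedAddCommGroup E] [NormedSpace ℝ E]
  {H : Type*} [TopologicalSpace H] {I : ModelWithCorners ℝ E H}
  {M : Type*} [TopologicalSpace M] [ChartedSpace H M]
  {F : Type*} [NormedAddCommGroup F] [NormedSpace ℝ F]

theorem vD_add_left (η : VForm I M F) (x : M) (u u' v : TangentSpace I x) :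
    vD I η x (u + u') v = vD I η x u v + vD I η x u' v := by
  have key : ∀ (D : E →L[ℝ] E →L[ℝ] F) (c : TangentSpace I x →L[ℝ] E),
      D (c (u + u')) (c v) - D (c v) (c (u + u')) =
        (D (c u) (c v) - D (c v) (c u)) + (D (c u') (c v) - D (c v) (c u')) := by
    intro D c
    simp only [map_add, add_apply]
    abel
  exact key _ _

theorem vD_smul_left (η : VForm I M F) (x : M) (c : ℝ) (u v : TangentSpace I x) :
    vD I η x (c • u) v = c • vD I η x u v := by
  have key : ∀ (D : E →L[ℝ] E →L[ℝ] F) (c' : TangentSpace I x →L[ℝ] E),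
      D (c' (c • u)) (c' v) - D (c' v) (c' (c • u)) = c • (D (c' u) (c' v) - D (c' v) (c' u)) := by
    intro D c'
    simp only [map_smul, smul_apply, smul_sub]
  exact key _ _

theorem vD_add_right (η : VForm I M F) (x : M) (u v v' : TangentSpace I x) :
    vD I η x u (v + v') = vD I η x u v + vD I η x u v' := by
  rw [vD_swap, vD_add_left, neg_add, ← vD_swap, ← vD_swap]

theorem vD_smul_right (η : VForm I M F) (x : M) (c : ℝ) (u v : TangentSpace I x) :
    vD I η x u (c • v) = c • vD I η x u v := by
  rw [vD_swap, vD_smul_left, ← smul_neg, ← vD_swap]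

theorem vD_self (η : VForm I M F) (x : M) (u : TangentSpace I x) : vD I η x u u = 0 := by
  simp [vD]

end Bilinear

section Tuples

variable {M : Type*} [TopologicalSpace M] [ChartedSpace (EuclideanSpace ℝ (Fin 4)) M]

/-- The last four components of a tuple `(Λ, σ, ρ, ξ, η)`. -/
def coframePart (t : VForm (𝓡 4) M (Fin 5 → ℝ)) : VForm (𝓡 4) M (Fin 4 → ℝ) := fun x =>
  ContinuousLinearMap.pi fun j => rcomp t j.succ x

theorem coframePart_apply (t : VForm (𝓡 4) M (Fin 5 → ℝ)) (x : M) (u : TangentSpace (𝓡 4) x)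
    (j : Fin 4) : coframePart t x u j = t x u j.succ := rfl

/-- The vector fields dual to `(σ, ρ, ξ, η)`. -/
def fr (t : VForm (𝓡 4) M (Fin 5 → ℝ)) (j : Fin 4) (x : M) : TangentSpace (𝓡 4) x :=
  dualFrame (coframePart t) j x

variable {t : VForm (𝓡 4) M (Fin 5 → ℝ)} {x : M}

theorem isInvertible_coframePart (h : Function.Injective (coframePart t x)) :
    (coframePart t x).IsInvertible := isInvertible_of_injective (by simp) h

theorem coframe_fr (h : Function.Injective (coframePart t x)) (i j : Fin 4) :
    t x (fr t j x) i.succ = if i = j then 1 else 0 := by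
  have := congrFun (apply_dualFrame (isInvertible_coframePart h) j) i
  rw [coframePart_apply] at this
  rw [fr, this, Pi.single_apply]

theorem eq_sum_fr (h : Function.Injective (coframePart t x)) (u : TangentSpace (𝓡 4) x) :
    u = t x u 1 • fr t 0 x + t x u 2 • fr t 1 x + t x u 3 • fr t 2 x + t x u 4 • fr t 3 x := by
  have := eq_sum_dualFrame (isInvertible_coframePart h) u
  rw [Fin.sum_univ_four] at this
  exact this

theorem clm_expand (h : Function.Injective (coframePart t x)) (L : TangentSpace (𝓡 4) x →L[ℝ] ℝ)
    (u : TangentSpace (𝓡 4) x) :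
    L u = t x u 1 * L (fr t 0 x) + t x u 2 * L (fr t 1 x) + t x u 3 * L (fr t 2 x) +
      t x u 4 * L (fr t 3 x) := by
  conv_lhs => rw [eq_sum_fr h u]
  simp

theorem vD_expand (h : Function.Injective (coframePart t x)) (η : VForm (𝓡 4) M ℝ)
    (u v : TangentSpace (𝓡 4) x) :
    vD (𝓡 4) η x u v =
      (t x u 1 * t x v 2 - t x u 2 * t x v 1) * vD (𝓡 4) η x (fr t 0 x) (fr t 1 x) +
      (t x u 1 * t x v 3 - t x u 3 * t x v 1) * vD (𝓡 4) η x (fr t 0 x) (fr t 2 x) +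
      (t x u 1 * t x v 4 - t x u 4 * t x v 1) * vD (𝓡 4) η x (fr t 0 x) (fr t 3 x) +
      (t x u 2 * t x v 3 - t x u 3 * t x v 2) * vD (𝓡 4) η x (fr t 1 x) (fr t 2 x) +
      (t x u 2 * t x v 4 - t x u 4 * t x v 2) * vD (𝓡 4) η x (fr t 1 x) (fr t 3 x) +
      (t x u 3 * t x v 4 - t x u 4 * t x v 3) * vD (𝓡 4) η x (fr t 2 x) (fr t 3 x) := by
  conv_lhs => rw [eq_sum_fr h u, eq_sum_fr h v]
  simp only [vD_add_left, vD_add_right, vD_smul_left, vD_smul_right, vD_self, smul_eq_mul]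
  rw [vD_swap η x (fr t 1 x) (fr t 0 x), vD_swap η x (fr t 2 x) (fr t 0 x),
    vD_swap η x (fr t 3 x) (fr t 0 x), vD_swap η x (fr t 2 x) (fr t 1 x),
    vD_swap η x (fr t 3 x) (fr t 1 x), vD_swap η x (fr t 3 x) (fr t 2 x)]
  ring

variable [IsManifold (𝓡 4) ∞ M]

theorem FormSmoothAt.coframePart (h : FormSmoothAt (𝓡 4) t x) :
    FormSmoothAt (𝓡 4) (coframePart t) x := formSmoothAt_pi fun j => h.rcomp j.succ

theorem fieldSmoothAt_fr (ht : FormSmoothAt (𝓡 4) t x) (h : Function.Injective (coframePart t x))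
    (j : Fin 4) : FieldSmoothAt (fr t j) x :=
  fieldSmoothAt_dualFrame ht.coframePart (isInvertible_coframePart h) j

theorem FormSmoothAt.coeff {k : ℕ} {t' : VForm (𝓡 4) M (Fin k → ℝ)} (h : FormSmoothAt (𝓡 4) t' x)
    {X : ∀ x : M, TangentSpace (𝓡 4) x} (hX : FieldSmoothAt X x) (j : Fin k) :
    ContMDiffAt (𝓡 4) 𝓘(ℝ, ℝ) ∞ (fun y => t' y (X y) j) x :=
  (h.rcomp j).apply hX

theorem contMDiffAt_vD_coeff {k : ℕ} {t' : VForm (𝓡 4) M (Fin k → ℝ)}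
    (h : ∀ᶠ y in 𝓝 x, FormSmoothAt (𝓡 4) t' y) {X Y : ∀ x : M, TangentSpace (𝓡 4) x}
    (hX : FieldSmoothAt X x) (hY : FieldSmoothAt Y x) (j : Fin k) :
    ContMDiffAt (𝓡 4) 𝓘(ℝ, ℝ) ∞ (fun y => vD (𝓡 4) t' y (X y) (Y y) j) x :=
  contMDiffAt_pi_space.1 (contMDiffAt_vD_apply h hX hY) j

theorem contMDiffAt_mvfderiv_apply {f : M → ℝ} (h : ContMDiffAt (𝓡 4) 𝓘(ℝ, ℝ) ∞ f x)
    {X : ∀ x : M, TangentSpace (𝓡 4) x} (hX : FieldSmoothAt X x) :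
    ContMDiffAt (𝓡 4) 𝓘(ℝ, ℝ) ∞ (fun y => mvfderiv (𝓡 4) f y (X y)) x :=
  (formSmoothAt_mvfderiv h).apply hX

/-- The tuple with components `∑ j, C k j • t j`. -/
def comb (C : Fin 5 → Fin 5 → M → ℝ) (t : VForm (𝓡 4) M (Fin 5 → ℝ)) :
    VForm (𝓡 4) M (Fin 5 → ℝ) := fun x =>
  ContinuousLinearMap.pi fun k => ∑ j, C k j x • rcomp t j x

omit [IsManifold (𝓡 4) ∞ M] in
theorem comb_apply (C : Fin 5 → Fin 5 → M → ℝ) (t : VForm (𝓡 4) M (Fin 5 → ℝ)) (x : M)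
    (u : TangentSpace (𝓡 4) x) (k : Fin 5) : comb C t x u k = ∑ j, C k j x * t x u j := by
  simp only [comb, ContinuousLinearMap.coe_pi', sum_apply,
    smul_apply, smul_eq_mul]
  rfl

theorem formSmoothAt_comb {C : Fin 5 → Fin 5 → M → ℝ} (h : FormSmoothAt (𝓡 4) t x)
    (hC : ∀ k j, ContMDiffAt (𝓡 4) 𝓘(ℝ, ℝ) ∞ (C k j) x) : FormSmoothAt (𝓡 4) (comb C t) x :=
  formSmoothAt_pi fun k => FormSmoothAt.sum (s := Finset.univ)
    (η := fun j y => C k j y • rcomp t j y) fun j _ => (h.rcomp j).smul (hC k j)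

theorem vD_lincomb {t' : VForm (𝓡 4) M (Fin 5 → ℝ)} {C : Fin 5 → M → ℝ} {k : Fin 5}
    (h : FormSmoothAt (𝓡 4) t x) (h' : FormSmoothAt (𝓡 4) t' x)
    (hC : ∀ j, ContMDiffAt (𝓡 4) 𝓘(ℝ, ℝ) ∞ (C j) x)
    (he : ∀ᶠ y in 𝓝 x, ∀ u, t' y u k = ∑ j, C j y * t y u j) (u v : TangentSpace (𝓡 4) x) :
    vD (𝓡 4) t' x u v k = ∑ j, (mvfderiv (𝓡 4) (C j) x u * t x v j -
      mvfderiv (𝓡 4) (C j) x v * t x u j + C j x * vD (𝓡 4) t x u v j) := by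
  rw [← vD_rcomp h']
  have e : ∀ᶠ y in 𝓝 x, rcomp t' k y = C 0 y • rcomp t 0 y + (C 1 y • rcomp t 1 y +
      (C 2 y • rcomp t 2 y + (C 3 y • rcomp t 3 y + C 4 y • rcomp t 4 y))) := by
    filter_upwards [he] with y hy
    ext u
    have := hy u
    rw [Fin.sum_univ_five] at this
    simp only [rcomp_apply, this, add_apply, smul_apply, smul_eq_mul]
    ring
  have s := fun j => FormSmoothAt.smul (hC j) (h.rcomp j)
  have s4 := s 4
  have s3 := (s 3).add s4
  have s2 := (s 2).add s3
  have s1 := (s 1).add s2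
  rw [vD_congr e, vD_add (s 0) s1, vD_add (s 1) s2, vD_add (s 2) s3, vD_add (s 3) s4]
  simp only [vD_smul (hC _) (h.rcomp _), Fin.sum_univ_five, vD_rcomp h, rcomp_apply, smul_eq_mul]
  ring

end Tuples

/-! ### Complex tangent vectors as pairs of real ones -/

section ComplexTangent

variable {E : Type*} [NormedAddCommGroup E] [NormedSpace ℝ E]
  {H : Type*} [TopologicalSpace H] {I : ModelWithCorners ℝ E H}
  {M : Type*} [TopologicalSpace M] [ChartedSpace H M] {x : M}

theorem cre_cmk (u v : TangentSpace I x) : cre I (cmk I u v) = u := by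
  simp [cre, cmk]

theorem cim_cmk (u v : TangentSpace I x) : cim I (cmk I u v) = v := by
  simp [cim, cmk]

theorem cmk_cre_cim (w : CTangent I x) : cmk I (cre I w) (cim I w) = w := by
  induction w using TensorProduct.induction_on with
  | zero => simp [cmk]
  | add a b ha hb =>
    conv_rhs => rw [← ha, ← hb]
    simp only [cmk, map_add, TensorProduct.tmul_add]
    abel
  | tmul z v =>
    simp only [cmk, cre, cim, LinearMap.comp_apply, LinearMap.rTensor_tmul, LinearEquiv.coe_coe,
      TensorProduct.lid_tmul, TensorProduct.tmul_smul]
    rw [TensorProduct.smul_tmul', TensorProduct.smul_tmul', ← TensorProduct.add_tmul]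
    congr 1
    apply Complex.ext <;> simp [Complex.reLm, Complex.imLm]

theorem cext_cmk {k : ℕ} (φ : TangentSpace I x →L[ℝ] (Fin k → ℂ)) (u v : TangentSpace I x) :
    cext I φ (cmk I u v) = φ u + Complex.I • φ v := by
  simp [cext, cmk]

end ComplexTangent

/-! ### Real tuples adapted to the CR-structure -/

section Adapted

variable {M : Type*} [TopologicalSpace M] [ChartedSpace (EuclideanSpace ℝ (Fin 4)) M]

/-- The complex components `(σ, ρ, ζ, ζ̄)` of `(Λ, σ, ρ, ξ, η)`. -/
def complexPart : (Fin 5 → ℝ) →L[ℝ] (Fin 4 → ℂ) :=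
  let e : Fin 5 → ((Fin 5 → ℝ) →L[ℝ] ℂ) := fun j => Complex.ofRealCLM.comp (ContinuousLinearMap.proj j)
  ContinuousLinearMap.pi ![e 1, e 2, e 3 + Complex.I • e 4, e 3 - Complex.I • e 4]

/-- The complex components `(Λ, σ, ρ, ζ, ζ̄)` of `(Λ, σ, ρ, ξ, η)`. -/
def complexTuple : (Fin 5 → ℝ) →L[ℝ] (Fin 5 → ℂ) :=
  let e : Fin 5 → ((Fin 5 → ℝ) →L[ℝ] ℂ) := fun j => Complex.ofRealCLM.comp (ContinuousLinearMap.proj j)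
  ContinuousLinearMap.pi ![e 0, e 1, e 2, e 3 + Complex.I • e 4, e 3 - Complex.I • e 4]

theorem complexPart_apply (a : Fin 5 → ℝ) : complexPart a =
    ![(a 1 : ℂ), a 2, a 3 + Complex.I * a 4, a 3 - Complex.I * a 4] := by
  ext j; fin_cases j <;> rfl

theorem complexTuple_apply (a : Fin 5 → ℝ) : complexTuple a =
    ![(a 0 : ℂ), a 1, a 2, a 3 + Complex.I * a 4, a 3 - Complex.I * a 4] := by
  ext j; fin_cases j <;> rfl

theorem complexTuple_succ (a : Fin 5 → ℝ) (j : Fin 4) :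
    complexTuple a j.succ = complexPart a j := by
  rw [complexPart_apply, complexTuple_apply]; rfl

variable [IsManifold (𝓡 4) ∞ M]

section

variable {x : M}

/-- The real tuple `(Λ, σ, ρ, ξ, η)` at `x` gives a coframe that is adapted to the CR-structure. -/
def CRStructure.IsRealAdapted (S : CRStructure (𝓡 4) M 1)
    (φ : TangentSpace (𝓡 4) x →L[ℝ] (Fin 5 → ℝ)) : Prop :=
  ∀ u v : TangentSpace (𝓡 4) x, cmk (𝓡 4) u v ∈ S.L x ↔
    φ u 1 = 0 ∧ φ v 1 = 0 ∧ φ u 2 = 0 ∧ φ v 2 = 0 ∧ φ u 3 = - φ v 4 ∧ φ v 3 = φ u 4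

/-- For w = u + iv, a real form kills w iff it kills u and v, and (ξ - iη)(w) has real part ξ(u) +
η(v) and imaginary part ξ(v) - η(u). -/
theorem CRStructure.isAdapted_complexPart (S : CRStructure (𝓡 4) M 1)
    (φ : TangentSpace (𝓡 4) x →L[ℝ] (Fin 5 → ℝ)) :
    S.IsAdapted (complexPart.comp φ) ↔ S.IsRealAdapted φ := by
  have key : ∀ u v : TangentSpace (𝓡 4) x,
      (cext (𝓡 4) (complexPart.comp φ) (cmk (𝓡 4) u v) 0 = 0 ∧
        cext (𝓡 4) (complexPart.comp φ) (cmk (𝓡 4) u v) 1 = 0 ∧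
        cext (𝓡 4) (complexPart.comp φ) (cmk (𝓡 4) u v) 3 = 0) ↔
      φ u 1 = 0 ∧ φ v 1 = 0 ∧ φ u 2 = 0 ∧ φ v 2 = 0 ∧ φ u 3 = - φ v 4 ∧ φ v 3 = φ u 4 := by
    intro u v
    rw [cext_cmk]
    simp only [ContinuousLinearMap.comp_apply, complexPart_apply, Pi.add_apply, Pi.smul_apply,
      Complex.ext_iff]
    simp [and_assoc]
    intros
    constructor
    · rintro ⟨h1, h2⟩
      exact ⟨by linarith, by linarith⟩
    · rintro ⟨h1, h2⟩
      exact ⟨by linarith, by linarith⟩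
  constructor
  · rintro ⟨-, h⟩ u v
    exact (h _).trans (key u v)
  · intro h
    refine ⟨fun v => ?_, fun w => ?_⟩
    · simp [ContinuousLinearMap.comp_apply, complexPart_apply, sub_eq_add_neg]
    · rw [← cmk_cre_cim w]
      exact (h _ _).trans (key _ _).symm

/-- A real vector killed by σ, ρ, ξ and η lies in L and equals its conjugate, so it vanishes by L ∩
L̄ = 0. -/
theorem CRStructure.IsRealAdapted.injective {S : CRStructure (𝓡 4) M 1}
    {t : VForm (𝓡 4) M (Fin 5 → ℝ)} (h : S.IsRealAdapted (t x)) :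
    Function.Injective (coframePart t x) := by
  rw [injective_iff_map_eq_zero]
  intro u hu
  have e : ∀ j : Fin 4, t x u j.succ = 0 := fun j => congrFun hu j
  have hm : cmk (𝓡 4) u 0 ∈ S.L x := (h u 0).2 (by
    have e0 := e 0; have e1 := e 1; have e2 := e 2; have e3 := e 3
    simp at e0 e1 e2 e3
    simp [e0, e1, e2, e3])
  have hc : cconj (𝓡 4) (cmk (𝓡 4) u 0) = cmk (𝓡 4) u 0 := by
    simp [cconj, cre_cmk, cim_cmk]
  have := S.eq_zero_of_mem_conj x _ hm (by rwa [hc])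
  rw [← cre_cmk u 0, this, map_zero]

end

end Adapted

/-! ### Prenormalized tuples -/

section Coefficients

variable {M : Type*} [TopologicalSpace M] [ChartedSpace (EuclideanSpace ℝ (Fin 4)) M]
  {t : VForm (𝓡 4) M (Fin 5 → ℝ)} {x : M}

theorem fr_apply_one (h : Function.Injective (coframePart t x)) (j : Fin 4) :
    t x (fr t j x) 1 = if 0 = j then 1 else 0 := coframe_fr h 0 j

theorem fr_apply_two (h : Function.Injective (coframePart t x)) (j : Fin 4) :
    t x (fr t j x) 2 = if 1 = j then 1 else 0 := coframe_fr h 1 j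

theorem fr_apply_three (h : Function.Injective (coframePart t x)) (j : Fin 4) :
    t x (fr t j x) 3 = if 2 = j then 1 else 0 := coframe_fr h 2 j

theorem fr_apply_four (h : Function.Injective (coframePart t x)) (j : Fin 4) :
    t x (fr t j x) 4 = if 3 = j then 1 else 0 := coframe_fr h 3 j

theorem connection_expand (h : Function.Injective (coframePart t x)) (u : TangentSpace (𝓡 4) x) :
    t x u 0 = t x u 1 * t x (fr t 0 x) 0 + t x u 2 * t x (fr t 1 x) 0 +
      t x u 3 * t x (fr t 2 x) 0 + t x u 4 * t x (fr t 3 x) 0 :=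
  clm_expand h (rcomp t 0 x) u

theorem mvfderiv_expand (h : Function.Injective (coframePart t x)) (f : M → ℝ)
    (u : TangentSpace (𝓡 4) x) :
    mvfderiv (𝓡 4) f x u = t x u 1 * mvfderiv (𝓡 4) f x (fr t 0 x) +
      t x u 2 * mvfderiv (𝓡 4) f x (fr t 1 x) +
      t x u 3 * mvfderiv (𝓡 4) f x (fr t 2 x) + t x u 4 * mvfderiv (𝓡 4) f x (fr t 3 x) :=
  clm_expand h (mvfderiv (𝓡 4) f x) u

variable [IsManifold (𝓡 4) ∞ M]

/-- The smooth tuple `t` satisfies the first two structure equations at `x`. -/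
structure IsPrenormalizedAt (t : VForm (𝓡 4) M (Fin 5 → ℝ)) (x : M) : Prop where
  smooth : FormSmoothAt (𝓡 4) t x
  injective : Function.Injective (coframePart t x)
  vD_one : ∀ u v, vD (𝓡 4) t x u v 1 = 3 * (t x u 0 * t x v 1 - t x u 1 * t x v 0) +
    2 * (t x u 2 * t x v 3 - t x u 3 * t x v 2)
  vD_two : ∀ u v, vD (𝓡 4) t x u v 2 = 2 * (t x u 0 * t x v 2 - t x u 2 * t x v 0) +
    2 * (t x u 3 * t x v 4 - t x u 4 * t x v 3)

theorem vD_tuple_expand (ht : FormSmoothAt (𝓡 4) t x) (h : Function.Injective (coframePart t x))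
    (k : Fin 5) (u v : TangentSpace (𝓡 4) x) :
    vD (𝓡 4) t x u v k =
      (t x u 1 * t x v 2 - t x u 2 * t x v 1) * vD (𝓡 4) t x (fr t 0 x) (fr t 1 x) k +
      (t x u 1 * t x v 3 - t x u 3 * t x v 1) * vD (𝓡 4) t x (fr t 0 x) (fr t 2 x) k +
      (t x u 1 * t x v 4 - t x u 4 * t x v 1) * vD (𝓡 4) t x (fr t 0 x) (fr t 3 x) k +
      (t x u 2 * t x v 3 - t x u 3 * t x v 2) * vD (𝓡 4) t x (fr t 1 x) (fr t 2 x) k +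
      (t x u 2 * t x v 4 - t x u 4 * t x v 2) * vD (𝓡 4) t x (fr t 1 x) (fr t 3 x) k +
      (t x u 3 * t x v 4 - t x u 4 * t x v 3) * vD (𝓡 4) t x (fr t 2 x) (fr t 3 x) k := by
  have := vD_expand h (rcomp t k) u v
  simpa only [vD_rcomp ht] using this

/-- This is d²σ = 0, which after substitution of dσ and dρ reads 3 dΛ∧σ = 2 ρ∧(dξ - Λ∧ξ). -/
theorem cyclic_one (h : ∀ᶠ y in 𝓝 x, IsPrenormalizedAt t y) (u v w : TangentSpace (𝓡 4) x) :
    3 * (vD (𝓡 4) t x u v 0 * t x w 1 + vD (𝓡 4) t x v w 0 * t x u 1 +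
        vD (𝓡 4) t x w u 0 * t x v 1) =
      2 * (t x u 2 * (vD (𝓡 4) t x v w 3 - (t x v 0 * t x w 3 - t x w 0 * t x v 3)) +
        t x v 2 * (vD (𝓡 4) t x w u 3 - (t x w 0 * t x u 3 - t x u 0 * t x w 3)) +
        t x w 2 * (vD (𝓡 4) t x u v 3 - (t x u 0 * t x v 3 - t x v 0 * t x u 3))) := by
  have hx := h.self_of_nhds
  have hs := hx.smooth
  have sc : ∀ (c : ℝ) (j : Fin 5), FormSmoothAt (𝓡 4)
      (fun y => (c • ContinuousLinearMap.proj j : (Fin 5 → ℝ) →L[ℝ] ℝ).comp (t y)) x :=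
    fun c j => hs.clm_comp _
  have key := vD_wedge_cyclic (η := rcomp t 1) (h.mono fun y hy => hy.smooth.rcomp 1)
    (sc 3 0) (sc 1 1) (sc 2 2) (sc 1 3) (h.mono fun y hy u v => by
      rw [vD_rcomp hy.smooth, hy.vD_one]
      simp
      ring) u v w
  simp only [vD_clm_comp hs] at key
  simp at key
  rw [hx.vD_one, hx.vD_one, hx.vD_one, hx.vD_two, hx.vD_two, hx.vD_two] at key
  linear_combination key

/-- This is d²ρ = 0, which after substitution reads dΛ∧ρ = ξ∧(dη - Λ∧η) - η∧(dξ - Λ∧ξ). -/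
theorem cyclic_two (h : ∀ᶠ y in 𝓝 x, IsPrenormalizedAt t y) (u v w : TangentSpace (𝓡 4) x) :
    vD (𝓡 4) t x u v 0 * t x w 2 + vD (𝓡 4) t x v w 0 * t x u 2 +
        vD (𝓡 4) t x w u 0 * t x v 2 =
      (t x u 3 * (vD (𝓡 4) t x v w 4 - (t x v 0 * t x w 4 - t x w 0 * t x v 4)) +
        t x v 3 * (vD (𝓡 4) t x w u 4 - (t x w 0 * t x u 4 - t x u 0 * t x w 4)) +
        t x w 3 * (vD (𝓡 4) t x u v 4 - (t x u 0 * t x v 4 - t x v 0 * t x u 4))) -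
      (t x u 4 * (vD (𝓡 4) t x v w 3 - (t x v 0 * t x w 3 - t x w 0 * t x v 3)) +
        t x v 4 * (vD (𝓡 4) t x w u 3 - (t x w 0 * t x u 3 - t x u 0 * t x w 3)) +
        t x w 4 * (vD (𝓡 4) t x u v 3 - (t x u 0 * t x v 3 - t x v 0 * t x u 3))) := by
  have hx := h.self_of_nhds
  have hs := hx.smooth
  have sc : ∀ (c : ℝ) (j : Fin 5), FormSmoothAt (𝓡 4)
      (fun y => (c • ContinuousLinearMap.proj j : (Fin 5 → ℝ) →L[ℝ] ℝ).comp (t y)) x :=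
    fun c j => hs.clm_comp _
  have key := vD_wedge_cyclic (η := rcomp t 2) (h.mono fun y hy => hy.smooth.rcomp 2)
    (sc 2 0) (sc 1 2) (sc 2 3) (sc 1 4) (h.mono fun y hy u v => by
      rw [vD_rcomp hy.smooth, hy.vD_two]
      simp
      ring) u v w
  simp only [vD_clm_comp hs] at key
  simp at key
  rw [hx.vD_two, hx.vD_two, hx.vD_two] at key
  linear_combination key / 2

/-- On E₁, E₂, E₃ the left side of `cyclic_one` vanishes and the right side isolates (dξ - Λ∧ξ)(E₂,
E₃). Hence the ξ half of dζ ≡ Λ∧ζ modulo σ, ρ is automatic, and only the η half is a normalization.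
-/
theorem vD_three_of_prenormalized (h : ∀ᶠ y in 𝓝 x, IsPrenormalizedAt t y) :
    vD (𝓡 4) t x (fr t 2 x) (fr t 3 x) 3 = - t x (fr t 3 x) 0 := by
  have hi := h.self_of_nhds.injective
  have := cyclic_one h (fr t 1 x) (fr t 2 x) (fr t 3 x)
  simp [fr_apply_one hi, fr_apply_two hi, fr_apply_three hi] at this
  linarith

omit [IsManifold (𝓡 4) ∞ M] in
theorem contMDiffAt_complex_mk {f g : M → ℝ} (hf : ContMDiffAt (𝓡 4) 𝓘(ℝ, ℝ) ∞ f x)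
    (hg : ContMDiffAt (𝓡 4) 𝓘(ℝ, ℝ) ∞ g x) :
    ContMDiffAt (𝓡 4) 𝓘(ℝ, ℂ) ∞ (fun y => (⟨f y, g y⟩ : ℂ)) x := by
  have h1 := (Complex.equivRealProdCLM.symm.contDiff (n := ∞)).contMDiff.contMDiffAt.comp x
    (hf.prodMk_space hg)
  exact h1

/-- The coefficients of the structure equations of `t`. -/
def structureCoeff (t : VForm (𝓡 4) M (Fin 5 → ℝ)) : Fin 6 → M → ℂ :=
  let D : Fin 4 → Fin 4 → Fin 5 → M → ℝ := fun i j k y => vD (𝓡 4) t y (fr t i y) (fr t j y) k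
  let l : Fin 4 → M → ℝ := fun i y => t y (fr t i y) 0
  ![fun y => ⟨D 0 1 0 y, 0⟩, fun y => ⟨D 0 1 3 y, D 0 1 4 y⟩,
    fun y => ⟨(D 0 2 3 y + D 0 3 4 y) / 2 - l 0 y, (D 0 2 4 y - D 0 3 3 y) / 2⟩,
    fun y => ⟨(D 0 2 3 y - D 0 3 4 y) / 2, (D 0 2 4 y + D 0 3 3 y) / 2⟩,
    fun y => ⟨(D 1 2 3 y + D 1 3 4 y) / 2 - l 1 y, (D 1 2 4 y - D 1 3 3 y) / 2⟩,
    fun y => ⟨(D 1 2 3 y - D 1 3 4 y) / 2, (D 1 2 4 y + D 1 3 3 y) / 2⟩]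

theorem contMDiffAt_structureCoeff (h : ∀ᶠ y in 𝓝 x, IsPrenormalizedAt t y) (k : Fin 6) :
    ContMDiffAt (𝓡 4) 𝓘(ℝ, ℂ) ∞ (structureCoeff t k) x := by
  have hx := h.self_of_nhds
  have hD : ∀ i j k, ContMDiffAt (𝓡 4) 𝓘(ℝ, ℝ) ∞
      (fun y => vD (𝓡 4) t y (fr t i y) (fr t j y) k) x := fun i j k =>
    contMDiffAt_vD_coeff (h.mono fun y hy => hy.smooth) (fieldSmoothAt_fr hx.smooth hx.injective i)
      (fieldSmoothAt_fr hx.smooth hx.injective j) k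
  have hl : ∀ i, ContMDiffAt (𝓡 4) 𝓘(ℝ, ℝ) ∞ (fun y => t y (fr t i y) 0) x := fun i =>
    hx.smooth.coeff (fieldSmoothAt_fr hx.smooth hx.injective i) 0
  have h2 : ∀ {f : M → ℝ}, ContMDiffAt (𝓡 4) 𝓘(ℝ, ℝ) ∞ f x →
      ContMDiffAt (𝓡 4) 𝓘(ℝ, ℝ) ∞ (fun y => f y / 2) x := fun hf => hf.div_const 2
  fin_cases k
  · exact contMDiffAt_complex_mk (hD _ _ _) contMDiffAt_const
  · exact contMDiffAt_complex_mk (hD _ _ _) (hD _ _ _)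
  · exact contMDiffAt_complex_mk ((h2 ((hD _ _ _).add (hD _ _ _))).sub (hl _))
      (h2 ((hD _ _ _).sub (hD _ _ _)))
  · exact contMDiffAt_complex_mk (h2 ((hD _ _ _).sub (hD _ _ _))) (h2 ((hD _ _ _).add (hD _ _ _)))
  · exact contMDiffAt_complex_mk ((h2 ((hD _ _ _).add (hD _ _ _))).sub (hl _))
      (h2 ((hD _ _ _).sub (hD _ _ _)))
  · exact contMDiffAt_complex_mk (h2 ((hD _ _ _).sub (hD _ _ _))) (h2 ((hD _ _ _).add (hD _ _ _)))

/-- The two vanishing ξ∧η coefficients of dζ - Λ∧ζ give the equation for dζ with six real 2-form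
coefficients per part reduced to the terms in σ and ρ. Then d²σ = 0 and d²ρ = 0 express dΛ through
the coefficients of dζ, leaving only its σ∧ρ term free. -/
theorem structureRel_structureCoeff (h : ∀ᶠ y in 𝓝 x, IsPrenormalizedAt t y)
    (h4 : vD (𝓡 4) t x (fr t 2 x) (fr t 3 x) 4 = t x (fr t 2 x) 0) (u v : TangentSpace (𝓡 4) x) :
    StructureRel (fun k => structureCoeff t k x) (vD (𝓡 4) t x u v) (t x u) (t x v) := by
  have hx := h.self_of_nhds
  have hi := hx.injective
  have h3 := vD_three_of_prenormalized h
  have u0 := connection_expand hi u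
  have v0 := connection_expand hi v
  refine ⟨hx.vD_one u v, hx.vD_two u v, ?_, ?_⟩
  · have e3 := vD_tuple_expand hx.smooth hi 3 u v
    have e4 := vD_tuple_expand hx.smooth hi 4 u v
    rw [h3] at e3
    rw [h4] at e4
    rw [e3, e4]
    apply Complex.ext
    · simp [structureCoeff]
      rw [u0, v0]
      ring
    · simp [structureCoeff]
      rw [u0, v0]
      ring
  · have e0 := vD_tuple_expand hx.smooth hi 0 u v
    -- Coefficients of dΛ: c1 kills ξ∧η, while c2, c3, c4, c5 determine ρ∧ξ, ρ∧η, σ∧ξ, σ∧η in this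
    -- order.
    have c1 := cyclic_one h (fr t 0 x) (fr t 2 x) (fr t 3 x)
    have c2 := cyclic_one h (fr t 0 x) (fr t 1 x) (fr t 2 x)
    have c3 := cyclic_one h (fr t 0 x) (fr t 1 x) (fr t 3 x)
    have c4 := cyclic_two h (fr t 0 x) (fr t 1 x) (fr t 2 x)
    have c5 := cyclic_two h (fr t 0 x) (fr t 1 x) (fr t 3 x)
    simp [fr_apply_one hi, fr_apply_two hi, fr_apply_three hi, fr_apply_four hi] at c1 c2 c3 c4 c5
    rw [vD_swap t x (fr t 2 x) (fr t 0 x)] at c2 c4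
    rw [vD_swap t x (fr t 3 x) (fr t 0 x)] at c3 c5
    rw [Pi.neg_apply] at c2 c3 c4 c5
    apply Complex.ext
    · simp [structureCoeff]
      linear_combination e0 + (t x u 3 * t x v 4 - t x u 4 * t x v 3) * c1 +
        (t x u 2 * t x v 3 - t x u 3 * t x v 2) * c2 / 3 +
        (t x u 2 * t x v 4 - t x u 4 * t x v 2) * c3 / 3 -
        (t x u 1 * t x v 3 - t x u 3 * t x v 1) * c4 -
        (t x u 1 * t x v 4 - t x u 4 * t x v 1) * c5
    -- The right side is real: its terms are conjugate in pairs, and the chosen J 0 is real.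
    · simp [structureCoeff]
      ring

end Coefficients

/-! ### Normalized tuples -/

section Normalized

variable {M : Type*} [TopologicalSpace M] [ChartedSpace (EuclideanSpace ℝ (Fin 4)) M]
  [IsManifold (𝓡 4) ∞ M] {S : CRStructure (𝓡 4) M 1}
  {t t' : VForm (𝓡 4) M (Fin 5 → ℝ)} {x : M}

/-- The tuple `t = (Λ, σ, ρ, ξ, η)` is smooth at `x`, adapted to the CR-structure, and satisfies the
structure equations at `x`. -/
structure CRStructure.IsNormalizedAt (S : CRStructure (𝓡 4) M 1)
    (t : VForm (𝓡 4) M (Fin 5 → ℝ)) (x : M) : Prop extends IsPrenormalizedAt t x where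
  adapted : S.IsRealAdapted (t x)
  vD_four : ∀ u v, t x u 1 = 0 → t x u 2 = 0 → t x v 1 = 0 → t x v 2 = 0 →
    vD (𝓡 4) t x u v 4 = t x u 0 * t x v 4 - t x u 4 * t x v 0

theorem CRStructure.IsNormalizedAt.structureRel (h : ∀ᶠ y in 𝓝 x, S.IsNormalizedAt t y)
    (u v : TangentSpace (𝓡 4) x) :
    StructureRel (fun k => structureCoeff t k x) (vD (𝓡 4) t x u v) (t x u) (t x v) := by
  have hx := h.self_of_nhds
  refine structureRel_structureCoeff (h.mono fun y hy => hy.toIsPrenormalizedAt) ?_ u v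
  have hi := hx.injective
  have := hx.vD_four (fr t 2 x) (fr t 3 x)
  simpa [fr_apply_one hi, fr_apply_two hi, fr_apply_four hi] using this

theorem CRStructure.isNormalizedAt_of_structureRel (hs : FormSmoothAt (𝓡 4) t x)
    (ha : S.IsRealAdapted (t x)) {J : Fin 6 → ℂ}
    (hJ : ∀ u v, StructureRel J (vD (𝓡 4) t x u v) (t x u) (t x v)) : S.IsNormalizedAt t x where
  smooth := hs
  injective := ha.injective
  vD_one u v := (hJ u v).1
  vD_two u v := (hJ u v).2.1
  adapted := ha
  vD_four u v h1 h2 h3 h4 := by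
    have := congrArg Complex.im (hJ u v).2.2.1
    simp [h1, h2, h3, h4] at this
    exact this

-- Frame vectors isolate the coefficients. The pairs (E₀, E₂) and (E₀, E₃) yield J 2 + J 3 and i(J 2
-- - J 3), and similarly with E₁ for J 4 and J 5.
omit [IsManifold (𝓡 4) ∞ M] in
theorem structureRel_unique (hi : Function.Injective (coframePart t x)) {J J' : Fin 6 → ℂ}
    {τ : TangentSpace (𝓡 4) x → TangentSpace (𝓡 4) x → Fin 5 → ℝ}
    (h : ∀ u v, StructureRel J (τ u v) (t x u) (t x v))
    (h' : ∀ u v, StructureRel J' (τ u v) (t x u) (t x v)) : J = J' := by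
  have k : ∀ i j : Fin 4, _ := fun i j => (h (fr t i x) (fr t j x)).2.2.1.symm.trans
    (h' (fr t i x) (fr t j x)).2.2.1
  have k' := (h (fr t 0 x) (fr t 1 x)).2.2.2.symm.trans (h' (fr t 0 x) (fr t 1 x)).2.2.2
  have k01 := k 0 1
  have k02 := k 0 2
  have k03 := k 0 3
  have k12 := k 1 2
  have k13 := k 1 3
  simp [fr_apply_one hi, fr_apply_two hi, fr_apply_three hi, fr_apply_four hi] at k' k01 k02 k03 k12 k13
  have hI := Complex.I_mul_I
  funext j
  fin_cases j
  · exact k'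
  · exact k01
  · show J 2 = J' 2
    linear_combination k02 / 2 - Complex.I * k03 / 2 + (J 2 - J 3 - J' 2 + J' 3) / 2 * hI
  · show J 3 = J' 3
    linear_combination k02 / 2 + Complex.I * k03 / 2 - (J 2 - J 3 - J' 2 + J' 3) / 2 * hI
  · show J 4 = J' 4
    linear_combination k12 / 2 - Complex.I * k13 / 2 + (J 4 - J 5 - J' 4 + J' 5) / 2 * hI
  · show J 5 = J' 5
    linear_combination k12 / 2 + Complex.I * k13 / 2 - (J 4 - J 5 - J' 4 + J' 5) / 2 * hI

/-- The vector E₂ - iE₃ spans L for the first tuple, so the second tuple must annihilate it with σ',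
ρ' and ζ̄'. The last two equalities are the Cauchy–Riemann equations for ζ' ≡ cζ modulo σ, ρ. -/
theorem CRStructure.IsRealAdapted.change (h : S.IsRealAdapted (t x)) (h' : S.IsRealAdapted (t' x)) :
    (t' x (fr t 2 x) 1 = 0 ∧ t' x (fr t 3 x) 1 = 0 ∧ t' x (fr t 2 x) 2 = 0 ∧
      t' x (fr t 3 x) 2 = 0) ∧ t' x (fr t 3 x) 4 = t' x (fr t 2 x) 3 ∧
      t' x (fr t 2 x) 4 = - t' x (fr t 3 x) 3 := by
  have hi := h.injective
  have hm : cmk (𝓡 4) (fr t 2 x) (- fr t 3 x) ∈ S.L x := by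
    rw [h]
    simp [fr_apply_one hi, fr_apply_two hi, fr_apply_three hi, fr_apply_four hi]
  rw [h'] at hm
  simpa [and_assoc, eq_comm] using hm

theorem CRStructure.IsRealAdapted.vscale (h : S.IsRealAdapted (t x)) {f : M → ℝ} (h0 : f x ≠ 0) :
    S.IsRealAdapted (vscale (𝓡 4) f t x) := by
  intro u v
  rw [h u v]
  simp [vscale_apply, formWeight, h0, ← mul_neg]

theorem vD_change (ht : ∀ᶠ y in 𝓝 x, FormSmoothAt (𝓡 4) t y)
    (hi : ∀ᶠ y in 𝓝 x, Function.Injective (coframePart t y)) (ht' : FormSmoothAt (𝓡 4) t' x)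
    (k : Fin 5) (u v : TangentSpace (𝓡 4) x) :
    vD (𝓡 4) t' x u v k = ∑ j : Fin 4,
      (mvfderiv (𝓡 4) (fun y => t' y (fr t j y) k) x u * t x v j.succ -
        mvfderiv (𝓡 4) (fun y => t' y (fr t j y) k) x v * t x u j.succ +
        t' x (fr t j x) k * vD (𝓡 4) t x u v j.succ) := by
  have := vD_lincomb (k := k) (C := Fin.cons (fun _ => 0) fun j y => t' y (fr t j y) k)
    ht.self_of_nhds ht' (by
      intro j
      refine Fin.cases contMDiffAt_const (fun j => ?_) j
      exact ht'.coeff (fieldSmoothAt_fr ht.self_of_nhds hi.self_of_nhds j) k)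
    (by
      filter_upwards [hi] with y hy u
      have := clm_expand hy (rcomp t' k y) u
      rw [Fin.sum_univ_succ, Fin.sum_univ_four]
      simp only [rcomp_apply] at this
      simp only [Fin.cons_zero, Fin.cons_succ]
      rw [this, show (Fin.succ 2 : Fin 5) = 3 from rfl, show (Fin.succ 3 : Fin 5) = 4 from rfl]
      simp only [Fin.succ_zero_eq_one, Fin.succ_one_eq_two]
      ring) u v
  rw [this, Fin.sum_univ_succ]
  simp [mvfderiv_const]

omit [IsManifold (𝓡 4) ∞ M] in
theorem mvfderiv_eq_zero_of_eventually {f : M → ℝ} {c : ℝ} (h : ∀ᶠ y in 𝓝 x, f y = c)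
    (u : TangentSpace (𝓡 4) x) : mvfderiv (𝓡 4) f x u = 0 := by
  have h1 : f =ᶠ[𝓝 x] fun _ => c := h
  unfold mvfderiv
  rw [h1.mfderiv_eq, mfderiv_const]
  rfl

/-- Since dσ(E₂, E₃) = 0 and dρ(E₂, E₃) = 2, the bracket [E₂, E₃] is -2E₁ modulo E₂, E₃. A form that
kills E₂ and E₃ nearby thus has exterior derivative twice its value on E₁. -/
theorem change_vD_one (h : ∀ᶠ y in 𝓝 x, S.IsNormalizedAt t y) (h' : ∀ᶠ y in 𝓝 x, S.IsNormalizedAt t' y)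
    (k : Fin 5) (hk2 : ∀ᶠ y in 𝓝 x, t' y (fr t 2 y) k = 0)
    (hk3 : ∀ᶠ y in 𝓝 x, t' y (fr t 3 y) k = 0) :
    vD (𝓡 4) t' x (fr t 2 x) (fr t 3 x) k = 2 * t' x (fr t 1 x) k := by
  have hx := h.self_of_nhds
  have hi := hx.injective
  rw [vD_change (h.mono fun y hy => hy.smooth) (h.mono fun y hy => hy.injective)
    h'.self_of_nhds.smooth, Fin.sum_univ_four, hk2.self_of_nhds, hk3.self_of_nhds]
  simp only [Fin.succ_zero_eq_one, Fin.succ_one_eq_two, mvfderiv_eq_zero_of_eventually hk2,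
    mvfderiv_eq_zero_of_eventually hk3, hx.vD_one, hx.vD_two]
  simp [fr_apply_one hi, fr_apply_two hi, fr_apply_three hi, fr_apply_four hi]
  ring

/-- The 2-form dσ' = 3Λ'∧σ' + 2ρ'∧ξ' vanishes on E₂, E₃, as σ' and ρ' do. So ker σ, spanned by L, L̄
and their bracket, is common to both tuples. -/
theorem CRStructure.IsNormalizedAt.change_one_one (h : ∀ᶠ y in 𝓝 x, S.IsNormalizedAt t y)
    (h' : ∀ᶠ y in 𝓝 x, S.IsNormalizedAt t' y) : t' x (fr t 1 x) 1 = 0 := by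
  have hc : ∀ᶠ y in 𝓝 x, _ := h.and h' |>.mono fun y hy => hy.1.adapted.change hy.2.adapted
  have e := change_vD_one h h' 1 (hc.mono fun y hy => hy.1.1) (hc.mono fun y hy => hy.1.2.1)
  obtain ⟨⟨h1, h2, h3, h4⟩, h5, h6⟩ := hc.self_of_nhds
  rw [h'.self_of_nhds.vD_one, h1, h2, h3, h4] at e
  linarith

/-- Write ζ' ≡ cζ modulo σ, ρ. The equation for dρ' on E₂, E₃ gives ρ'(E₁) = |c|². The equation for
dσ' on (E₁, E₃) gives |c|² ξ'(E₃) = 0, so c is real and equals g, and on (E₁, E₂) it gives σ'(E₀) =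
|c|² g = g³. -/
theorem CRStructure.IsNormalizedAt.change (h : ∀ᶠ y in 𝓝 x, S.IsNormalizedAt t y)
    (h' : ∀ᶠ y in 𝓝 x, S.IsNormalizedAt t' y) :
    let g := t' x (fr t 2 x) 3
    g ≠ 0 ∧ t' x (fr t 0 x) 1 = g ^ 3 ∧ t' x (fr t 1 x) 2 = g ^ 2 ∧ t' x (fr t 3 x) 3 = 0 := by
  intro g
  have hc : ∀ᶠ y in 𝓝 x, _ := h.and h' |>.mono fun y hy => hy.1.adapted.change hy.2.adapted
  have h11 : ∀ᶠ y in 𝓝 x, t' y (fr t 1 y) 1 = 0 := h.eventually_nhds.and h'.eventually_nhds |>.mono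
    fun y hy => CRStructure.IsNormalizedAt.change_one_one hy.1 hy.2
  have e := change_vD_one h h' 2 (hc.mono fun y hy => hy.1.2.2.1) (hc.mono fun y hy => hy.1.2.2.2)
  have hx := h.self_of_nhds
  have hx' := h'.self_of_nhds
  have hi := hx.injective
  -- Near x, σ' is a multiple of σ, so dσ' is that multiple of dσ up to a term containing σ.
  have e2 : ∀ v, vD (𝓡 4) t' x (fr t 1 x) v 1 = t' x (fr t 0 x) 1 * vD (𝓡 4) t x (fr t 1 x) v 1 -
      mvfderiv (𝓡 4) (fun y => t' y (fr t 0 y) 1) x v * 0 +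
      mvfderiv (𝓡 4) (fun y => t' y (fr t 0 y) 1) x (fr t 1 x) * t x v 1 := by
    intro v
    rw [vD_change (h.mono fun y hy => hy.smooth) (h.mono fun y hy => hy.injective) hx'.smooth,
      Fin.sum_univ_four, hc.self_of_nhds.1.1, hc.self_of_nhds.1.2.1, h11.self_of_nhds]
    simp only [mvfderiv_eq_zero_of_eventually h11,
      mvfderiv_eq_zero_of_eventually (hc.mono fun y hy => hy.1.1),
      mvfderiv_eq_zero_of_eventually (hc.mono fun y hy => hy.1.2.1), Fin.succ_zero_eq_one,
      fr_apply_one hi]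
    simp
    ring
  have e22 := e2 (fr t 2 x)
  have e23 := e2 (fr t 3 x)
  obtain ⟨⟨h1, h2, h3, h4⟩, h5, h6⟩ := hc.self_of_nhds
  have h7 := h11.self_of_nhds
  rw [hx'.vD_two, h3, h4, h5, h6] at e
  rw [hx.vD_one, hx'.vD_one, h1, h3, h7] at e22
  rw [hx.vD_one, hx'.vD_one, h2, h4, h7] at e23
  simp [fr_apply_one hi, fr_apply_two hi, fr_apply_three hi] at e22 e23
  have hne : fr t 2 x ≠ 0 := by
    intro h0
    have := fr_apply_three hi 2
    rw [h0] at this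
    simp at this
  -- This is c ≠ 0: otherwise the second coframe would annihilate E₂.
  have hne' : ¬ (t' x (fr t 2 x) 3 = 0 ∧ t' x (fr t 3 x) 3 = 0) := by
    rintro ⟨ha, hb⟩
    apply hne
    apply hx'.injective
    rw [map_zero]
    ext j
    rw [coframePart_apply]
    fin_cases j
    · exact h1
    · exact h3
    · exact ha
    · show t' x (fr t 2 x) 4 = 0
      rw [h6, hb, neg_zero]
  have hκ : t' x (fr t 1 x) 2 = g ^ 2 + t' x (fr t 3 x) 3 ^ 2 := by
    simp only [g]
    linear_combination - e / 2
  have hκ0 : t' x (fr t 1 x) 2 ≠ 0 := by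
    rw [hκ]
    intro h0
    exact hne' ⟨by nlinarith [sq_nonneg g, sq_nonneg (t' x (fr t 3 x) 3)],
      by nlinarith [sq_nonneg g, sq_nonneg (t' x (fr t 3 x) 3)]⟩
  have hg2 : t' x (fr t 3 x) 3 = 0 := by
    rcases e23 with h | h
    · exact absurd h hκ0
    · exact h
  rw [hg2] at hκ
  refine ⟨fun h0 => hne' ⟨h0, hg2⟩, ?_, by rw [hκ]; ring, hg2⟩
  rw [hκ] at e22
  simp only [g] at e22 ⊢
  linear_combination - e22 / 2

end Normalized

/-! ### Uniqueness of normalized tuples -/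

section Uniqueness

variable {M : Type*} [TopologicalSpace M] [ChartedSpace (EuclideanSpace ℝ (Fin 4)) M]
  [IsManifold (𝓡 4) ∞ M] {S : CRStructure (𝓡 4) M 1}
  {t t' : VForm (𝓡 4) M (Fin 5 → ℝ)} {x : M}

/-- The tuple `t'` differs from `t` by a unipotent change, apart from the first component. -/
structure IsUnipotentChange (t t' : VForm (𝓡 4) M (Fin 5 → ℝ)) (b c₁ c₂ e₁ e₂ : M → ℝ) (x : M) :
    Prop where
  smooth_b : ContMDiffAt (𝓡 4) 𝓘(ℝ, ℝ) ∞ b x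
  smooth_c₁ : ContMDiffAt (𝓡 4) 𝓘(ℝ, ℝ) ∞ c₁ x
  smooth_c₂ : ContMDiffAt (𝓡 4) 𝓘(ℝ, ℝ) ∞ c₂ x
  smooth_e₁ : ContMDiffAt (𝓡 4) 𝓘(ℝ, ℝ) ∞ e₁ x
  smooth_e₂ : ContMDiffAt (𝓡 4) 𝓘(ℝ, ℝ) ∞ e₂ x
  one : ∀ u, t' x u 1 = t x u 1
  two : ∀ u, t' x u 2 = t x u 2 + b x * t x u 1
  three : ∀ u, t' x u 3 = t x u 3 + c₁ x * t x u 2 + e₁ x * t x u 1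
  four : ∀ u, t' x u 4 = t x u 4 + c₂ x * t x u 2 + e₂ x * t x u 1

variable {b c₁ c₂ e₁ e₂ : M → ℝ}

theorem IsUnipotentChange.vD_one (h : ∀ᶠ y in 𝓝 x, IsUnipotentChange t t' b c₁ c₂ e₁ e₂ y)
    (ht : FormSmoothAt (𝓡 4) t x) (ht' : FormSmoothAt (𝓡 4) t' x) (u v : TangentSpace (𝓡 4) x) :
    vD (𝓡 4) t' x u v 1 = vD (𝓡 4) t x u v 1 := by
  rw [vD_lincomb (C := ![fun _ => 0, fun _ => 1, fun _ => 0, fun _ => 0, fun _ => 0]) ht ht'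
    (by intro j; fin_cases j <;> exact contMDiffAt_const)
    (h.mono fun y hy u => by simp [hy.one, Fin.sum_univ_five])]
  simp [Fin.sum_univ_five, mvfderiv_const]

theorem IsUnipotentChange.vD_two (h : ∀ᶠ y in 𝓝 x, IsUnipotentChange t t' b c₁ c₂ e₁ e₂ y)
    (ht : FormSmoothAt (𝓡 4) t x) (ht' : FormSmoothAt (𝓡 4) t' x) (u v : TangentSpace (𝓡 4) x) :
    vD (𝓡 4) t' x u v 2 = vD (𝓡 4) t x u v 2 + b x * vD (𝓡 4) t x u v 1 +
      (mvfderiv (𝓡 4) b x u * t x v 1 - mvfderiv (𝓡 4) b x v * t x u 1) := by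
  have hx := h.self_of_nhds
  rw [vD_lincomb (C := ![fun _ => 0, b, fun _ => 1, fun _ => 0, fun _ => 0]) ht ht'
    (by intro j; fin_cases j <;> first | exact contMDiffAt_const | exact hx.smooth_b)
    (h.mono fun y hy u => by simp [hy.two, Fin.sum_univ_five]; ring)]
  simp [Fin.sum_univ_five, mvfderiv_const]
  ring

theorem IsUnipotentChange.vD_four (h : ∀ᶠ y in 𝓝 x, IsUnipotentChange t t' b c₁ c₂ e₁ e₂ y)
    (ht : FormSmoothAt (𝓡 4) t x) (ht' : FormSmoothAt (𝓡 4) t' x) (u v : TangentSpace (𝓡 4) x) :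
    vD (𝓡 4) t' x u v 4 = vD (𝓡 4) t x u v 4 + c₂ x * vD (𝓡 4) t x u v 2 +
      e₂ x * vD (𝓡 4) t x u v 1 +
      (mvfderiv (𝓡 4) c₂ x u * t x v 2 - mvfderiv (𝓡 4) c₂ x v * t x u 2) +
      (mvfderiv (𝓡 4) e₂ x u * t x v 1 - mvfderiv (𝓡 4) e₂ x v * t x u 1) := by
  have hx := h.self_of_nhds
  rw [vD_lincomb (C := ![fun _ => 0, e₂, c₂, fun _ => 0, fun _ => 1]) ht ht'
    (by intro j; fin_cases j <;>
          first | exact contMDiffAt_const | exact hx.smooth_c₂ | exact hx.smooth_e₂)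
    (h.mono fun y hy u => by simp [hy.four, Fin.sum_univ_five]; ring)]
  simp [Fin.sum_univ_five, mvfderiv_const]
  ring

/-- Coefficients are compared. In dσ', σ∧ξ gives 3(Λ' - Λ)(E₂) = 2b and σ∧η gives (Λ' - Λ)(E₃) = 0.
In dρ', ρ∧η gives c₁ = 0 and ρ∧ξ gives c₂ = -5b/3. The normalization of dη' then requires 2b/3 = 2c₂
= -10b/3, hence b = 0. -/
theorem IsUnipotentChange.aux (h : ∀ᶠ y in 𝓝 x, IsUnipotentChange t t' b c₁ c₂ e₁ e₂ y)
    (ht : S.IsNormalizedAt t x) (ht' : S.IsNormalizedAt t' x) :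
    b x = 0 ∧ c₁ x = 0 ∧ c₂ x = 0 ∧ t' x (fr t 2 x) 0 = t x (fr t 2 x) 0 ∧
      t' x (fr t 3 x) 0 = t x (fr t 3 x) 0 ∧
      3 * (t' x (fr t 1 x) 0 - t x (fr t 1 x) 0) + 2 * e₁ x = 0 := by
  have hi := ht.injective
  have hx := h.self_of_nhds
  have s := ht.smooth
  have s' := ht'.smooth
  have e02 := vD_one h s s' (fr t 0 x) (fr t 2 x)
  have e03 := vD_one h s s' (fr t 0 x) (fr t 3 x)
  have e01 := vD_one h s s' (fr t 0 x) (fr t 1 x)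
  have f13 := vD_two h s s' (fr t 1 x) (fr t 3 x)
  have f12 := vD_two h s s' (fr t 1 x) (fr t 2 x)
  have g23 := vD_four h s s' (fr t 2 x) (fr t 3 x)
  have k := ht.vD_four (fr t 2 x) (fr t 3 x)
  have k' := ht'.vD_four (fr t 2 x) (fr t 3 x)
  simp [hx.one, hx.two, hx.four, fr_apply_one hi, fr_apply_two hi, fr_apply_four hi] at k k'
  rw [k, k'] at g23
  simp only [ht.vD_one, ht.vD_two, ht'.vD_one, ht'.vD_two, hx.one, hx.two, hx.three, hx.four,
    fr_apply_one hi, fr_apply_two hi, fr_apply_three hi, fr_apply_four hi] at e01 e02 e03 f13 f12 g23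
  simp at e01 e02 e03 f13 f12 g23
  have hb : b x = 0 := by linarith
  rw [hb] at e01
  exact ⟨hb, by linarith, by linarith, by linarith, e03, by linarith⟩

/-- Since b vanishes on a neighbourhood, so does db, and dρ' = dρ. Its coefficients of σ∧ξ, σ∧η and
σ∧ρ give e₂ = 0, e₁ = 0 and equality of Λ and Λ' on E₀; the last relation of `aux` then gives
equality on E₁. -/
theorem IsUnipotentChange.eq (h : ∀ᶠ y in 𝓝 x, IsUnipotentChange t t' b c₁ c₂ e₁ e₂ y)
    (ht : ∀ᶠ y in 𝓝 x, S.IsNormalizedAt t y) (ht' : ∀ᶠ y in 𝓝 x, S.IsNormalizedAt t' y) :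
    t' x = t x := by
  have ha : ∀ᶠ y in 𝓝 x, b y = 0 := (h.eventually_nhds.and (ht.and ht')).mono
    fun y hy => (aux hy.1 hy.2.1 hy.2.2).1
  obtain ⟨hb, h1, h2, hl2, hl3, hl1⟩ := aux h ht.self_of_nhds ht'.self_of_nhds
  have hx := h.self_of_nhds
  have hn := ht.self_of_nhds
  have hn' := ht'.self_of_nhds
  have hi := hn.injective
  have f02 := vD_two h hn.smooth hn'.smooth (fr t 0 x) (fr t 2 x)
  have f03 := vD_two h hn.smooth hn'.smooth (fr t 0 x) (fr t 3 x)
  have f01 := vD_two h hn.smooth hn'.smooth (fr t 0 x) (fr t 1 x)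
  simp only [mvfderiv_eq_zero_of_eventually ha, hn.vD_one, hn.vD_two, hn'.vD_two,
    hx.two, hx.three, hx.four, hb, h1, h2, fr_apply_one hi, fr_apply_two hi,
    fr_apply_three hi, fr_apply_four hi] at f01 f02 f03
  simp at f01 f02 f03
  rw [f03] at hl1
  have hl1' : t' x (fr t 1 x) 0 = t x (fr t 1 x) 0 := by linarith
  ext u j
  fin_cases j
  · show t' x u 0 = t x u 0
    rw [connection_expand hi u]
    have := clm_expand hi (rcomp t' 0 x) u
    simp only [rcomp_apply] at this
    rw [this, f01, hl1', hl2, hl3]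
  · exact hx.one u
  · exact (hx.two u).trans (by simp [hb])
  · exact (hx.three u).trans (by simp [h1, f03])
  · exact (hx.four u).trans (by simp [h2, f02])

theorem CRStructure.IsNormalizedAt.rescale (h : ∀ᶠ y in 𝓝 x, S.IsNormalizedAt t y) {f : M → ℝ}
    (hf : ContMDiffAt (𝓡 4) 𝓘(ℝ, ℝ) ∞ f x) (h0 : f x ≠ 0) :
    S.IsNormalizedAt (vscale (𝓡 4) f t) x :=
  CRStructure.isNormalizedAt_of_structureRel (h.self_of_nhds.smooth.vscale hf h0)
    (h.self_of_nhds.adapted.vscale h0) fun u v =>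
      structureRel_vscale hf h0 h.self_of_nhds.smooth (structureRel h u v)

/-- By `change` the diagonal part of the transition is exactly the scaling by g. The scaled tuple is
again normalized, and it differs from t' by a unipotent change, which is trivial. -/
theorem CRStructure.IsNormalizedAt.eq_vscale (h : ∀ᶠ y in 𝓝 x, S.IsNormalizedAt t y)
    (h' : ∀ᶠ y in 𝓝 x, S.IsNormalizedAt t' y) :
    t' x = vscale (𝓡 4) (fun y => t' y (fr t 2 y) 3) t x := by
  set g : M → ℝ := fun y => t' y (fr t 2 y) 3 with hg
  have hc : ∀ᶠ y in 𝓝 x, (_ ∧ _) := (h.and h').mono fun y hy => hy.1.adapted.change hy.2.adapted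
  have h11 : ∀ᶠ y in 𝓝 x, t' y (fr t 1 y) 1 = 0 := (h.eventually_nhds.and h'.eventually_nhds).mono
    fun y hy => change_one_one hy.1 hy.2
  have hch : ∀ᶠ y in 𝓝 x, _ ≠ _ ∧ _ := (h.eventually_nhds.and h'.eventually_nhds).mono
    fun y hy => change hy.1 hy.2
  have hsm : ∀ᶠ y in 𝓝 x, ∀ j k, ContMDiffAt (𝓡 4) 𝓘(ℝ, ℝ) ∞ (fun z => t' z (fr t j z) k) y :=
    (h.and h').mono fun y hy j k =>
      hy.2.smooth.coeff (fieldSmoothAt_fr hy.1.smooth hy.1.injective j) k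
  have hpow : ∀ (n : ℕ) j k, ∀ᶠ y in 𝓝 x, ContMDiffAt (𝓡 4) 𝓘(ℝ, ℝ) ∞
      (fun z => t' z (fr t j z) k / g z ^ n) y := fun n j k => by
    filter_upwards [hsm, hch] with y hy hy'
    exact (hy j k).div₀ ((hy 2 3).pow n) (pow_ne_zero n hy'.1)
  refine IsUnipotentChange.eq (S := S) (t := vscale (𝓡 4) g t)
    (b := fun y => t' y (fr t 0 y) 2 / g y ^ 3) (c₁ := fun y => t' y (fr t 1 y) 3 / g y ^ 2)
    (c₂ := fun y => t' y (fr t 1 y) 4 / g y ^ 2) (e₁ := fun y => t' y (fr t 0 y) 3 / g y ^ 3)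
    (e₂ := fun y => t' y (fr t 0 y) 4 / g y ^ 3) ?_ ?_ h'
  · filter_upwards [h, hc, h11, hch, hpow 3 0 2, hpow 2 1 3, hpow 2 1 4, hpow 3 0 3, hpow 3 0 4]
      with y hy hcy h11y hchy s1 s2 s3 s4 s5
    obtain ⟨⟨a1, a2, a3, a4⟩, a5, a6⟩ := hcy
    obtain ⟨d0, d1, d2, d3⟩ := hchy
    have ex : ∀ u k, _ := fun u k => clm_expand hy.injective (rcomp t' k y) u
    simp only [rcomp_apply] at ex
    have hg0 : g y ≠ 0 := d0
    have hgy : t' y (fr t 2 y) 3 = g y := rfl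
    rw [hgy] at d1 d2 a5
    refine ⟨s1, s2, s3, s4, s5, fun u => ?_, fun u => ?_, fun u => ?_, fun u => ?_⟩
    · rw [ex u 1, a1, a2, h11y, d1, vscale_apply]
      simp [formWeight]
      ring
    · rw [ex u 2, a3, a4, d2, vscale_apply, vscale_apply]
      simp [formWeight]
      field_simp
      ring
    · rw [ex u 3, hgy, d3, vscale_apply, vscale_apply, vscale_apply]
      simp [formWeight]
      field_simp
      ring
    · rw [ex u 4, a5, a6, d3, vscale_apply, vscale_apply, vscale_apply]
      simp [formWeight]
      field_simp
      ring
  · filter_upwards [h.eventually_nhds, hsm, hch] with y hy hs hc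
    exact rescale hy (hs 2 3) hc.1

/-- The tuple t' satisfies the structure equations with its own coefficients and, as a scaling of t,
with the rescaled ones; coefficients are unique. -/
theorem CRStructure.IsNormalizedAt.coeff_eq (h : ∀ᶠ y in 𝓝 x, S.IsNormalizedAt t y)
    (h' : ∀ᶠ y in 𝓝 x, S.IsNormalizedAt t' y) (k : Fin 6) :
    structureCoeff t' k x =
      ((t' x (fr t 2 x) 3 ^ coeffWeight k)⁻¹ : ℝ) * structureCoeff t k x := by
  have he : ∀ᶠ y in 𝓝 x, t' y = _ := (h.eventually_nhds.and h'.eventually_nhds).mono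
    fun y hy => eq_vscale hy.1 hy.2
  have hx := h.self_of_nhds
  have hf := h'.self_of_nhds.smooth.coeff (fieldSmoothAt_fr hx.smooth hx.injective 2) 3
  have h1 := fun u v => structureRel h' u v
  have h2 := fun u v => structureRel_vscale hf (change h h').1 hx.smooth (structureRel h u v)
  rw [← vD_congr he, ← he.self_of_nhds] at h2
  exact congrFun (structureRel_unique h'.self_of_nhds.injective h1 h2) k

end Uniqueness

/-! ### Existence of normalized tuples, starting from preadapted tuples -/

section Normalization

variable {M : Type*} [TopologicalSpace M] [ChartedSpace (EuclideanSpace ℝ (Fin 4)) M]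
  [IsManifold (𝓡 4) ∞ M] {S : CRStructure (𝓡 4) M 1}
  {t t' : VForm (𝓡 4) M (Fin 5 → ℝ)} {x : M}

/-- The unipotent change of `t` with the given coefficients, where the first component becomes
`∑ j, l j • t j`. -/
def unipotentChange (l : Fin 5 → M → ℝ) (b c₁ c₂ e₁ e₂ : M → ℝ) (t : VForm (𝓡 4) M (Fin 5 → ℝ)) :
    VForm (𝓡 4) M (Fin 5 → ℝ) :=
  comb ![l, ![fun _ => 0, fun _ => 1, fun _ => 0, fun _ => 0, fun _ => 0],
    ![fun _ => 0, b, fun _ => 1, fun _ => 0, fun _ => 0],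
    ![fun _ => 0, e₁, c₁, fun _ => 1, fun _ => 0],
    ![fun _ => 0, e₂, c₂, fun _ => 0, fun _ => 1]] t

variable {l : Fin 5 → M → ℝ} {b c₁ c₂ e₁ e₂ : M → ℝ}

omit [IsManifold (𝓡 4) ∞ M] in
theorem unipotentChange_zero (u : TangentSpace (𝓡 4) x) :
    unipotentChange l b c₁ c₂ e₁ e₂ t x u 0 = ∑ j, l j x * t x u j := comb_apply _ _ _ _ _

omit [IsManifold (𝓡 4) ∞ M] in
theorem isUnipotentChange (hb : ContMDiffAt (𝓡 4) 𝓘(ℝ, ℝ) ∞ b x)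
    (hc₁ : ContMDiffAt (𝓡 4) 𝓘(ℝ, ℝ) ∞ c₁ x) (hc₂ : ContMDiffAt (𝓡 4) 𝓘(ℝ, ℝ) ∞ c₂ x)
    (he₁ : ContMDiffAt (𝓡 4) 𝓘(ℝ, ℝ) ∞ e₁ x) (he₂ : ContMDiffAt (𝓡 4) 𝓘(ℝ, ℝ) ∞ e₂ x) :
    IsUnipotentChange t (unipotentChange l b c₁ c₂ e₁ e₂ t) b c₁ c₂ e₁ e₂ x where
  smooth_b := hb
  smooth_c₁ := hc₁
  smooth_c₂ := hc₂
  smooth_e₁ := he₁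
  smooth_e₂ := he₂
  one u := by
    rw [unipotentChange, comb_apply]
    simp [Fin.sum_univ_five]
  two u := by
    rw [unipotentChange, comb_apply]
    simp [Fin.sum_univ_five]
    ring
  three u := by
    rw [unipotentChange, comb_apply]
    simp [Fin.sum_univ_five]
    ring
  four u := by
    rw [unipotentChange, comb_apply]
    simp [Fin.sum_univ_five]
    ring

theorem IsUnipotentChange.formSmoothAt
    (h : IsUnipotentChange t (unipotentChange l b c₁ c₂ e₁ e₂ t) b c₁ c₂ e₁ e₂ x)
    (hl : ∀ j, ContMDiffAt (𝓡 4) 𝓘(ℝ, ℝ) ∞ (l j) x)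
    (ht : FormSmoothAt (𝓡 4) t x) : FormSmoothAt (𝓡 4) (unipotentChange l b c₁ c₂ e₁ e₂ t) x := by
  refine formSmoothAt_comb ht fun k j => ?_
  fin_cases k
  · exact hl j
  all_goals
    fin_cases j <;> first
    | exact contMDiffAt_const
    | exact h.smooth_b
    | exact h.smooth_c₁
    | exact h.smooth_c₂
    | exact h.smooth_e₁
    | exact h.smooth_e₂

theorem IsUnipotentChange.adapted (h : IsUnipotentChange t t' b c₁ c₂ e₁ e₂ x)
    (ha : S.IsRealAdapted (t x)) : S.IsRealAdapted (t' x) := by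
  intro u v
  rw [ha u v, h.one, h.one, h.two, h.two, h.three, h.three, h.four, h.four]
  constructor
  · rintro ⟨h1, h2, h3, h4, h5, h6⟩
    simp [h1, h2, h3, h4, h5, h6]
  · rintro ⟨h1, h2, h3, h4, h5, h6⟩
    simp only [h1, h2, mul_zero, add_zero] at h3 h4 h5 h6
    simp only [h3, h4, mul_zero, add_zero] at h5 h6
    exact ⟨h1, h2, h3, h4, h5, h6⟩

/-- The smooth tuple `t` is adapted to the CR-structure, with `dσ = 2 ρ ∧ ξ` modulo `σ` and
`dρ = 2 ξ ∧ η` modulo `σ, ρ`. -/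
structure CRStructure.IsPreadaptedAt (S : CRStructure (𝓡 4) M 1)
    (t : VForm (𝓡 4) M (Fin 5 → ℝ)) (x : M) : Prop where
  smooth : FormSmoothAt (𝓡 4) t x
  adapted : S.IsRealAdapted (t x)
  vD_one : ∀ u v, t x u 1 = 0 → t x v 1 = 0 →
    vD (𝓡 4) t x u v 1 = 2 * (t x u 2 * t x v 3 - t x u 3 * t x v 2)
  vD_two : ∀ u v, t x u 1 = 0 → t x u 2 = 0 → t x v 1 = 0 → t x v 2 = 0 →
    vD (𝓡 4) t x u v 2 = 2 * (t x u 3 * t x v 4 - t x u 4 * t x v 3)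

/-- With b = 0, the four components of Λ and c₁, c₂, e₁, e₂ are eight unknowns for the eight
coefficients of dσ and dρ not prescribed by preadaptedness: three in dσ and five in dρ. -/
theorem CRStructure.IsPreadaptedAt.exists_prenormalized
    (h : ∀ᶠ y in 𝓝 x, S.IsPreadaptedAt t y) :
    ∃ t' : VForm (𝓡 4) M (Fin 5 → ℝ), ∀ᶠ y in 𝓝 x,
      IsPrenormalizedAt t' y ∧ S.IsRealAdapted (t' y) := by
  let D : Fin 4 → Fin 4 → Fin 5 → M → ℝ := fun i j k y => vD (𝓡 4) t y (fr t i y) (fr t j y) k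
  have hD : ∀ᶠ y in 𝓝 x, ∀ i j k, ContMDiffAt (𝓡 4) 𝓘(ℝ, ℝ) ∞ (D i j k) y := by
    filter_upwards [h.eventually_nhds] with y hy i j k
    have hy' := hy.self_of_nhds
    exact contMDiffAt_vD_coeff (hy.mono fun z hz => hz.smooth)
      (fieldSmoothAt_fr hy'.smooth hy'.adapted.injective i)
      (fieldSmoothAt_fr hy'.smooth hy'.adapted.injective j) k
  -- In dρ, the coefficients of ρ∧ξ, ρ∧η, σ∧ξ, σ∧η determine c₂, c₁, e₂, e₁. In `l`, the σ entry
  -- comes from σ∧ρ in dρ, and the ρ, ξ, η entries come from σ∧ρ, σ∧ξ, σ∧η in dσ.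
  let c₂ : M → ℝ := fun y => (-D 1 2 2 y + 2 / 3 * D 0 2 1 y) / 2
  let c₁ : M → ℝ := fun y => (D 1 3 2 y - 2 / 3 * D 0 3 1 y) / 2
  let e₂ : M → ℝ := fun y => -D 0 2 2 y / 2
  let e₁ : M → ℝ := fun y => D 0 3 2 y / 2
  let l : Fin 5 → M → ℝ := ![fun _ => 0, fun y => c₁ y * e₂ y - e₁ y * c₂ y + D 0 1 2 y / 2,
    fun y => -D 0 1 1 y / 3 - 2 / 3 * e₁ y, fun y => -D 0 2 1 y / 3, fun y => -D 0 3 1 y / 3]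
  have hsm : ∀ᶠ y in 𝓝 x, ContMDiffAt (𝓡 4) 𝓘(ℝ, ℝ) ∞ c₁ y ∧ ContMDiffAt (𝓡 4) 𝓘(ℝ, ℝ) ∞ c₂ y ∧
      ContMDiffAt (𝓡 4) 𝓘(ℝ, ℝ) ∞ e₁ y ∧ ContMDiffAt (𝓡 4) 𝓘(ℝ, ℝ) ∞ e₂ y := by
    filter_upwards [hD] with y hy
    exact ⟨((hy _ _ _).sub (contMDiffAt_const.mul (hy _ _ _))).div_const _,
      ((hy _ _ _).neg.add (contMDiffAt_const.mul (hy _ _ _))).div_const _,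
      (hy _ _ _).div_const _, (hy _ _ _).neg.div_const _⟩
  have hu : ∀ᶠ y in 𝓝 x, IsUnipotentChange t (unipotentChange l (fun _ => 0) c₁ c₂ e₁ e₂ t)
      (fun _ => 0) c₁ c₂ e₁ e₂ y :=
    hsm.mono fun y hy => isUnipotentChange contMDiffAt_const hy.1 hy.2.1 hy.2.2.1 hy.2.2.2
  refine ⟨unipotentChange l (fun _ => 0) c₁ c₂ e₁ e₂ t, ?_⟩
  filter_upwards [h, hu, hu.eventually_nhds, hD, hsm] with y hy huy huy' hDy hs
  have hi := hy.adapted.injective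
  have ha := huy.adapted hy.adapted
  have hl : ∀ j, ContMDiffAt (𝓡 4) 𝓘(ℝ, ℝ) ∞ (l j) y := by
    intro j
    fin_cases j
    · exact contMDiffAt_const
    · exact ((hs.1.mul hs.2.2.2).sub (hs.2.2.1.mul hs.2.1)).add ((hDy _ _ _).div_const _)
    · exact ((hDy _ _ _).neg.div_const _).sub (contMDiffAt_const.mul hs.2.2.1)
    · exact (hDy _ _ _).neg.div_const _
    · exact (hDy _ _ _).neg.div_const _
  have hst := huy.formSmoothAt hl hy.smooth
  have d12 := hy.vD_one (fr t 1 y) (fr t 2 y)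
  have d13 := hy.vD_one (fr t 1 y) (fr t 3 y)
  have d23 := hy.vD_one (fr t 2 y) (fr t 3 y)
  have r23 := hy.vD_two (fr t 2 y) (fr t 3 y)
  simp [fr_apply_one hi, fr_apply_two hi, fr_apply_three hi, fr_apply_four hi] at d12 d13 d23 r23
  refine ⟨⟨hst, ha.injective, fun u v => ?_, fun u v => ?_⟩, ha⟩
  · rw [IsUnipotentChange.vD_one huy' hy.smooth hst, vD_tuple_expand hy.smooth hi, d12, d13, d23,
      huy.one, huy.one, huy.two, huy.two, huy.three, huy.three, unipotentChange_zero,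
      unipotentChange_zero]
    simp [Fin.sum_univ_five, l, D]
    ring
  · rw [IsUnipotentChange.vD_two huy' hy.smooth hst, vD_tuple_expand hy.smooth hi, r23,
      huy.two, huy.two, huy.three, huy.three, huy.four, huy.four, unipotentChange_zero,
      unipotentChange_zero]
    simp [Fin.sum_univ_five, l, D, mvfderiv_const, c₁, c₂, e₁, e₂]
    ring

/-- A change ρ ↦ ρ + bσ can be completed to one that preserves the first two equations. It shifts
the ξ∧η coefficient of dη - Λ∧η by -4b, so b can be chosen to remove it. -/
theorem IsPrenormalizedAt.exists_normalized
    (h : ∀ᶠ y in 𝓝 x, IsPrenormalizedAt t y ∧ S.IsRealAdapted (t y)) :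
    ∃ t' : VForm (𝓡 4) M (Fin 5 → ℝ), ∀ᶠ y in 𝓝 x, S.IsNormalizedAt t' y := by
  let p : Fin 4 → M → ℝ := fun j y => t y (fr t j y) 0
  -- The ξ∧η coefficient of dη' is that of dη plus 2c₂ = -10b/3, and it must equal Λ'(E₂) = Λ(E₂) +
  -- 2b/3.
  let b : M → ℝ := fun y => (vD (𝓡 4) t y (fr t 2 y) (fr t 3 y) 4 - p 2 y) / 4
  let db : Fin 4 → M → ℝ := fun j y => mvfderiv (𝓡 4) b y (fr t j y)
  have hp : ∀ᶠ y in 𝓝 x, ∀ j, ContMDiffAt (𝓡 4) 𝓘(ℝ, ℝ) ∞ (p j) y := by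
    filter_upwards [h] with y hy j
    exact hy.1.smooth.coeff (fieldSmoothAt_fr hy.1.smooth hy.1.injective j) _
  have hb : ∀ᶠ y in 𝓝 x, ContMDiffAt (𝓡 4) 𝓘(ℝ, ℝ) ∞ b y := by
    filter_upwards [h.eventually_nhds, hp] with y hy hpy
    have hy' := hy.self_of_nhds.1
    exact ((contMDiffAt_vD_coeff (hy.mono fun z hz => hz.1.smooth)
      (fieldSmoothAt_fr hy'.smooth hy'.injective 2)
      (fieldSmoothAt_fr hy'.smooth hy'.injective 3) 4).sub (hpy 2)).div_const _
  have hdb : ∀ᶠ y in 𝓝 x, ∀ j, ContMDiffAt (𝓡 4) 𝓘(ℝ, ℝ) ∞ (db j) y := by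
    filter_upwards [h, hb] with y hy hby j
    exact contMDiffAt_mvfderiv_apply hby (fieldSmoothAt_fr hy.1.smooth hy.1.injective j)
  -- Forced by the ρ∧ξ coefficient of dρ': c₂ = -(2/3)b - b.
  let c₂ : M → ℝ := fun y => -5 / 3 * b y
  -- The term db∧σ in dρ' is compensated by e₁ in the coefficient of σ∧η and by e₂ in that of σ∧ξ.
  let e₁ : M → ℝ := fun y => -(db 3 y + b y * p 3 y) / 2
  let e₂ : M → ℝ := fun y => (db 2 y + b y * p 2 y + 2 * b y ^ 2) / 2 + c₂ y * b y
  -- Λ is corrected by a ξ term and a ρ term, from σ∧ξ and σ∧ρ in dσ', and by a σ term, from σ∧ρ in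
  -- dρ'.
  let l : Fin 5 → M → ℝ := ![fun _ => 1,
    fun y => - e₁ y * c₂ y - (db 1 y + b y * p 1 y) / 2 - 2 / 3 * e₁ y * b y,
    fun y => -2 / 3 * e₁ y, fun y => 2 / 3 * b y, fun _ => 0]
  have hsm : ∀ᶠ y in 𝓝 x, ContMDiffAt (𝓡 4) 𝓘(ℝ, ℝ) ∞ c₂ y ∧
      ContMDiffAt (𝓡 4) 𝓘(ℝ, ℝ) ∞ e₁ y ∧ ContMDiffAt (𝓡 4) 𝓘(ℝ, ℝ) ∞ e₂ y := by
    filter_upwards [hp, hb, hdb] with y h1 h2 h3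
    have h4 : ContMDiffAt (𝓡 4) 𝓘(ℝ, ℝ) ∞ c₂ y := contMDiffAt_const.mul h2
    exact ⟨h4, ((h3 _).add (h2.mul (h1 _))).neg.div_const _,
      ((((h3 _).add (h2.mul (h1 _))).add (contMDiffAt_const.mul (h2.pow _))).div_const _).add
        (h4.mul h2)⟩
  have hu : ∀ᶠ y in 𝓝 x, IsUnipotentChange t (unipotentChange l b (fun _ => 0) c₂ e₁ e₂ t)
      b (fun _ => 0) c₂ e₁ e₂ y := by
    filter_upwards [hb, hsm] with y h1 h2
    exact isUnipotentChange h1 contMDiffAt_const h2.1 h2.2.1 h2.2.2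
  refine ⟨unipotentChange l b (fun _ => 0) c₂ e₁ e₂ t, ?_⟩
  filter_upwards [h, hu, hu.eventually_nhds, hp, hb, hdb, hsm] with y hy huy huy' hpy hby hdby hs
  have hi := hy.1.injective
  have ha := huy.adapted hy.2
  have hl : ∀ j, ContMDiffAt (𝓡 4) 𝓘(ℝ, ℝ) ∞ (l j) y := by
    intro j
    fin_cases j
    · exact contMDiffAt_const
    · exact ((hs.2.1.neg.mul hs.1).sub (((hdby _).add (hby.mul (hpy _))).div_const _)).sub
        ((contMDiffAt_const.mul hs.2.1).mul hby)
    · exact contMDiffAt_const.mul hs.2.1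
    · exact contMDiffAt_const.mul hby
    · exact contMDiffAt_const
  have hst := huy.formSmoothAt hl hy.1.smooth
  refine ⟨⟨hst, ha.injective, fun u v => ?_, fun u v => ?_⟩, ha, fun u v h1 h2 h3 h4 => ?_⟩
  · rw [IsUnipotentChange.vD_one huy' hy.1.smooth hst, hy.1.vD_one,
      huy.one, huy.one, huy.two, huy.two, huy.three, huy.three, unipotentChange_zero,
      unipotentChange_zero]
    simp [Fin.sum_univ_five, l]
    ring
  · rw [IsUnipotentChange.vD_two huy' hy.1.smooth hst, hy.1.vD_one, hy.1.vD_two,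
      huy.two, huy.two, huy.three, huy.three, huy.four, huy.four, unipotentChange_zero,
      unipotentChange_zero, mvfderiv_expand hi b u, mvfderiv_expand hi b v]
    have hu0 := connection_expand hi u
    have hv0 := connection_expand hi v
    simp [Fin.sum_univ_five, l, c₂, e₁, e₂, db, p]
    rw [hu0, hv0]
    ring
  · rw [huy.one] at h1 h3
    rw [huy.two, h1] at h2
    rw [huy.two, h3] at h4
    simp only [mul_zero, add_zero] at h2 h4
    rw [IsUnipotentChange.vD_four huy' hy.1.smooth hst, hy.1.vD_one, hy.1.vD_two,
      vD_tuple_expand hy.1.smooth hi 4, huy.four, huy.four, unipotentChange_zero,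
      unipotentChange_zero]
    have hb' : vD (𝓡 4) t y (fr t 2 y) (fr t 3 y) 4 = 4 * b y + p 2 y := by simp only [b]; ring
    have hu0 := connection_expand hi u
    have hv0 := connection_expand hi v
    rw [hb']
    simp [Fin.sum_univ_five, l, c₂, h1, h2, h3, h4]
    rw [hu0, hv0]
    simp [h1, h2, h3, h4, p]
    ring

end Normalization

/-! ### Dual coframes -/

section DualCoframe

variable {M : Type*} [TopologicalSpace M] [ChartedSpace (EuclideanSpace ℝ (Fin 4)) M]
  [IsManifold (𝓡 4) ∞ M] {x : M}

theorem mfderiv_chart_injective {y : M} (hy : y ∈ (chartAt (EuclideanSpace ℝ (Fin 4)) x).source) :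
    Function.Injective (mvfderiv (𝓡 4) (extChartAt (𝓡 4) x) y) :=
  (isInvertible_mfderiv_extChartAt (I := 𝓡 4) (x := x) (y := y)
    (by rwa [extChartAt_source])).injective

theorem formSmoothAt_chart {y : M} (hy : y ∈ (chartAt (EuclideanSpace ℝ (Fin 4)) x).source) :
    FormSmoothAt (𝓡 4) (mvfderiv (𝓡 4) (extChartAt (𝓡 4) x)) y :=
  formSmoothAt_mvfderiv (contMDiffAt_extChartAt' hy)

/-- In the chart at x the fields become the columns of a matrix that is invertible at x, hence near
x. Its inverse composed with the differential of the chart is the dual coframe. -/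
theorem exists_dual_coframe {F : Fin 4 → ∀ y : M, TangentSpace (𝓡 4) y}
    (hF : ∀ j, ∀ᶠ y in 𝓝 x, FieldSmoothAt (F j) y) (hl : LinearIndependent ℝ fun j => F j x) :
    ∃ R : VForm (𝓡 4) M (Fin 4 → ℝ), ∀ᶠ y in 𝓝 x, FormSmoothAt (𝓡 4) R y ∧
      Function.Injective (R y) ∧ ∀ j, R y (F j y) = Pi.single j 1 := by
  let R₀ : VForm (𝓡 4) M (EuclideanSpace ℝ (Fin 4)) := mvfderiv (𝓡 4) (extChartAt (𝓡 4) x)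
  let m : M → (Fin 4 → ℝ) →L[ℝ] EuclideanSpace ℝ (Fin 4) := fun y =>
    ∑ j, (ContinuousLinearMap.proj j : (Fin 4 → ℝ) →L[ℝ] ℝ).smulRight (R₀ y (F j y))
  have hm_apply : ∀ y (c : Fin 4 → ℝ), m y c = ∑ j, c j • R₀ y (F j y) := by
    intro y c
    simp [m]
  have hsrc : ∀ᶠ y in 𝓝 x, y ∈ (chartAt (EuclideanSpace ℝ (Fin 4)) x).source :=
    chart_source_mem_nhds _ x
  have hm : ∀ᶠ y in 𝓝 x, ContMDiffAt (𝓡 4)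
      𝓘(ℝ, (Fin 4 → ℝ) →L[ℝ] EuclideanSpace ℝ (Fin 4)) ∞ m y := by
    filter_upwards [Filter.eventually_all.2 hF, hsrc] with y hy hy'
    have h1 : ∀ j, ContMDiffAt (𝓡 4) 𝓘(ℝ, EuclideanSpace ℝ (Fin 4)) ∞ (fun z => R₀ z (F j z)) y :=
      fun j => (formSmoothAt_chart hy').apply (hy j)
    have h2 : ∀ j, ContMDiffAt (𝓡 4) 𝓘(ℝ, (Fin 4 → ℝ) →L[ℝ] EuclideanSpace ℝ (Fin 4)) ∞
        (fun z => (ContinuousLinearMap.proj j : (Fin 4 → ℝ) →L[ℝ] ℝ).smulRight (R₀ z (F j z))) y :=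
      fun j => ((ContinuousLinearMap.smulRightL ℝ (Fin 4 → ℝ) (EuclideanSpace ℝ (Fin 4))
        (ContinuousLinearMap.proj j : (Fin 4 → ℝ) →L[ℝ] ℝ)).contDiff (n := ∞)).contMDiff.contMDiffAt.comp y (h1 j)
    have h3 := ContMDiffAt.sum (t := Finset.univ) fun j _ => h2 j
    exact h3
  have hinj : Function.Injective (m x) := by
    rw [injective_iff_map_eq_zero]
    intro c hc
    rw [hm_apply] at hc
    have h1 : R₀ x (∑ j, c j • F j x) = 0 := by
      rw [map_sum, ← hc]
      simp
    have h2 := mfderiv_chart_injective (mem_chart_source _ x) (h1.trans (map_zero _).symm)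
    ext j
    exact Fintype.linearIndependent_iff.1 hl c h2 j
  have hinv : (m x).IsInvertible := by
    refine ⟨(LinearEquiv.ofInjectiveOfFinrankEq (m x : (Fin 4 → ℝ) →ₗ[ℝ] EuclideanSpace ℝ (Fin 4))
      hinj (by simp)).toContinuousLinearEquiv, ?_⟩
    ext v
    rfl
  have hev : ∀ᶠ y in 𝓝 x, (m y).IsInvertible :=
    hm.self_of_nhds.continuousAt.eventually_mem (ContinuousLinearEquiv.isOpen.mem_nhds hinv)
  refine ⟨fun y => (m y).inverse.comp (R₀ y), ?_⟩
  filter_upwards [hm, hev, hsrc] with y h1 h2 h3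
  refine ⟨?_, ?_, fun j => ?_⟩
  · rw [formSmoothAt_iff (𝓡 4) h3]
    have h4 := (formSmoothAt_iff (𝓡 4) h3).1 (formSmoothAt_chart h3)
    have h5 : ContMDiffAt (𝓡 4) 𝓘(ℝ, EuclideanSpace ℝ (Fin 4) →L[ℝ] (Fin 4 → ℝ)) ∞
        (fun z => (m z).inverse) y :=
      ContMDiffAt.comp y h2.contDiffAt_map_inverse.contMDiffAt h1
    exact h5.clm_comp h4
  · exact h2.inverse.injective.comp (mfderiv_chart_injective h3)
  · have : R₀ y (F j y) = m y (Pi.single j 1) := by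
      rw [hm_apply]
      simp [Pi.single_apply]
    show (m y).inverse (R₀ y (F j y)) = _
    rw [this, h2.inverse_apply_self]

/-- The coefficients of a smooth field with respect to two independent smooth fields are smooth. -/
theorem contMDiffAt_coeff_of_pair {X Y W : ∀ y : M, TangentSpace (𝓡 4) y} {a b : M → ℝ}
    (hX : FieldSmoothAt X x) (hY : FieldSmoothAt Y x) (hW : FieldSmoothAt W x)
    (hl : ∀ c d : ℝ, c • X x + d • Y x = 0 → c = 0 ∧ d = 0)
    (h : ∀ᶠ y in 𝓝 x, W y = a y • X y + b y • Y y) :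
    ContMDiffAt (𝓡 4) 𝓘(ℝ, ℝ) ∞ a x ∧ ContMDiffAt (𝓡 4) 𝓘(ℝ, ℝ) ∞ b x := by
  let R₀ : VForm (𝓡 4) M (EuclideanSpace ℝ (Fin 4)) := mvfderiv (𝓡 4) (extChartAt (𝓡 4) x)
  have hR : FormSmoothAt (𝓡 4) R₀ x := formSmoothAt_chart (mem_chart_source _ x)
  have hin : ∀ {V V' : ∀ y : M, TangentSpace (𝓡 4) y}, FieldSmoothAt V x → FieldSmoothAt V' x →
      ContMDiffAt (𝓡 4) 𝓘(ℝ, ℝ) ∞ (fun y => inner ℝ (R₀ y (V y)) (R₀ y (V' y))) x :=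
    fun hV hV' => (contDiff_inner (𝕜 := ℝ)).contMDiff.contMDiffAt.comp x
      ((hR.apply hV).prodMk_space (hR.apply hV'))
  -- The Gram determinant of the two fields in the chart; the coefficients are then given by
  -- Cramer's rule.
  let G : M → ℝ := fun y => inner ℝ (R₀ y (X y)) (R₀ y (X y)) * inner ℝ (R₀ y (Y y)) (R₀ y (Y y)) -
    inner ℝ (R₀ y (X y)) (R₀ y (Y y)) * inner ℝ (R₀ y (X y)) (R₀ y (Y y))
  have hG : ContMDiffAt (𝓡 4) 𝓘(ℝ, ℝ) ∞ G x :=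
    ((hin hX hX).mul (hin hY hY)).sub ((hin hX hY).mul (hin hX hY))
  have hG0 : G x ≠ 0 := by
    intro h0
    -- The vector |B|²A - ⟨A, B⟩B has squared norm |B|² times the Gram determinant.
    have key : ∀ A B : EuclideanSpace ℝ (Fin 4), inner ℝ A A * inner ℝ B B -
        inner ℝ A B * inner ℝ A B = 0 → inner ℝ B B • A - inner ℝ A B • B = 0 := by
      intro A B hAB
      rw [← inner_self_eq_zero (𝕜 := ℝ)]
      simp only [inner_sub_left, inner_sub_right, real_inner_smul_left, real_inner_smul_right,
        real_inner_comm A B]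
      linear_combination inner ℝ B B * hAB
    have h1 := key _ _ h0
    have h2 : R₀ x (inner ℝ (R₀ x (Y x)) (R₀ x (Y x)) • X x +
        (- inner ℝ (R₀ x (X x)) (R₀ x (Y x))) • Y x) = 0 := by
      rw [map_add, map_smul, map_smul, ← h1]
      module
    have h3 := mfderiv_chart_injective (mem_chart_source _ x) (h2.trans (map_zero _).symm)
    have h4 := (hl _ _ h3).1
    rw [inner_self_eq_zero] at h4
    have h5 := mfderiv_chart_injective (mem_chart_source _ x) (h4.trans (map_zero _).symm)
    have := (hl 0 1 (by simp [h5])).2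
    exact one_ne_zero this
  have hGe : ∀ᶠ y in 𝓝 x, G y ≠ 0 := hG.continuousAt.eventually_ne hG0
  constructor
  · refine ((((hin hY hY).mul (hin hX hW)).sub ((hin hX hY).mul (hin hY hW))).div₀ hG
      hG0).congr_of_eventuallyEq ?_
    filter_upwards [h, hGe] with y hy hy0
    refine (eq_div_iff hy0).2 ?_
    simp only [G, hy, Pi.mul_apply, map_add, map_smul, inner_add_right, real_inner_smul_right,
      real_inner_comm (R₀ y (X y)) (R₀ y (Y y))]
    ring
  · refine ((((hin hX hX).mul (hin hY hW)).sub ((hin hX hY).mul (hin hX hW))).div₀ hG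
      hG0).congr_of_eventuallyEq ?_
    filter_upwards [h, hGe] with y hy hy0
    refine (eq_div_iff hy0).2 ?_
    simp only [G, hy, Pi.mul_apply, map_add, map_smul, inner_add_right, real_inner_smul_right,
      real_inner_comm (R₀ y (X y)) (R₀ y (Y y))]
    ring

end DualCoframe

/-! ### Lie brackets of combinations of vector fields -/

section Brackets

open VectorField

variable {M : Type*} [TopologicalSpace M] [ChartedSpace (EuclideanSpace ℝ (Fin 4)) M]
  [IsManifold (𝓡 4) ∞ M] {x : M}

theorem FieldSmoothAt.mlieBracket {X Y : ∀ y : M, TangentSpace (𝓡 4) y}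
    (hX : FieldSmoothAt X x) (hY : FieldSmoothAt Y x) :
    FieldSmoothAt (mlieBracket (𝓡 4) X Y) x := by
  have : IsManifold (𝓡 4) ((⊤ : ℕ∞) + 1) M := ‹IsManifold (𝓡 4) ∞ M›
  have : IsManifold (𝓡 4) (minSmoothness ℝ 2) M := by
    rw [minSmoothness_of_isRCLikeNormedField]
    infer_instance
  exact ContMDiffAt.mlieBracket_vectorField (m := ⊤) (n := ⊤) hX hY (by simp)

theorem FieldSmoothAt.mdifferentiableAt {X : ∀ y : M, TangentSpace (𝓡 4) y}
    (hX : FieldSmoothAt X x) :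
    MDifferentiableAt (𝓡 4) (𝓡 4).tangent (fun y => (⟨y, X y⟩ : TangentBundle (𝓡 4) M)) x :=
  ContMDiffAt.mdifferentiableAt hX (by simp)

variable {P : Fin 3 → ∀ y : M, TangentSpace (𝓡 4) y} {A B : ∀ y : M, TangentSpace (𝓡 4) y}
  {a b : Fin 3 → M → ℝ}

theorem mlieBracket_comb_left (hP : ∀ j, FieldSmoothAt (P j) x)
    (ha : ∀ j, MDifferentiableAt (𝓡 4) 𝓘(ℝ, ℝ) (a j) x)
    (hA : ∀ᶠ y in 𝓝 x, A y = a 0 y • P 0 y + a 1 y • P 1 y + a 2 y • P 2 y) :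
    mlieBracket (𝓡 4) A B x = a 0 x • mlieBracket (𝓡 4) (P 0) B x +
      a 1 x • mlieBracket (𝓡 4) (P 1) B x + a 2 x • mlieBracket (𝓡 4) (P 2) B x -
      (mvfderiv (𝓡 4) (a 0) x (B x) • P 0 x + mvfderiv (𝓡 4) (a 1) x (B x) • P 1 x +
        mvfderiv (𝓡 4) (a 2) x (B x) • P 2 x) := by
  have hA' : A =ᶠ[𝓝 x] (a 0 • P 0 + a 1 • P 1) + a 2 • P 2 := hA
  have hp := fun j => (hP j).mdifferentiableAt
  have hs : ∀ j, MDifferentiableAt (𝓡 4) (𝓡 4).tangent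
      (fun y => (⟨y, (a j • P j) y⟩ : TangentBundle (𝓡 4) M)) x := fun j =>
    (ha j).smul_section (hp j)
  have hs01 := mdifferentiableAt_add_section (hs 0) (hs 1)
  rw [hA'.mlieBracket_vectorField_eq (Filter.EventuallyEq.refl _ B),
    mlieBracket_add_left hs01 (hs 2), mlieBracket_add_left (hs 0) (hs 1),
    mlieBracket_smul_left (ha 0) (hp 0), mlieBracket_smul_left (ha 1) (hp 1),
    mlieBracket_smul_left (ha 2) (hp 2)]
  module

theorem mlieBracket_comb (hP : ∀ j, FieldSmoothAt (P j) x)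
    (ha : ∀ j, MDifferentiableAt (𝓡 4) 𝓘(ℝ, ℝ) (a j) x)
    (hb : ∀ j, MDifferentiableAt (𝓡 4) 𝓘(ℝ, ℝ) (b j) x)
    (hA : ∀ᶠ y in 𝓝 x, A y = a 0 y • P 0 y + a 1 y • P 1 y + a 2 y • P 2 y)
    (hB : ∀ᶠ y in 𝓝 x, B y = b 0 y • P 0 y + b 1 y • P 1 y + b 2 y • P 2 y) :
    mlieBracket (𝓡 4) A B x =
      (a 0 x * b 1 x - a 1 x * b 0 x) • mlieBracket (𝓡 4) (P 0) (P 1) x +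
      (a 0 x * b 2 x - a 2 x * b 0 x) • mlieBracket (𝓡 4) (P 0) (P 2) x +
      (a 1 x * b 2 x - a 2 x * b 1 x) • mlieBracket (𝓡 4) (P 1) (P 2) x +
      ((mvfderiv (𝓡 4) (b 0) x (A x) - mvfderiv (𝓡 4) (a 0) x (B x)) • P 0 x +
        (mvfderiv (𝓡 4) (b 1) x (A x) - mvfderiv (𝓡 4) (a 1) x (B x)) • P 1 x +
        (mvfderiv (𝓡 4) (b 2) x (A x) - mvfderiv (𝓡 4) (a 2) x (B x)) • P 2 x) := by
  have hBP : ∀ i, mlieBracket (𝓡 4) (P i) B x = - _ := fun i =>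
    mlieBracket_swap_apply.trans (congrArg Neg.neg (mlieBracket_comb_left (B := P i) hP hb hB))
  have hAx : ∀ f : M → ℝ, mvfderiv (𝓡 4) f x (A x) = a 0 x * mvfderiv (𝓡 4) f x (P 0 x) +
      a 1 x * mvfderiv (𝓡 4) f x (P 1 x) + a 2 x * mvfderiv (𝓡 4) f x (P 2 x) := by
    intro f
    rw [hA.self_of_nhds]
    simp
  rw [mlieBracket_comb_left hP ha hA, hBP, hBP, hBP, hAx, hAx, hAx]
  rw [mlieBracket_swap_apply (V := P 1) (W := P 0), mlieBracket_swap_apply (V := P 2) (W := P 0),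
    mlieBracket_swap_apply (V := P 2) (W := P 1)]
  simp only [mlieBracket_self, Pi.zero_apply]
  module

/-- The field `A` is a combination of the fields `P` with smooth coefficients near `x`. -/
def IsSmoothComb (P : Fin 3 → ∀ y : M, TangentSpace (𝓡 4) y) (A : ∀ y : M, TangentSpace (𝓡 4) y)
    (a : Fin 3 → M → ℝ) (x : M) : Prop :=
  (∀ᶠ y in 𝓝 x, ∀ j, ContMDiffAt (𝓡 4) 𝓘(ℝ, ℝ) ∞ (a j) y) ∧
    ∀ᶠ y in 𝓝 x, A y = a 0 y • P 0 y + a 1 y • P 1 y + a 2 y • P 2 y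

omit [IsManifold (𝓡 4) ∞ M] in
theorem IsSmoothComb.add (hA : IsSmoothComb P A a x) (hB : IsSmoothComb P B b x) :
    IsSmoothComb P (fun y => A y + B y) (fun j y => a j y + b j y) x := by
  constructor
  · filter_upwards [hA.1, hB.1] with y h1 h2 j
    exact (h1 j).add (h2 j)
  · filter_upwards [hA.2, hB.2] with y h1 h2
    rw [h1, h2]
    module

omit [IsManifold (𝓡 4) ∞ M] in
theorem IsSmoothComb.neg (hA : IsSmoothComb P A a x) :
    IsSmoothComb P (fun y => - A y) (fun j y => - a j y) x := by
  constructor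
  · filter_upwards [hA.1] with y h1 j
    exact (h1 j).neg
  · filter_upwards [hA.2] with y h1
    rw [h1]
    module

omit [IsManifold (𝓡 4) ∞ M] in
theorem IsSmoothComb.sub (hA : IsSmoothComb P A a x) (hB : IsSmoothComb P B b x) :
    IsSmoothComb P (fun y => A y - B y) (fun j y => a j y - b j y) x := by
  simpa only [sub_eq_add_neg] using hA.add hB.neg

theorem IsSmoothComb.fieldSmoothAt (hP : ∀ j, FieldSmoothAt (P j) x) (hA : IsSmoothComb P A a x) :
    FieldSmoothAt A x := by
  have ha := hA.1.self_of_nhds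
  have h := ((ha 0).smul_section (hP 0)).add_section ((ha 1).smul_section (hP 1)) |>.add_section
    ((ha 2).smul_section (hP 2))
  refine h.congr_of_eventuallyEq ?_
  filter_upwards [hA.2] with y hy
  rw [hy]
  rfl

/-- For fields in the span of P 0 and P 1, the Leibniz terms of the bracket stay in that span and
the rest is a multiple of [P 0, P 1] = P 2. -/
theorem IsSmoothComb.mlieBracket (hP : ∀ᶠ y in 𝓝 x, ∀ j, FieldSmoothAt (P j) y)
    (h2 : ∀ᶠ y in 𝓝 x, P 2 y = mlieBracket (𝓡 4) (P 0) (P 1) y)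
    (hA : IsSmoothComb P A a x) (hB : IsSmoothComb P B b x)
    (ha2 : a 2 = fun _ => 0) (hb2 : b 2 = fun _ => 0) :
    ∃ c, IsSmoothComb P (VectorField.mlieBracket (𝓡 4) A B) c x := by
  refine ⟨![fun y => mvfderiv (𝓡 4) (b 0) y (A y) - mvfderiv (𝓡 4) (a 0) y (B y),
    fun y => mvfderiv (𝓡 4) (b 1) y (A y) - mvfderiv (𝓡 4) (a 1) y (B y),
    fun y => a 0 y * b 1 y - a 1 y * b 0 y], ?_, ?_⟩
  · filter_upwards [hA.1, hB.1, hA.1.eventually_nhds, hB.1.eventually_nhds, hA.2.eventually_nhds,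
      hB.2.eventually_nhds, hP] with y h1 h2 h3 h4 h5 h6 h7 j
    have sA := IsSmoothComb.fieldSmoothAt h7 ⟨h3, h5⟩
    have sB := IsSmoothComb.fieldSmoothAt h7 ⟨h4, h6⟩
    fin_cases j
    · exact (contMDiffAt_mvfderiv_apply (h2 0) sA).sub (contMDiffAt_mvfderiv_apply (h1 0) sB)
    · exact (contMDiffAt_mvfderiv_apply (h2 1) sA).sub (contMDiffAt_mvfderiv_apply (h1 1) sB)
    · exact ((h1 0).mul (h2 1)).sub ((h1 1).mul (h2 0))
  · filter_upwards [hA.1, hB.1, hA.2.eventually_nhds, hB.2.eventually_nhds, hP, h2]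
      with y h1 h2 h3 h4 h5 h6
    rw [mlieBracket_comb h5 (fun j => (h1 j).mdifferentiableAt (by simp))
      (fun j => (h2 j).mdifferentiableAt (by simp)) h3 h4, ← h6, ha2, hb2]
    simp [mvfderiv_const]
    module

end Brackets

/-! ### Local frames of the CR-bundle -/

section EngelFrame

open VectorField

variable {M : Type*} [TopologicalSpace M] [ChartedSpace (EuclideanSpace ℝ (Fin 4)) M] {x : M}

theorem cmk_add (u v u' v' : TangentSpace (𝓡 4) x) :
    cmk (𝓡 4) (u + u') (v + v') = cmk (𝓡 4) u v + cmk (𝓡 4) u' v' := by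
  simp only [cmk, TensorProduct.tmul_add]
  abel

theorem smul_cmk (a b : ℝ) (u v : TangentSpace (𝓡 4) x) :
    (⟨a, b⟩ : ℂ) • cmk (𝓡 4) u v = cmk (𝓡 4) (a • u - b • v) (b • u + a • v) := by
  have h : ∀ (z : ℂ) (w : TangentSpace (𝓡 4) x),
      z ⊗ₜ[ℝ] w = (1 : ℂ) ⊗ₜ[ℝ] (z.re • w) + Complex.I ⊗ₜ[ℝ] (z.im • w) := by
    intro z w
    rw [TensorProduct.tmul_smul, TensorProduct.tmul_smul, TensorProduct.smul_tmul',
      TensorProduct.smul_tmul', ← TensorProduct.add_tmul]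
    congr 1
    apply Complex.ext <;> simp
  simp only [cmk, smul_add, TensorProduct.smul_tmul', smul_eq_mul, mul_one]
  rw [h ⟨a, b⟩ u, h (⟨a, b⟩ * Complex.I) v]
  simp only [Complex.mul_I_re, Complex.mul_I_im, TensorProduct.tmul_add, TensorProduct.tmul_sub,
    neg_smul, TensorProduct.tmul_neg]
  abel

theorem cmk_eq_iff {u v u' v' : TangentSpace (𝓡 4) x} :
    cmk (𝓡 4) u v = cmk (𝓡 4) u' v' ↔ u = u' ∧ v = v' := by
  constructor
  · intro h
    exact ⟨by simpa only [cre_cmk] using congrArg (cre (𝓡 4)) h,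
      by simpa only [cim_cmk] using congrArg (cim (𝓡 4)) h⟩
  · rintro ⟨rfl, rfl⟩
    rfl

variable [IsManifold (𝓡 4) ∞ M] {S : CRStructure (𝓡 4) M 1}

/-- The complex field `X + i Y` is a smooth local frame of the CR-bundle near `x`. -/
structure CRStructure.IsFrameNear (S : CRStructure (𝓡 4) M 1)
    (X Y : ∀ y : M, TangentSpace (𝓡 4) y) (x : M) : Prop where
  smooth_left : ∀ᶠ y in 𝓝 x, FieldSmoothAt X y
  smooth_right : ∀ᶠ y in 𝓝 x, FieldSmoothAt Y y
  independent : ∀ᶠ y in 𝓝 x, ∀ c d : ℝ, c • X y + d • Y y = 0 → c = 0 ∧ d = 0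
  mem_iff : ∀ᶠ y in 𝓝 x, ∀ u v : TangentSpace (𝓡 4) y, cmk (𝓡 4) u v ∈ S.L y ↔
    ∃ a b : ℝ, u = a • X y - b • Y y ∧ v = b • X y + a • Y y

theorem SmoothFieldOn.fieldSmoothAt {Z : ∀ y : M, CTangent (𝓡 4) y} {U : Set M}
    (h : SmoothFieldOn (𝓡 4) Z U) (hU : IsOpen U) {y : M} (hy : y ∈ U) :
    FieldSmoothAt (fun y => cre (𝓡 4) (Z y)) y ∧ FieldSmoothAt (fun y => cim (𝓡 4) (Z y)) y :=
  ⟨h.1.contMDiffAt (hU.mem_nhds hy), h.2.contMDiffAt (hU.mem_nhds hy)⟩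

theorem CRStructure.exists_isFrameNear (S : CRStructure (𝓡 4) M 1) (x : M) :
    ∃ X Y : ∀ y : M, TangentSpace (𝓡 4) y, S.IsFrameNear X Y x := by
  obtain ⟨U, hU, hx, Z, hZ, hL⟩ := S.exists_frame x
  have hev : ∀ᶠ y in 𝓝 x, y ∈ U := hU.mem_nhds hx
  have hmem : ∀ y ∈ U, ∀ u v : TangentSpace (𝓡 4) y, cmk (𝓡 4) u v ∈ S.L y ↔
      ∃ a b : ℝ, u = a • cre (𝓡 4) (Z 0 y) - b • cim (𝓡 4) (Z 0 y) ∧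
        v = b • cre (𝓡 4) (Z 0 y) + a • cim (𝓡 4) (Z 0 y) := by
    intro y hy u v
    rw [(hL y hy).2, Set.range_unique, Submodule.mem_span_singleton]
    constructor
    · rintro ⟨⟨a, b⟩, h⟩
      refine ⟨a, b, ?_⟩
      change _ • Z 0 y = _ at h
      rw [← cmk_cre_cim (Z 0 y), smul_cmk, cmk_eq_iff] at h
      exact ⟨h.1.symm, h.2.symm⟩
    · rintro ⟨a, b, rfl, rfl⟩
      refine ⟨⟨a, b⟩, ?_⟩
      change _ • Z 0 y = _
      conv_lhs => rw [← cmk_cre_cim (Z 0 y), smul_cmk]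
  refine ⟨fun y => cre (𝓡 4) (Z 0 y), fun y => cim (𝓡 4) (Z 0 y), ?_, ?_, ?_, ?_⟩
  · exact hev.mono fun y hy => ((hZ 0).fieldSmoothAt hU hy).1
  · exact hev.mono fun y hy => ((hZ 0).fieldSmoothAt hU hy).2
  · filter_upwards [hev] with y hy c d h
    by_contra hcd
    -- If cX + dY = 0, then (d + ic)(X + iY) = dX - cY is a real vector in L, hence zero. The two
    -- relations force X = Y = 0, contrary to the frame property.
    have hpos : 0 < c ^ 2 + d ^ 2 := by
      by_contra hle
      exact hcd ⟨by nlinarith [sq_nonneg c, sq_nonneg d], by nlinarith [sq_nonneg c, sq_nonneg d]⟩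
    set X := cre (𝓡 4) (Z 0 y)
    set Y := cim (𝓡 4) (Z 0 y)
    have h1 : cmk (𝓡 4) (d • X - c • Y) 0 ∈ S.L y :=
      (hmem y hy _ _).2 ⟨d, c, rfl, h.symm⟩
    have h2 := S.eq_zero_of_mem_conj y _ h1 (by
      have : cconj (𝓡 4) (cmk (𝓡 4) (d • X - c • Y) 0) = cmk (𝓡 4) (d • X - c • Y) 0 := by
        simp [cconj, cre_cmk, cim_cmk]
      rwa [this])
    have h3 : d • X - c • Y = 0 := by rw [← cre_cmk (d • X - c • Y) 0, h2, map_zero]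
    have hX : (c ^ 2 + d ^ 2) • X = 0 := by
      have : (c ^ 2 + d ^ 2) • X = c • (c • X + d • Y) + d • (d • X - c • Y) := by module
      rw [this, h, h3, smul_zero, smul_zero, add_zero]
    have hY : (c ^ 2 + d ^ 2) • Y = 0 := by
      have : (c ^ 2 + d ^ 2) • Y = d • (c • X + d • Y) - c • (d • X - c • Y) := by module
      rw [this, h, h3, smul_zero, smul_zero, sub_zero]
    have hX0 := (smul_eq_zero.1 hX).resolve_left hpos.ne'
    have hY0 := (smul_eq_zero.1 hY).resolve_left hpos.ne'
    refine (hL y hy).1.ne_zero 0 ?_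
    change Z 0 y = 0
    rw [← cmk_cre_cim (Z 0 y)]
    change cmk (𝓡 4) X Y = 0
    simp [hX0, hY0, cmk]
  · exact hev.mono fun y hy => hmem y hy

theorem CRStructure.IsFrameNear.isSmoothComb {X Y : ∀ y : M, TangentSpace (𝓡 4) y}
    (h : S.IsFrameNear X Y x) (T : ∀ y : M, TangentSpace (𝓡 4) y)
    {W : ∀ y : M, CTangent (𝓡 4) y} {U : Set M} (hU : IsOpen U) (hx : x ∈ U)
    (hW : IsSectionOn (𝓡 4) S.L W U) : ∃ a b : M → ℝ,
      IsSmoothComb ![X, Y, T] (fun y => cre (𝓡 4) (W y)) ![a, fun y => - b y, fun _ => 0] x ∧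
      IsSmoothComb ![X, Y, T] (fun y => cim (𝓡 4) (W y)) ![b, a, fun _ => 0] x := by
  have hev : ∀ᶠ y in 𝓝 x, y ∈ U := hU.mem_nhds hx
  -- The conditional form makes the choice total; the coefficients of W = (a + ib)(X + iY) are
  -- meaningful only near x, and smoothness is proved afterwards.
  have key : ∀ y : M, ∃ p : ℝ × ℝ, (∃ a b : ℝ, cre (𝓡 4) (W y) = a • X y - b • Y y ∧
      cim (𝓡 4) (W y) = b • X y + a • Y y) → cre (𝓡 4) (W y) = p.1 • X y - p.2 • Y y ∧
      cim (𝓡 4) (W y) = p.2 • X y + p.1 • Y y := by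
    intro y
    by_cases hy : ∃ a b : ℝ, cre (𝓡 4) (W y) = a • X y - b • Y y ∧
      cim (𝓡 4) (W y) = b • X y + a • Y y
    · obtain ⟨a, b, hab⟩ := hy
      exact ⟨(a, b), fun _ => hab⟩
    · exact ⟨0, fun h => absurd h hy⟩
  choose p hp using key
  have hp' : ∀ᶠ y in 𝓝 x, cre (𝓡 4) (W y) = (p y).1 • X y - (p y).2 • Y y ∧
      cim (𝓡 4) (W y) = (p y).2 • X y + (p y).1 • Y y := by
    filter_upwards [hev, h.mem_iff] with y hy hm
    exact hp y ((hm _ _).1 (by rw [cmk_cre_cim]; exact hW.2 y hy))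
  have hs : ∀ᶠ y in 𝓝 x, ContMDiffAt (𝓡 4) 𝓘(ℝ, ℝ) ∞ (fun y => (p y).2) y ∧
      ContMDiffAt (𝓡 4) 𝓘(ℝ, ℝ) ∞ (fun y => (p y).1) y := by
    filter_upwards [hev, hp'.eventually_nhds, h.smooth_left, h.smooth_right, h.independent]
      with y hy h1 h2 h3 h4
    exact contMDiffAt_coeff_of_pair h2 h3 (hW.1.fieldSmoothAt hU hy).2 h4
      (h1.mono fun z hz => hz.2)
  refine ⟨fun y => (p y).1, fun y => (p y).2, ⟨?_, ?_⟩, ⟨?_, ?_⟩⟩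
  · filter_upwards [hs] with y hy j
    fin_cases j
    exacts [hy.2, hy.1.neg, contMDiffAt_const]
  · filter_upwards [hp'] with y hy
    change cre (𝓡 4) (W y) = (p y).1 • X y + (- (p y).2) • Y y + (0 : ℝ) • T y
    rw [hy.1]
    module
  · filter_upwards [hs] with y hy j
    fin_cases j
    exacts [hy.1, hy.2, contMDiffAt_const]
  · filter_upwards [hp'] with y hy
    change cim (𝓡 4) (W y) = (p y).2 • X y + (p y).1 • Y y + (0 : ℝ) • T y
    rw [hy.2]
    module

end EngelFrame

/-! ### The non-degeneracy condition in a local frame -/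

section EngelSpan

open VectorField

variable {M : Type*} [TopologicalSpace M] [ChartedSpace (EuclideanSpace ℝ (Fin 4)) M]
  [IsManifold (𝓡 4) ∞ M] {S : CRStructure (𝓡 4) M 1} {x : M}
  {X Y : ∀ y : M, TangentSpace (𝓡 4) y}

omit [IsManifold (𝓡 4) ∞ M] in
theorem cmk_comb_mem_span {A B P Q R : TangentSpace (𝓡 4) x} {u v : TangentSpace (𝓡 4) x}
    {c d k₀ k₁ k₂ l₀ l₁ l₂ : ℝ}
    (hu : u = c • A - d • B + (k₀ • P + k₁ • Q + k₂ • R))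
    (hv : v = d • A + c • B + (l₀ • P + l₁ • Q + l₂ • R)) :
    cmk (𝓡 4) u v ∈ Submodule.span ℂ (Set.range
      ![cmk (𝓡 4) A B, cmk (𝓡 4) R 0, cmk (𝓡 4) P 0, cmk (𝓡 4) Q 0]) := by
  have e : cmk (𝓡 4) u v = (⟨c, d⟩ : ℂ) • cmk (𝓡 4) A B + ((⟨k₂, l₂⟩ : ℂ) • cmk (𝓡 4) R 0 +
      ((⟨k₀, l₀⟩ : ℂ) • cmk (𝓡 4) P 0 + (⟨k₁, l₁⟩ : ℂ) • cmk (𝓡 4) Q 0)) := by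
    simp only [smul_cmk, ← cmk_add, cmk_eq_iff, hu, hv]
    constructor <;> module
  rw [e]
  have hm : ∀ j, ![cmk (𝓡 4) A B, cmk (𝓡 4) R 0, cmk (𝓡 4) P 0, cmk (𝓡 4) Q 0] j ∈
      Submodule.span ℂ (Set.range
      ![cmk (𝓡 4) A B, cmk (𝓡 4) R 0, cmk (𝓡 4) P 0, cmk (𝓡 4) Q 0]) :=
    fun j => Submodule.subset_span ⟨j, rfl⟩
  exact Submodule.add_mem _ (Submodule.smul_mem _ _ (hm 0)) (Submodule.add_mem _
    (Submodule.smul_mem _ _ (hm 1)) (Submodule.add_mem _ (Submodule.smul_mem _ _ (hm 2))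
    (Submodule.smul_mem _ _ (hm 3))))

omit [IsManifold (𝓡 4) ∞ M] in
theorem cmk_span_mem_span {A B P Q R : TangentSpace (𝓡 4) x} {u v : TangentSpace (𝓡 4) x}
    {k₀ k₁ k₂ l₀ l₁ l₂ : ℝ} (hu : u = k₀ • P + k₁ • Q + k₂ • R) (hv : v = l₀ • P + l₁ • Q + l₂ • R) :
    cmk (𝓡 4) u v ∈ Submodule.span ℂ (Set.range
      ![cmk (𝓡 4) A B, cmk (𝓡 4) R 0, cmk (𝓡 4) P 0, cmk (𝓡 4) Q 0]) := by
  refine cmk_comb_mem_span (c := 0) (d := 0) (k₀ := k₀) (k₁ := k₁) (k₂ := k₂) (l₀ := l₀)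
    (l₁ := l₁) (l₂ := l₂) (hu.trans ?_) (hv.trans ?_)
  · rw [zero_smul, zero_smul, sub_zero, zero_add]
  · rw [zero_smul, zero_smul, zero_add, zero_add]

theorem IsSmoothComb.mlieBracket_third {P : Fin 3 → ∀ y : M, TangentSpace (𝓡 4) y}
    {A B : ∀ y : M, TangentSpace (𝓡 4) y} {a b : Fin 3 → M → ℝ}
    (hP : ∀ j, FieldSmoothAt (P j) x)
    (h2 : ∀ᶠ y in 𝓝 x, P 2 y = VectorField.mlieBracket (𝓡 4) (P 0) (P 1) y)
    (hA : IsSmoothComb P A a x) (hB : IsSmoothComb P B b x) (ha2 : a 2 = fun _ => 0) :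
    ∃ k : Fin 3 → ℝ, VectorField.mlieBracket (𝓡 4) A B x =
      (a 0 x * b 2 x) • VectorField.mlieBracket (𝓡 4) (P 0) (P 2) x +
      (a 1 x * b 2 x) • VectorField.mlieBracket (𝓡 4) (P 1) (P 2) x +
      (k 0 • P 0 x + k 1 • P 1 x + k 2 • P 2 x) := by
  refine ⟨![mvfderiv (𝓡 4) (b 0) x (A x) - mvfderiv (𝓡 4) (a 0) x (B x),
    mvfderiv (𝓡 4) (b 1) x (A x) - mvfderiv (𝓡 4) (a 1) x (B x),
    mvfderiv (𝓡 4) (b 2) x (A x) - mvfderiv (𝓡 4) (a 2) x (B x) +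
      (a 0 x * b 1 x - a 1 x * b 0 x)], ?_⟩
  rw [mlieBracket_comb hP (fun j => (hA.1.self_of_nhds j).mdifferentiableAt (by simp))
      (fun j => (hB.1.self_of_nhds j).mdifferentiableAt (by simp)) hA.2 hB.2, ← h2.self_of_nhds, ha2]
  simp [mvfderiv_const]
  module

/-- The first vector is [X + iY, T]. Modulo X, Y, T, a bracket of a section of L with a combination
of X, Y, T is a complex multiple of it, so the four vectors span ℂ ⊗ T_xM, of dimension four. -/
theorem CRStructure.IsFrameNear.linearIndependent (h : S.IsFrameNear X Y x)
    (hS : S.SpansUpToOrderThree) :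
    let T := mlieBracket (𝓡 4) X Y
    LinearIndependent ℂ ![cmk (𝓡 4) (mlieBracket (𝓡 4) X T x) (mlieBracket (𝓡 4) Y T x),
      cmk (𝓡 4) (T x) 0, cmk (𝓡 4) (X x) 0, cmk (𝓡 4) (Y x) 0] := by
  intro T
  let P : Fin 3 → ∀ y : M, TangentSpace (𝓡 4) y := ![X, Y, T]
  have hP : ∀ᶠ y in 𝓝 x, ∀ j, FieldSmoothAt (P j) y := by
    filter_upwards [h.smooth_left, h.smooth_right] with y h1 h2 j
    fin_cases j
    exacts [h1, h2, h1.mlieBracket h2]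
  have hP2 : ∀ᶠ y in 𝓝 x, P 2 y = mlieBracket (𝓡 4) (P 0) (P 1) y :=
    Filter.Eventually.of_forall fun y => rfl
  refine linearIndependent_of_top_le_span_of_card_eq_finrank ?_ ?_
  · rw [← hS x, Submodule.span_le]
    rintro v ⟨U, Z, Z', W, hU, hx, hZ, hZ', hW, hv⟩
    obtain ⟨a, b, hZr, hZi⟩ := h.isSmoothComb T hU hx hZ
    obtain ⟨a', b', hZr', hZi'⟩ := h.isSmoothComb T hU hx hZ'
    obtain ⟨c, d, hWr, hWi⟩ := h.isSmoothComb T hU hx hW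
    have hcr : (fun y => cre (𝓡 4) (conjField (𝓡 4) W y)) = fun y => cre (𝓡 4) (W y) := by
      funext y
      simp [conjField, cconj, cre_cmk]
    have hci : (fun y => cim (𝓡 4) (conjField (𝓡 4) W y)) = fun y => -cim (𝓡 4) (W y) := by
      funext y
      simp [conjField, cconj, cim_cmk]
    have hWi' := hWi.neg
    have h20 : (fun (j : Fin 3) y => -(![d, c, fun _ => 0] : Fin 3 → M → ℝ) j y) 2 = fun _ => 0 := by
      funext y
      simp
    obtain ⟨p₁, hp₁⟩ := IsSmoothComb.mlieBracket hP hP2 hZr hWr rfl rfl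
    obtain ⟨p₂, hp₂⟩ := IsSmoothComb.mlieBracket hP hP2 hZi hWi' rfl h20
    obtain ⟨p₃, hp₃⟩ := IsSmoothComb.mlieBracket hP hP2 hZr hWi' rfl h20
    obtain ⟨p₄, hp₄⟩ := IsSmoothComb.mlieBracket hP hP2 hZi hWr rfl rfl
    have hp := hp₁.sub hp₂
    have hq := hp₃.add hp₄
    have hVr : (fun y => cre (𝓡 4) (cbracket (𝓡 4) Z (conjField (𝓡 4) W) y)) =
        fun y => mlieBracket (𝓡 4) (fun y => cre (𝓡 4) (Z y)) (fun y => cre (𝓡 4) (W y)) y -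
          mlieBracket (𝓡 4) (fun y => cim (𝓡 4) (Z y)) (fun y => -cim (𝓡 4) (W y)) y := by
      funext y
      rw [cbracket, cre_cmk, hcr, hci]
    have hVi : (fun y => cim (𝓡 4) (cbracket (𝓡 4) Z (conjField (𝓡 4) W) y)) =
        fun y => mlieBracket (𝓡 4) (fun y => cre (𝓡 4) (Z y)) (fun y => -cim (𝓡 4) (W y)) y +
          mlieBracket (𝓡 4) (fun y => cim (𝓡 4) (Z y)) (fun y => cre (𝓡 4) (W y)) y := by
      funext y
      rw [cbracket, cim_cmk, hcr, hci]
    rw [← hVr] at hp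
    rw [← hVi] at hq
    rcases hv with rfl | rfl | rfl | rfl
    · rw [← cmk_cre_cim (Z x)]
      exact cmk_span_mem_span hZr.2.self_of_nhds hZi.2.self_of_nhds
    · rw [← cmk_cre_cim (conjField (𝓡 4) W x)]
      exact cmk_span_mem_span ((congrFun hcr x).trans hWr.2.self_of_nhds)
        ((congrFun hci x).trans hWi'.2.self_of_nhds)
    · rw [← cmk_cre_cim (cbracket (𝓡 4) Z (conjField (𝓡 4) W) x)]
      exact cmk_span_mem_span hp.2.self_of_nhds hq.2.self_of_nhds
    · have hPx := hP.self_of_nhds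
      obtain ⟨k₁, e₁⟩ := IsSmoothComb.mlieBracket_third hPx hP2 hZr' hp rfl
      obtain ⟨k₂, e₂⟩ := IsSmoothComb.mlieBracket_third hPx hP2 hZi' hq rfl
      obtain ⟨k₃, e₃⟩ := IsSmoothComb.mlieBracket_third hPx hP2 hZr' hq rfl
      obtain ⟨k₄, e₄⟩ := IsSmoothComb.mlieBracket_third hPx hP2 hZi' hp rfl
      change cmk (𝓡 4) (_ - _) (_ + _) ∈ _
      rw [e₁, e₂, e₃, e₄]
      generalize p₁ 2 x - p₂ 2 x = r
      generalize p₃ 2 x + p₄ 2 x = r'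
      -- The coefficient of [X + iY, T] is c + id = (a' + ib')(r + ir'), the product of the
      -- coefficients of Z' and of T.
      refine cmk_comb_mem_span (c := a' x * r - b' x * r') (d := b' x * r + a' x * r')
        (k₀ := k₁ 0 - k₂ 0) (k₁ := k₁ 1 - k₂ 1) (k₂ := k₁ 2 - k₂ 2)
        (l₀ := k₃ 0 + k₄ 0) (l₁ := k₃ 1 + k₄ 1) (l₂ := k₃ 2 + k₄ 2) ?_ ?_
      · change (a' x * r) • mlieBracket (𝓡 4) X T x + (-b' x * r) • mlieBracket (𝓡 4) Y T x +
          (k₁ 0 • X x + k₁ 1 • Y x + k₁ 2 • T x) - ((b' x * r') • mlieBracket (𝓡 4) X T x +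
          (a' x * r') • mlieBracket (𝓡 4) Y T x + (k₂ 0 • X x + k₂ 1 • Y x + k₂ 2 • T x)) = _
        module
      · change (a' x * r') • mlieBracket (𝓡 4) X T x + (-b' x * r') • mlieBracket (𝓡 4) Y T x +
          (k₃ 0 • X x + k₃ 1 • Y x + k₃ 2 • T x) + ((b' x * r) • mlieBracket (𝓡 4) X T x +
          (a' x * r) • mlieBracket (𝓡 4) Y T x + (k₄ 0 • X x + k₄ 1 • Y x + k₄ 2 • T x)) = _
        module
  · rw [Fintype.card_fin]
    have : Module.finrank ℂ (CTangent (𝓡 4) x) = Module.finrank ℝ (TangentSpace (𝓡 4) x) :=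
      Module.finrank_baseChange
    rw [this]
    exact (finrank_euclideanSpace_fin (𝕜 := ℝ) (n := 4)).symm

-- If A and B both lay in the real span of T, X, Y, then A + iB would lie in their complex span.
omit [IsManifold (𝓡 4) ∞ M] in
theorem linearIndependent_real_of_complex {A B T X Y : TangentSpace (𝓡 4) x}
    (h : LinearIndependent ℂ ![cmk (𝓡 4) A B, cmk (𝓡 4) T 0, cmk (𝓡 4) X 0, cmk (𝓡 4) Y 0]) :
    LinearIndependent ℝ ![A, T, X, Y] ∨ LinearIndependent ℝ ![B, T, X, Y] := by
  rw [Fintype.linearIndependent_iff] at h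
  have h3 : LinearIndependent ℝ ![T, X, Y] := by
    rw [Fintype.linearIndependent_iff]
    intro g hg
    have hg' : g 0 • T + g 1 • X + g 2 • Y = 0 := by
      simpa [Fin.sum_univ_three] using hg
    have := h ![0, (⟨g 0, 0⟩ : ℂ), ⟨g 1, 0⟩, ⟨g 2, 0⟩] (by
      rw [Fin.sum_univ_four]
      change (0 : ℂ) • cmk (𝓡 4) A B + (⟨g 0, 0⟩ : ℂ) • cmk (𝓡 4) T 0 +
        (⟨g 1, 0⟩ : ℂ) • cmk (𝓡 4) X 0 + (⟨g 2, 0⟩ : ℂ) • cmk (𝓡 4) Y 0 = 0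
      have h0 : (0 : CTangent (𝓡 4) x) = cmk (𝓡 4) 0 0 := by simp [cmk]
      rw [zero_smul, zero_add, smul_cmk, smul_cmk, smul_cmk, ← cmk_add, ← cmk_add, h0, cmk_eq_iff]
      constructor
      · rw [← hg']
        module
      · module)
    intro i
    fin_cases i
    exacts [congrArg Complex.re (this 1), congrArg Complex.re (this 2),
      congrArg Complex.re (this 3)]
  by_contra! hn
  have hA : A ∈ Submodule.span ℝ (Set.range ![T, X, Y]) := by
    by_contra hA
    exact hn.1 (linearIndependent_finCons.2 ⟨h3, hA⟩)
  have hB : B ∈ Submodule.span ℝ (Set.range ![T, X, Y]) := by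
    by_contra hB
    exact hn.2 (linearIndependent_finCons.2 ⟨h3, hB⟩)
  rw [Submodule.mem_span_range_iff_exists_fun] at hA hB
  obtain ⟨a, ha⟩ := hA
  obtain ⟨b, hb⟩ := hB
  have ha' : a 0 • T + a 1 • X + a 2 • Y = A := by simpa [Fin.sum_univ_three] using ha
  have hb' : b 0 • T + b 1 • X + b 2 • Y = B := by simpa [Fin.sum_univ_three] using hb
  have := h ![1, (⟨-a 0, -b 0⟩ : ℂ), ⟨-a 1, -b 1⟩, ⟨-a 2, -b 2⟩] (by
    rw [Fin.sum_univ_four]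
    change (1 : ℂ) • cmk (𝓡 4) A B + (⟨-a 0, -b 0⟩ : ℂ) • cmk (𝓡 4) T 0 +
      (⟨-a 1, -b 1⟩ : ℂ) • cmk (𝓡 4) X 0 + (⟨-a 2, -b 2⟩ : ℂ) • cmk (𝓡 4) Y 0 = 0
    have h0 : (0 : CTangent (𝓡 4) x) = cmk (𝓡 4) 0 0 := by simp [cmk]
    rw [one_smul, smul_cmk, smul_cmk, smul_cmk, ← cmk_add, ← cmk_add, ← cmk_add, h0, cmk_eq_iff,
      ← ha', ← hb']
    constructor <;> module) 0
  exact one_ne_zero this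

end EngelSpan

/-! ### Existence of preadapted tuples -/

section Existence

open VectorField

variable {M : Type*} [TopologicalSpace M] [ChartedSpace (EuclideanSpace ℝ (Fin 4)) M]
  [IsManifold (𝓡 4) ∞ M] {S : CRStructure (𝓡 4) M 1} {x : M}
  {X Y A : ∀ y : M, TangentSpace (𝓡 4) y}

/-- The linear map `w ↦ (0, w)`. -/
def zeroCons : (Fin 4 → ℝ) →L[ℝ] (Fin 5 → ℝ) :=
  ContinuousLinearMap.pi (Fin.cons 0 fun j => ContinuousLinearMap.proj j)

theorem zeroCons_succ (w : Fin 4 → ℝ) (j : Fin 4) : zeroCons w j.succ = w j := by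
  simp [zeroCons]

theorem exists_tuple_dual {F : Fin 4 → ∀ y : M, TangentSpace (𝓡 4) y}
    (hF : ∀ j, ∀ᶠ y in 𝓝 x, FieldSmoothAt (F j) y) (hl : LinearIndependent ℝ fun j => F j x) :
    ∃ t : VForm (𝓡 4) M (Fin 5 → ℝ), ∀ᶠ y in 𝓝 x, FormSmoothAt (𝓡 4) t y ∧
      Function.Injective (coframePart t y) ∧ ∀ i j : Fin 4, t y (F i y) j.succ = (Pi.single i 1 : Fin 4 → ℝ) j := by
  obtain ⟨R, hR⟩ := exists_dual_coframe hF hl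
  refine ⟨fun y => zeroCons.comp (R y), hR.mono fun y hy => ⟨hy.1.clm_comp _, ?_, ?_⟩⟩
  · have : coframePart (fun y => zeroCons.comp (R y)) y = R y := by
      ext u j
      rw [coframePart_apply]
      exact zeroCons_succ _ _
    rw [this]
    exact hy.2.1
  · intro i j
    rw [← hy.2.2 i]
    exact zeroCons_succ _ _

/-- For the coframe (σ, ρ, ξ, η) dual to A, T, X, Y, modulo σ one has dσ = ρ∧(pξ + qη) with p =
σ([X, T]) and q = σ([Y, T]), and modulo σ, ρ one has dρ = -ξ∧η. The form pξ + qη becomes the new ξ,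
which fixes the phase of ζ. -/
theorem CRStructure.IsFrameNear.exists_preadapted (h : S.IsFrameNear X Y x)
    (hA : ∀ᶠ y in 𝓝 x, FieldSmoothAt A y)
    (hl : LinearIndependent ℝ ![A x, mlieBracket (𝓡 4) X Y x, X x, Y x])
    (hm : A x = mlieBracket (𝓡 4) X (mlieBracket (𝓡 4) X Y) x ∨
      A x = mlieBracket (𝓡 4) Y (mlieBracket (𝓡 4) X Y) x) :
    ∃ t : VForm (𝓡 4) M (Fin 5 → ℝ), ∀ᶠ y in 𝓝 x, S.IsPreadaptedAt t y := by
  let T := mlieBracket (𝓡 4) X Y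
  let F : Fin 4 → ∀ y : M, TangentSpace (𝓡 4) y := ![A, T, X, Y]
  have hT : ∀ᶠ y in 𝓝 x, FieldSmoothAt T y := by
    filter_upwards [h.smooth_left, h.smooth_right] with y h1 h2
    exact h1.mlieBracket h2
  have hF : ∀ j, ∀ᶠ y in 𝓝 x, FieldSmoothAt (F j) y := by
    intro j
    fin_cases j
    exacts [hA, hT, h.smooth_left, h.smooth_right]
  have hl' : LinearIndependent ℝ fun j => F j x := by
    convert hl using 1
    funext j
    fin_cases j <;> rfl
  obtain ⟨t, ht⟩ := exists_tuple_dual hF hl'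
  let p : M → ℝ := fun y => t y (mlieBracket (𝓡 4) X T y) 1
  let q : M → ℝ := fun y => t y (mlieBracket (𝓡 4) Y T y) 1
  have hp : ∀ᶠ y in 𝓝 x, ContMDiffAt (𝓡 4) 𝓘(ℝ, ℝ) ∞ p y := by
    filter_upwards [ht, h.smooth_left, hT] with y h1 h2 h3
    exact h1.1.coeff (h2.mlieBracket h3) 1
  have hq : ∀ᶠ y in 𝓝 x, ContMDiffAt (𝓡 4) 𝓘(ℝ, ℝ) ∞ q y := by
    filter_upwards [ht, h.smooth_right, hT] with y h1 h2 h3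
    exact h1.1.coeff (h2.mlieBracket h3) 1
  -- Nonzero at x because p or q equals 1 there, according to the choice of A.
  let m : M → ℝ := fun y => p y ^ 2 + q y ^ 2
  have hmx : m x ≠ 0 := by
    have e : t x (A x) 1 = 1 := ht.self_of_nhds.2.2 0 0
    have : p x = 1 ∨ q x = 1 := hm.imp (fun hh => by rw [hh] at e; exact e)
      (fun hh => by rw [hh] at e; exact e)
    rcases this with hh | hh
    · have : m x = 1 + q x ^ 2 := by simp [m, hh]
      rw [this]; positivity
    · have : m x = p x ^ 2 + 1 := by simp [m, hh]
      rw [this]; positivity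
  have hms : ∀ᶠ y in 𝓝 x, ContMDiffAt (𝓡 4) 𝓘(ℝ, ℝ) ∞ m y := by
    filter_upwards [hp, hq] with y h1 h2
    exact (h1.pow 2).add (h2.pow 2)
  have hm0 : ∀ᶠ y in 𝓝 x, m y ≠ 0 :=
    hms.self_of_nhds.continuousAt.eventually_ne hmx
  have hfr : ∀ᶠ y in 𝓝 x, ∀ j, fr t j y = F j y := by
    filter_upwards [ht] with y hy j
    apply hy.2.1
    funext i
    rw [coframePart_apply, coframePart_apply, coframe_fr hy.2.1, hy.2.2 j i, Pi.single_apply]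
  -- Cartan's formula: the components of t are constant on the frame F.
  have hconst : ∀ᶠ y in 𝓝 x, ∀ i j k : Fin 4,
      vD (𝓡 4) t y (F i y) (F j y) k.succ = - t y (mlieBracket (𝓡 4) (F i) (F j) y) k.succ := by
    filter_upwards [ht.eventually_nhds, Filter.eventually_all.2 hF] with y hy hFy i j k
    rw [← vD_rcomp hy.self_of_nhds.1, vD_apply_of_const (hy.self_of_nhds.1.rcomp _)
      (hFy i).mdifferentiableAt (hFy j).mdifferentiableAt
      (hy.mono fun z hz => hz.2.2 i k) (hy.mono fun z hz => hz.2.2 j k)]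
    rfl
  -- The new ζ is (p + iq)(ξ - iη), whose conjugate kills X + iY. Then ξ'∧η' = -m ξ∧η, so dρ' =
  -- 2ξ'∧η' requires ρ' = 2mρ, and dσ' = 2ρ'∧ξ' requires σ' = 4mσ.
  let C : Fin 5 → Fin 5 → M → ℝ := ![![0, 0, 0, 0, 0], ![0, fun y => 4 * m y, 0, 0, 0],
    ![0, 0, fun y => 2 * m y, 0, 0], ![0, 0, 0, p, q], ![0, 0, 0, q, fun y => -p y]]
  have hC : ∀ᶠ y in 𝓝 x, ∀ k j, ContMDiffAt (𝓡 4) 𝓘(ℝ, ℝ) ∞ (C k j) y := by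
    filter_upwards [hp, hq, hms] with y h1 h2 h3 k j
    have h0 : ContMDiffAt (𝓡 4) 𝓘(ℝ, ℝ) ∞ (0 : M → ℝ) y := contMDiffAt_const
    have h4 : ContMDiffAt (𝓡 4) 𝓘(ℝ, ℝ) ∞ (fun y => 4 * m y) y := contMDiffAt_const.mul h3
    have h5 : ContMDiffAt (𝓡 4) 𝓘(ℝ, ℝ) ∞ (fun y => 2 * m y) y := contMDiffAt_const.mul h3
    have h6 : ContMDiffAt (𝓡 4) 𝓘(ℝ, ℝ) ∞ (fun y => -p y) y := h1.neg
    fin_cases k <;> fin_cases j <;> assumption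
  refine ⟨comb C t, ?_⟩
  have hone : ∀ y u, comb C t y u 1 = 4 * m y * t y u 1 := fun y u => by
    rw [comb_apply, Fin.sum_univ_five]; simp [C]
  have htwo : ∀ y u, comb C t y u 2 = 2 * m y * t y u 2 := fun y u => by
    rw [comb_apply, Fin.sum_univ_five]; simp [C]
  have hthree : ∀ y u, comb C t y u 3 = p y * t y u 3 + q y * t y u 4 := fun y u => by
    rw [comb_apply, Fin.sum_univ_five]; simp [C]
  have hfour : ∀ y u, comb C t y u 4 = q y * t y u 3 - p y * t y u 4 := fun y u => by
    rw [comb_apply, Fin.sum_univ_five]; simp [C]; ring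
  filter_upwards [ht, hC, hms, hm0, hfr, hconst, h.mem_iff] with y h1 h2 h3 h4 h5 h6 h7
  have hs : FormSmoothAt (𝓡 4) (comb C t) y := formSmoothAt_comb h1.1 h2
  have hX : ∀ j : Fin 4, t y (X y) j.succ = (Pi.single 2 1 : Fin 4 → ℝ) j := h1.2.2 2
  have hY : ∀ j : Fin 4, t y (Y y) j.succ = (Pi.single 3 1 : Fin 4 → ℝ) j := h1.2.2 3
  have hTy : ∀ j : Fin 4, t y (T y) j.succ = (Pi.single 1 1 : Fin 4 → ℝ) j := h1.2.2 1
  have hi := h1.2.1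
  have hswap : ∀ Z : ∀ z : M, TangentSpace (𝓡 4) z,
      t y (mlieBracket (𝓡 4) T Z y) 1 = - t y (mlieBracket (𝓡 4) Z T y) 1 := by
    intro Z
    rw [mlieBracket_swap_apply, map_neg]
    rfl
  have d12 : vD (𝓡 4) t y (fr t 1 y) (fr t 2 y) 1 = p y := by
    rw [h5, h5]
    exact (h6 1 2 0).trans (neg_eq_iff_eq_neg.2 (hswap X))
  have d13 : vD (𝓡 4) t y (fr t 1 y) (fr t 3 y) 1 = q y := by
    rw [h5, h5]
    exact (h6 1 3 0).trans (neg_eq_iff_eq_neg.2 (hswap Y))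
  have d23 : vD (𝓡 4) t y (fr t 2 y) (fr t 3 y) 1 = 0 := by
    rw [h5, h5]
    exact (h6 2 3 0).trans (neg_eq_zero.2 (hTy 0))
  have r23 : vD (𝓡 4) t y (fr t 2 y) (fr t 3 y) 2 = -1 := by
    rw [h5, h5]
    exact (h6 2 3 1).trans (congrArg Neg.neg (hTy 1))
  refine ⟨hs, ?_, ?_, ?_⟩
  · intro u v
    rw [h7, hone, hone, htwo, htwo, hthree, hthree, hfour, hfour]
    have hX1 : t y (X y) 1 = 0 := hX 0
    have hX2 : t y (X y) 2 = 0 := hX 1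
    have hX3 : t y (X y) 3 = 1 := hX 2
    have hX4 : t y (X y) 4 = 0 := hX 3
    have hY1 : t y (Y y) 1 = 0 := hY 0
    have hY2 : t y (Y y) 2 = 0 := hY 1
    have hY3 : t y (Y y) 3 = 0 := hY 2
    have hY4 : t y (Y y) 4 = 1 := hY 3
    constructor
    · rintro ⟨a, b, rfl, rfl⟩
      simp [hX1, hX2, hX3, hX4, hY1, hY2, hY3, hY4]
      constructor <;> ring
    · rintro ⟨e1, e2, e3, e4, e5, e6⟩
      have g1 : t y u 1 = 0 := by simpa [h4] using e1
      have g2 : t y v 1 = 0 := by simpa [h4] using e2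
      have g3 : t y u 2 = 0 := by simpa [h4] using e3
      have g4 : t y v 2 = 0 := by simpa [h4] using e4
      have g5 : t y v 4 = t y u 3 := by
        refine mul_left_cancel₀ h4 ?_
        simp only [m]
        linear_combination (-p y) * e5 + q y * e6
      have g6 : t y u 4 = - t y v 3 := by
        refine mul_left_cancel₀ h4 ?_
        simp only [m]
        linear_combination q y * e5 + p y * e6
      refine ⟨t y u 3, t y v 3, ?_, ?_⟩
      · conv_lhs => rw [eq_sum_fr hi u, g1, g3, g6, h5, h5, h5, h5]
        change (0 : ℝ) • A y + (0 : ℝ) • T y + t y u 3 • X y + (-t y v 3) • Y y = _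
        module
      · conv_lhs => rw [eq_sum_fr hi v, g2, g4, g5, h5, h5, h5, h5]
        change (0 : ℝ) • A y + (0 : ℝ) • T y + t y v 3 • X y + t y u 3 • Y y = _
        module
  · intro u v hu hv
    rw [hone] at hu hv
    have hu' : t y u 1 = 0 := by simpa [h4] using hu
    have hv' : t y v 1 = 0 := by simpa [h4] using hv
    rw [vD_lincomb (k := 1) (C := C 1) h1.1 hs (h2 1)
      (Filter.Eventually.of_forall fun z w => comb_apply C t z w 1), Fin.sum_univ_five,
      vD_tuple_expand h1.1 hi 1, d12, d13, d23, htwo, htwo, hthree, hthree, hu', hv']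
    simp [C]
    ring
  · intro u v hu hu2 hv hv2
    rw [hone] at hu hv
    rw [htwo] at hu2 hv2
    have hu' : t y u 1 = 0 := by simpa [h4] using hu
    have hv' : t y v 1 = 0 := by simpa [h4] using hv
    have hu2' : t y u 2 = 0 := by simpa [h4] using hu2
    have hv2' : t y v 2 = 0 := by simpa [h4] using hv2
    rw [vD_lincomb (k := 2) (C := C 2) h1.1 hs (h2 2)
      (Filter.Eventually.of_forall fun z w => comb_apply C t z w 2), Fin.sum_univ_five,
      vD_tuple_expand h1.1 hi 2, r23, hfour, hfour, hthree, hthree, hu', hv', hu2', hv2']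
    simp [C, m]
    ring

theorem CRStructure.exists_normalized (S : CRStructure (𝓡 4) M 1) (hS : S.SpansUpToOrderThree)
    (x : M) : ∃ t : VForm (𝓡 4) M (Fin 5 → ℝ), ∀ᶠ y in 𝓝 x, S.IsNormalizedAt t y := by
  obtain ⟨X, Y, h⟩ := S.exists_isFrameNear x
  have hT : ∀ᶠ y in 𝓝 x, FieldSmoothAt (mlieBracket (𝓡 4) X Y) y := by
    filter_upwards [h.smooth_left, h.smooth_right] with y h1 h2
    exact h1.mlieBracket h2
  have : ∃ t : VForm (𝓡 4) M (Fin 5 → ℝ), ∀ᶠ y in 𝓝 x, S.IsPreadaptedAt t y := by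
    rcases linearIndependent_real_of_complex (h.linearIndependent hS) with hl | hl
    · refine h.exists_preadapted (A := mlieBracket (𝓡 4) X (mlieBracket (𝓡 4) X Y)) ?_ hl (Or.inl rfl)
      filter_upwards [h.smooth_left, hT] with y h1 h2
      exact h1.mlieBracket h2
    · refine h.exists_preadapted (A := mlieBracket (𝓡 4) Y (mlieBracket (𝓡 4) X Y)) ?_ hl (Or.inr rfl)
      filter_upwards [h.smooth_right, hT] with y h1 h2
      exact h1.mlieBracket h2
  obtain ⟨t, ht⟩ := this
  obtain ⟨t', ht'⟩ := CRStructure.IsPreadaptedAt.exists_prenormalized ht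
  exact IsPrenormalizedAt.exists_normalized ht'

end Existence

/-! ### Smoothness along maps, rescaling and coframes -/

section AlongMap

variable {E : Type*} [NormedAddCommGroup E] [NormedSpace ℝ E]
  {H : Type*} [TopologicalSpace H] {I : ModelWithCorners ℝ E H}
  {M : Type*} [TopologicalSpace M] [ChartedSpace H M] [IsManifold I ∞ M]
  {F : Type*} [NormedAddCommGroup F] [NormedSpace ℝ F]
  {F' : Type*} [NormedAddCommGroup F'] [NormedSpace ℝ F']
  {E' : Type*} [NormedAddCommGroup E'] [NormedSpace ℝ E']
  {H' : Type*} [TopologicalSpace H'] {I' : ModelWithCorners ℝ E' H'}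
  {N : Type*} [TopologicalSpace N] [ChartedSpace H' N]
  {g : N → M} {ϕ : ∀ n, TangentSpace I (g n) →L[ℝ] F} {n₀ : N}

variable (I I') in
/-- Smoothness of a family of vector-valued covectors along a map. -/
def CovectorsSmoothAt (g : N → M) (ϕ : ∀ n, TangentSpace I (g n) →L[ℝ] F) (n₀ : N) : Prop :=
  ContMDiffAt I' (I.prod 𝓘(ℝ, E →L[ℝ] F)) ∞ (fun n => (⟨g n, ϕ n⟩ : TotalSpace (E →L[ℝ] F)
      (fun x : M => TangentSpace I x →L[ℝ] Trivial M F x))) n₀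

theorem covectorsSmoothAt_iff : CovectorsSmoothAt I I' g ϕ n₀ ↔ ContMDiffAt I' I ∞ g n₀ ∧
    ContMDiffAt I' 𝓘(ℝ, E →L[ℝ] F) ∞ (fun n => ((ϕ n).comp
      ((trivializationAt E (TangentSpace I) (g n₀)).symmL ℝ (g n)) : E →L[ℝ] F)) n₀ := by
  have := Bundle.contMDiffAt_totalSpace (IM := I') (IB := I) (n := ∞) (x₀ := n₀)
    (f := fun n => (⟨g n, ϕ n⟩ : TotalSpace (E →L[ℝ] F)
      (fun x : M => TangentSpace I x →L[ℝ] Trivial M F x)))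
  refine this.trans (and_congr_right fun _ => ?_)
  have h2 : (fun n => (trivializationAt (E →L[ℝ] F)
      (fun x : M => TangentSpace I x →L[ℝ] Trivial M F x) (g n₀) ⟨g n, ϕ n⟩).2) = fun n =>
      ((ϕ n).comp ((trivializationAt E (TangentSpace I) (g n₀)).symmL ℝ (g n)) : E →L[ℝ] F) := by
    funext n
    exact hom_trivializationAt_snd I (g n₀) ⟨g n, ϕ n⟩
  rw [← h2]

theorem CovectorsSmoothAt.clm_comp (h : CovectorsSmoothAt I I' g ϕ n₀) {D : N → F →L[ℝ] F'}
    (hD : ContMDiffAt I' 𝓘(ℝ, F →L[ℝ] F') ∞ D n₀) :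
    CovectorsSmoothAt I I' g (fun n => (D n).comp (ϕ n)) n₀ := by
  rw [covectorsSmoothAt_iff] at h ⊢
  exact ⟨h.1, hD.clm_comp h.2⟩

theorem CovectorsSmoothAt.apply (h : CovectorsSmoothAt I I' g ϕ n₀)
    {X : ∀ n, TangentSpace I (g n)}
    (hX : ContMDiffAt I' I.tangent ∞ (fun n => (⟨g n, X n⟩ : TangentBundle I M)) n₀) :
    ContMDiffAt I' 𝓘(ℝ, F) ∞ (fun n => ϕ n (X n)) n₀ := by
  rw [covectorsSmoothAt_iff] at h
  have h2 := ((Bundle.contMDiffAt_totalSpace (IM := I') (IB := I) (n := ∞) (x₀ := n₀)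
    (f := fun n => (⟨g n, X n⟩ : TangentBundle I M))).1 hX).2
  refine (h.2.clm_apply h2).congr_of_eventuallyEq ?_
  filter_upwards [h.1.continuousAt.preimage_mem_nhds (chart_source_mem_nhds H (g n₀))] with n hn
  have hb : g n ∈ (trivializationAt E (TangentSpace I) (g n₀)).baseSet := by simpa using hn
  simp only [ContinuousLinearMap.comp_apply]
  congr 1
  have := (trivializationAt E (TangentSpace I) (g n₀)).symmL_continuousLinearMapAt (R := ℝ) hb (X n)
  rw [Bundle.Trivialization.continuousLinearMapAt_apply,
    Bundle.Trivialization.linearMapAt_apply, if_pos hb] at this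
  exact this.symm

theorem FormSmoothAt.covectorsSmoothAt {η : VForm I M F} (h : FormSmoothAt I η (g n₀))
    (hg : ContMDiffAt I' I ∞ g n₀) : CovectorsSmoothAt I I' g (fun n => η (g n)) n₀ :=
  ContMDiffAt.comp n₀ h hg

end AlongMap

section Scale

variable {E : Type*} [NormedAddCommGroup E] [NormedSpace ℝ E]
  {H : Type*} [TopologicalSpace H] {I : ModelWithCorners ℝ E H}
  {M : Type*} [TopologicalSpace M] [ChartedSpace H M]
  {E' : Type*} [NormedAddCommGroup E'] [NormedSpace ℝ E']
  {H' : Type*} [TopologicalSpace H'] {I' : ModelWithCorners ℝ E' H'}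
  {N : Type*} [TopologicalSpace N] [ChartedSpace H' N]

theorem vpull_vscale {f : M → ℝ} {t : VForm I M (Fin 5 → ℝ)} {g : N → M} {x : N}
    (hg : MDifferentiableAt I' I g x) (hf : MDifferentiableAt I 𝓘(ℝ, ℝ) f (g x))
    (h0 : f (g x) ≠ 0) :
    vpull I I' g (vscale I f t) x = vscale I' (fun y => f (g y)) (vpull I I' g t) x := by
  have hl : MDifferentiableAt I 𝓘(ℝ, ℝ) (fun y => Real.log (f y)) (g x) :=
    (Real.differentiableAt_log h0).mdifferentiableAt.comp (g x) hf
  ext v j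
  rw [vpull_apply, vscale_apply, vscale_apply, vpull_apply]
  congr 2
  have : mfderiv I' 𝓘(ℝ, ℝ) (fun y => Real.log (f (g y))) x = _ := mfderiv_comp x hl hg
  unfold mvfderiv
  rw [this]
  rfl

/-- The scalings compose because log|gf| = log|g| + log|f| and powers are multiplicative. -/
theorem vscale_vscale {f g : M → ℝ} {t : VForm I M (Fin 5 → ℝ)} {x : M}
    (hf : MDifferentiableAt I 𝓘(ℝ, ℝ) f x) (hf0 : f x ≠ 0)
    (hg : MDifferentiableAt I 𝓘(ℝ, ℝ) g x) (hg0 : g x ≠ 0) :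
    vscale I g (vscale I f t) x = vscale I (fun y => g y * f y) t x := by
  have hlf : MDifferentiableAt I 𝓘(ℝ, ℝ) (fun y => Real.log (f y)) x :=
    (Real.differentiableAt_log hf0).mdifferentiableAt.comp x hf
  have hlg : MDifferentiableAt I 𝓘(ℝ, ℝ) (fun y => Real.log (g y)) x :=
    (Real.differentiableAt_log hg0).mdifferentiableAt.comp x hg
  have he : (fun y => Real.log (g y * f y)) =ᶠ[𝓝 x]
      (fun y => Real.log (g y)) + fun y => Real.log (f y) := by
    filter_upwards [hf.continuousAt.eventually_ne hf0, hg.continuousAt.eventually_ne hg0] with y h1 h2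
    exact Real.log_mul h2 h1
  have hd : ∀ u, mvfderiv I (fun y => Real.log (g y * f y)) x u =
      mvfderiv I (fun y => Real.log (g y)) x u + mvfderiv I (fun y => Real.log (f y)) x u := by
    intro u
    unfold mvfderiv
    rw [he.mfderiv_eq, mfderiv_add hlg hlf]
    rfl
  ext u j
  rw [vscale_apply, vscale_apply, vscale_apply, hd]
  fin_cases j <;> simp [formWeight] <;> ring

theorem vscale_congr {f g : M → ℝ} {t t' : VForm I M (Fin 5 → ℝ)} {x : M} (h : f =ᶠ[𝓝 x] g)
    (ht : t x = t' x) : vscale I f t x = vscale I g t' x := by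
  have hd : mvfderiv I (fun y => Real.log (f y)) x = mvfderiv I (fun y => Real.log (g y)) x := by
    have : (fun y => Real.log (f y)) =ᶠ[𝓝 x] fun y => Real.log (g y) :=
      h.mono fun y hy => congrArg Real.log hy
    unfold mvfderiv
    rw [this.mfderiv_eq]
    rfl
  ext u j
  rw [vscale_apply, vscale_apply, hd, ht, h.eq_of_nhds]

/-- The term d log|f| affects only Λ, so on coframes the scaling is the action of the structure
group. -/
theorem complexPart_vscale (f : M → ℝ) (t : VForm I M (Fin 5 → ℝ)) (x : M) :
    complexPart.comp (vscale I f t x) = weightAct I (f x) (complexPart.comp (t x)) := by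
  ext u j
  have h : ∀ i : Fin 4, vscale I f t x u i.succ = f x ^ formWeight i.succ * t x u i.succ := by
    intro i
    simp [vscale_apply]
  have h1 := h 0
  have h2 := h 1
  have h3 := h 2
  have h4 := h 3
  simp [formWeight] at h1 h2 h3 h4
  change complexPart (vscale I f t x u) j = _ * complexPart (t x u) j
  rw [complexPart_apply, complexPart_apply]
  fin_cases j <;> simp [h1, h2, h3, h4] <;> ring

/-- The endomorphism `diag(a³, a², a, a)`. -/
def weightDiag (a : ℝ) : (Fin 4 → ℂ) →L[ℝ] (Fin 4 → ℂ) :=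
  ∑ j : Fin 4, a ^ (![3, 2, 1, 1] : Fin 4 → ℕ) j •
    (ContinuousLinearMap.single ℝ (fun _ : Fin 4 => ℂ) j).comp (ContinuousLinearMap.proj j)

theorem contDiff_weightDiag : ContDiff ℝ ∞ weightDiag :=
  ContDiff.sum fun _ _ => (contDiff_id.pow _).smul contDiff_const

theorem weightAct_eq_comp (a : ℝ) {x : M} (φ : TangentSpace I x →L[ℝ] (Fin 4 → ℂ)) :
    weightAct I a φ = (weightDiag a).comp φ := by
  ext u j
  change _ * φ u j = weightDiag a (φ u) j
  simp only [weightDiag, sum_apply, Finset.sum_apply]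
  rw [Finset.sum_eq_single j]
  · simp
  · intro i _ hij
    simp [hij.symm]
  · simp

theorem weightAct_apply (a : ℝ) {x : M} (φ : TangentSpace I x →L[ℝ] (Fin 4 → ℂ))
    (u : TangentSpace I x) (j : Fin 4) :
    weightAct I a φ u j = ((a ^ (![3, 2, 1, 1] : Fin 4 → ℕ) j : ℝ) : ℂ) * φ u j := rfl

theorem weightAct_weightAct (a b : ℝ) {x : M} (φ : TangentSpace I x →L[ℝ] (Fin 4 → ℂ)) :
    weightAct I a (weightAct I b φ) = weightAct I (a * b) φ := by
  ext u j
  change _ * (_ * φ u j) = _ * φ u j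
  rw [mul_pow]
  push_cast
  ring

end Scale

section Coframes

variable {E : Type*} [NormedAddCommGroup E] [NormedSpace ℝ E]
  {H : Type*} [TopologicalSpace H] {I : ModelWithCorners ℝ E H}
  {M : Type*} [TopologicalSpace M] [ChartedSpace H M] {x : M}

theorem isCoframeAt_of_injective [FiniteDimensional ℝ E] {k : ℕ} (hk : Module.finrank ℝ E = k)
    {φ : TangentSpace I x →L[ℝ] (Fin k → ℂ)}
    (h : ∀ u v, φ u + Complex.I • φ v = 0 → u = 0 ∧ v = 0) : IsCoframeAt I φ := by
  have hi : Function.Injective (cext I φ) := by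
    rw [injective_iff_map_eq_zero]
    intro w hw
    rw [← cmk_cre_cim w, cext_cmk] at hw
    obtain ⟨h1, h2⟩ := h _ _ hw
    rw [← cmk_cre_cim w, h1, h2]
    simp [cmk]
  have hfr : Module.finrank ℂ (CTangent I x) = Module.finrank ℂ (Fin k → ℂ) := by
    have : Module.finrank ℂ (CTangent I x) = Module.finrank ℝ (TangentSpace I x) :=
      Module.finrank_baseChange
    rw [this, Module.finrank_fin_fun]
    exact hk
  have : FiniteDimensional ℝ (TangentSpace I x) := ‹FiniteDimensional ℝ E›
  exact ⟨hi, (LinearMap.injective_iff_surjective_of_finrank_eq_finrank hfr).1 hi⟩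

theorem isCoframeAt_complexPart [FiniteDimensional ℝ E] (hE : Module.finrank ℝ E = 4)
    {φ : TangentSpace I x →L[ℝ] (Fin 5 → ℝ)}
    (h : ∀ u, (∀ j : Fin 4, φ u j.succ = 0) → u = 0) : IsCoframeAt I (complexPart.comp φ) := by
  refine isCoframeAt_of_injective hE fun u v huv => ?_
  have e : ∀ j, complexPart (φ u) j + Complex.I * complexPart (φ v) j = 0 := fun j => congrFun huv j
  have e0 := e 0
  have e1 := e 1
  have e2 := e 2
  have e3 := e 3
  simp [complexPart_apply, Complex.ext_iff] at e0 e1 e2 e3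
  constructor
  · refine h u fun j => ?_
    fin_cases j
    exacts [e0.1, e1.1, by change φ u 3 = 0; linarith, by change φ u 4 = 0; linarith]
  · refine h v fun j => ?_
    fin_cases j
    exacts [e0.2, e1.2, by change φ v 3 = 0; linarith, by change φ v 4 = 0; linarith]

theorem isCoframeAt_complexTuple [FiniteDimensional ℝ E] (hE : Module.finrank ℝ E = 5)
    {φ : TangentSpace I x →L[ℝ] (Fin 5 → ℝ)} (h : ∀ u, φ u = 0 → u = 0) :
    IsCoframeAt I (complexTuple.comp φ) := by
  refine isCoframeAt_of_injective hE fun u v huv => ?_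
  have e : ∀ j, complexTuple (φ u) j + Complex.I * complexTuple (φ v) j = 0 := fun j => congrFun huv j
  have e0 := e 0
  have e1 := e 1
  have e2 := e 2
  have e3 := e 3
  have e4 := e 4
  simp [complexTuple_apply, Complex.ext_iff] at e0 e1 e2 e3 e4
  constructor
  · refine h u (funext fun j => ?_)
    fin_cases j
    exacts [e0.1, e1.1, e2.1, by change φ u 3 = 0; linarith, by change φ u 4 = 0; linarith]
  · refine h v (funext fun j => ?_)
    fin_cases j
    exacts [e0.2, e1.2, e2.2, by change φ v 3 = 0; linarith, by change φ v 4 = 0; linarith]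

end Coframes

/-! ### The bundle of normalized coframes -/

section Model

/-- The product of the two model spaces carries a product charted structure and that of a model
space; `chartedSpaceSelf_prod` identifies them. -/
theorem contMDiff_fst_model : ContMDiff J5 (𝓡 4) ∞
    (fun h : ModelProd (EuclideanSpace ℝ (Fin 4)) ℝ => h.1) := by
  have := contMDiff_fst (I := 𝓡 4) (J := 𝓘(ℝ, ℝ)) (M := EuclideanSpace ℝ (Fin 4)) (N := ℝ) (n := ∞)
  rwa [chartedSpaceSelf_prod] at this

theorem contMDiff_snd_model : ContMDiff J5 𝓘(ℝ, ℝ) ∞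
    (fun h : ModelProd (EuclideanSpace ℝ (Fin 4)) ℝ => h.2) := by
  have := contMDiff_snd (I := 𝓡 4) (J := 𝓘(ℝ, ℝ)) (M := EuclideanSpace ℝ (Fin 4)) (N := ℝ) (n := ∞)
  rwa [chartedSpaceSelf_prod] at this

theorem contMDiffOn_mk_model {E : Type*} [NormedAddCommGroup E] [NormedSpace ℝ E]
    {H : Type*} [TopologicalSpace H] {I : ModelWithCorners ℝ E H}
    {N : Type*} [TopologicalSpace N] [ChartedSpace H N] {s : Set N}
    {f : N → EuclideanSpace ℝ (Fin 4)} {g : N → ℝ} (hf : ContMDiffOn I (𝓡 4) ∞ f s)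
    (hg : ContMDiffOn I 𝓘(ℝ, ℝ) ∞ g s) :
    ContMDiffOn I J5 (M' := ModelProd (EuclideanSpace ℝ (Fin 4)) ℝ) ∞ (fun n => (f n, g n)) s := by
  have := hf.prodMk hg
  rw [chartedSpaceSelf_prod] at this
  exact this

end Model

section Bundle

variable {M : Type*} [TopologicalSpace M] [ChartedSpace (EuclideanSpace ℝ (Fin 4)) M]
  [IsManifold (𝓡 4) ∞ M] {S : CRStructure (𝓡 4) M 1}
  {t t' : VForm (𝓡 4) M (Fin 5 → ℝ)} {x : M}

/-- The model of the total space of the bundle of tuples of complex covectors. -/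
abbrev covectorModel : ModelWithCorners ℝ
    (EuclideanSpace ℝ (Fin 4) × (EuclideanSpace ℝ (Fin 4) →L[ℝ] (Fin 4 → ℂ)))
    (ModelProd (EuclideanSpace ℝ (Fin 4)) (EuclideanSpace ℝ (Fin 4) →L[ℝ] (Fin 4 → ℂ))) :=
  (𝓡 4).prod 𝓘(ℝ, EuclideanSpace ℝ (Fin 4) →L[ℝ] (Fin 4 → ℂ))

/-- The coframes that belong to a normalized tuple. -/
def CRStructure.normalizedBundle (S : CRStructure (𝓡 4) M 1) : Set (CovectorTuples (𝓡 4) M 4) :=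
  {p | ∃ t : VForm (𝓡 4) M (Fin 5 → ℝ), (∀ᶠ y in 𝓝 p.proj, S.IsNormalizedAt t y) ∧
    p.snd = complexPart.comp (t p.proj)}

/-- The coframe that is obtained from the tuple `t` at `x` and the group parameter `a`. -/
def orbitPoint (t : VForm (𝓡 4) M (Fin 5 → ℝ)) (x : M) (a : ℝ) : CovectorTuples (𝓡 4) M 4 :=
  ⟨x, weightAct (𝓡 4) a (complexPart.comp (t x))⟩

/-- The group parameter of a coframe with respect to the tuple `t`. -/
def fibreCoord (t : VForm (𝓡 4) M (Fin 5 → ℝ)) (p : CovectorTuples (𝓡 4) M 4) : ℝ :=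
  ((p.snd : TangentSpace (𝓡 4) p.proj →L[ℝ] (Fin 4 → ℂ)) (fr t 2 p.proj) 2).re

/-- The ζ component has weight 1 and takes the value 1 on E₂, so it reads off a itself, including
its sign. -/
theorem fibreCoord_orbitPoint (hi : Function.Injective (coframePart t x)) (a : ℝ) :
    fibreCoord t (orbitPoint t x a) = a := by
  change (((a ^ 1 : ℝ) : ℂ) * complexPart (t x (fr t 2 x)) 2).re = a
  rw [complexPart_apply]
  simp [fr_apply_three hi, fr_apply_four hi]

theorem contMDiffAt_fibreCoord {p : CovectorTuples (𝓡 4) M 4} (ht : FormSmoothAt (𝓡 4) t p.proj)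
    (hi : Function.Injective (coframePart t p.proj)) :
    ContMDiffAt covectorModel 𝓘(ℝ, ℝ) ∞ (fibreCoord t) p := by
  have h1 : CovectorsSmoothAt (𝓡 4) covectorModel
      (fun q : CovectorTuples (𝓡 4) M 4 => q.proj) (fun q => q.snd) p := contMDiffAt_id
  have hX : FieldSmoothAt (fr t 2) p.proj := fieldSmoothAt_fr ht hi 2
  have h2 : ContMDiffAt covectorModel (𝓡 4).tangent ∞ (fun q : CovectorTuples (𝓡 4) M 4 =>
      (⟨q.proj, fr t 2 q.proj⟩ : TangentBundle (𝓡 4) M)) p :=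
    ContMDiffAt.comp p hX (Bundle.contMDiff_proj _ p)
  exact (Complex.reCLM.comp (ContinuousLinearMap.proj 2 : (Fin 4 → ℂ) →L[ℝ] ℂ)).contMDiff.contMDiffAt.comp
    p (h1.apply h2)

theorem contMDiffAt_orbitPoint {E : Type*} [NormedAddCommGroup E] [NormedSpace ℝ E]
    {H : Type*} [TopologicalSpace H] {I : ModelWithCorners ℝ E H}
    {N : Type*} [TopologicalSpace N] [ChartedSpace H N] {n : N} {f : N → M} {a : N → ℝ}
    (hf : ContMDiffAt I (𝓡 4) ∞ f n) (ha : ContMDiffAt I 𝓘(ℝ, ℝ) ∞ a n)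
    (ht : FormSmoothAt (𝓡 4) t (f n)) :
    ContMDiffAt I covectorModel ∞ (fun m => orbitPoint t (f m) (a m)) n := by
  have h := (ht.clm_comp complexPart).covectorsSmoothAt hf
  have hD : ContMDiffAt I 𝓘(ℝ, (Fin 4 → ℂ) →L[ℝ] (Fin 4 → ℂ)) ∞ (fun m => weightDiag (a m)) n :=
    contDiff_weightDiag.contMDiff.contMDiffAt.comp n ha
  refine (h.clm_comp hD).congr_of_eventuallyEq (Filter.Eventually.of_forall fun m => ?_)
  simp only [orbitPoint, weightAct_eq_comp]

/-- Uniqueness of normalized tuples up to scaling gives one inclusion; scaling by a constant, which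
preserves normalization, gives the other. -/
theorem CRStructure.mk_mem_normalizedBundle_iff (h : ∀ᶠ y in 𝓝 x, S.IsNormalizedAt t y)
    (φ : TangentSpace (𝓡 4) x →L[ℝ] (Fin 4 → ℂ)) :
    (⟨x, φ⟩ : CovectorTuples (𝓡 4) M 4) ∈ S.normalizedBundle ↔
      ∃ a : ℝ, a ≠ 0 ∧ φ = weightAct (𝓡 4) a (complexPart.comp (t x)) := by
  constructor
  · rintro ⟨t', h', e⟩
    refine ⟨t' x (fr t 2 x) 3, (IsNormalizedAt.change h h').1, ?_⟩
    rw [← complexPart_vscale (fun y => t' y (fr t 2 y) 3) t x, ← IsNormalizedAt.eq_vscale h h']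
    exact e
  · rintro ⟨a, ha, rfl⟩
    refine ⟨vscale (𝓡 4) (fun _ => a) t, h.eventually_nhds.mono fun y hy =>
      IsNormalizedAt.rescale hy contMDiffAt_const ha, ?_⟩
    exact (complexPart_vscale (fun _ => a) t x).symm

theorem CRStructure.orbitPoint_mem (h : ∀ᶠ y in 𝓝 x, S.IsNormalizedAt t y) {a : ℝ} (ha : a ≠ 0) :
    orbitPoint t x a ∈ S.normalizedBundle :=
  (mk_mem_normalizedBundle_iff h _).2 ⟨a, ha, rfl⟩

theorem CRStructure.eq_orbitPoint {p : CovectorTuples (𝓡 4) M 4} (hp : p ∈ S.normalizedBundle)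
    (h : ∀ᶠ y in 𝓝 p.proj, S.IsNormalizedAt t y) :
    fibreCoord t p ≠ 0 ∧ p = orbitPoint t p.proj (fibreCoord t p) := by
  obtain ⟨a, ha, e⟩ := (mk_mem_normalizedBundle_iff h p.snd).1 hp
  have e' : p = orbitPoint t p.proj a := by
    rw [orbitPoint, ← e]
  have : fibreCoord t p = a := by
    conv_lhs => rw [e']
    exact fibreCoord_orbitPoint h.self_of_nhds.injective a
  rw [this]
  exact ⟨ha, e'⟩

theorem CRStructure.isAdapted_of_mem {p : CovectorTuples (𝓡 4) M 4}
    (hp : p ∈ S.normalizedBundle) : S.IsAdapted p.snd := by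
  obtain ⟨t, h, e⟩ := hp
  rw [e]
  exact (S.isAdapted_complexPart (t p.proj)).2 h.self_of_nhds.adapted

theorem CRStructure.isWeightedReduction_normalizedBundle
    (h : ∀ x : M, ∃ t : VForm (𝓡 4) M (Fin 5 → ℝ), ∀ᶠ y in 𝓝 x, S.IsNormalizedAt t y) :
    IsWeightedReduction (𝓡 4) S.normalizedBundle := by
  intro x₀
  obtain ⟨t, ht⟩ := h x₀
  obtain ⟨U, hU, hUo, hx⟩ := eventually_nhds_iff.1 ht
  refine ⟨U, hUo, hx, fun y => complexPart.comp (t y), fun y hy =>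
    ((hU y hy).smooth.clm_comp complexPart).contMDiffWithinAt, fun y hy => ⟨?_, fun φ => ?_⟩⟩
  · refine isCoframeAt_complexPart (finrank_euclideanSpace_fin (𝕜 := ℝ) (n := 4)) fun u hu => ?_
    refine (hU y hy).injective ?_
    rw [map_zero]
    exact funext hu
  · exact mk_mem_normalizedBundle_iff (Filter.eventually_of_mem (hUo.mem_nhds hy) hU) φ

/-- Coordinates on P are a chart of M and the group parameter relative to t. The tuple is returned
with the chart because the coframe property of the forms is checked in these coordinates. -/
theorem CRStructure.exists_subChart
    (h : ∀ x : M, ∃ t : VForm (𝓡 4) M (Fin 5 → ℝ), ∀ᶠ y in 𝓝 x, S.IsNormalizedAt t y)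
    (p : S.normalizedBundle) : ∃ (c : SubChart covectorModel J5 S.normalizedBundle)
      (t : VForm (𝓡 4) M (Fin 5 → ℝ)), (p : CovectorTuples (𝓡 4) M 4) ∈ c.dom ∧
      (∀ᶠ y in 𝓝 p.1.proj, S.IsNormalizedAt t y) ∧
      c.Φ = fun q => (chartAt (EuclideanSpace ℝ (Fin 4)) p.1.proj q.proj, fibreCoord t q) := by
  obtain ⟨t, ht⟩ := h p.1.proj
  set e := chartAt (EuclideanSpace ℝ (Fin 4)) p.1.proj with he
  obtain ⟨W, hW, hWo, hx⟩ := eventually_nhds_iff.1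
    (ht.and (e.open_source.mem_nhds (mem_chart_source _ p.1.proj)))
  have hev : ∀ y ∈ W, ∀ᶠ z in 𝓝 y, S.IsNormalizedAt t z := fun y hy =>
    Filter.eventually_of_mem (hWo.mem_nhds hy) fun z hz => (hW z hz).1
  refine ⟨{
    dom := TotalSpace.proj ⁻¹' W
    cod := {k | (k.1 ∈ e.target ∧ e.symm k.1 ∈ W) ∧ k.2 ≠ 0}
    isOpen_dom := hWo.preimage (FiberBundle.continuous_proj _ _)
    isOpen_cod := ((e.symm.isOpen_inter_preimage hWo).preimage continuous_fst).inter
      (isOpen_ne.preimage continuous_snd)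
    Φ := fun q => (e q.proj, fibreCoord t q)
    Ψ := fun k => orbitPoint t (e.symm k.1) k.2
    map_Φ := ?_
    map_Ψ := ?_
    map_Ψ_dom := ?_
    left_inv := ?_
    right_inv := ?_
    smooth_Φ := ?_
    smooth_Ψ := ?_ }, t, hx, ht, rfl⟩
  · intro q hq hqW
    refine ⟨⟨e.map_source (hW _ hqW).2, ?_⟩, (eq_orbitPoint hq (hev _ hqW)).1⟩
    rw [e.left_inv (hW _ hqW).2]
    exact hqW
  · rintro k ⟨⟨-, hk⟩, h0⟩
    exact orbitPoint_mem (hev _ hk) h0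
  · rintro k ⟨⟨-, hk⟩, -⟩
    exact hk
  · intro q hq hqW
    change orbitPoint t (e.symm (e q.proj)) (fibreCoord t q) = q
    rw [e.left_inv (hW _ hqW).2]
    exact (eq_orbitPoint hq (hev _ hqW)).2.symm
  · rintro k ⟨⟨hk, hk'⟩, -⟩
    exact Prod.ext (e.right_inv hk) (fibreCoord_orbitPoint (hW _ hk').1.injective _)
  · refine contMDiffOn_mk_model ?_ ?_
    · exact (contMDiffOn_chart (I := 𝓡 4) (n := ∞) (x := p.1.proj)).comp
        (Bundle.contMDiff_proj _).contMDiffOn fun q hq => (hW _ hq).2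
    · intro q hq
      exact (contMDiffAt_fibreCoord (hW _ hq).1.smooth (hW _ hq).1.injective).contMDiffWithinAt
  · rintro k ⟨⟨hk, hk'⟩, -⟩
    refine (contMDiffAt_orbitPoint (a := fun k : ModelProd (EuclideanSpace ℝ (Fin 4)) ℝ => k.2)
      (ContMDiffAt.comp k ?_ (contMDiff_fst_model k)) (contMDiff_snd_model k)
      (hW _ hk').1.smooth).contMDiffWithinAt
    exact (contMDiffOn_chart_symm (I := 𝓡 4) (n := ∞) (x := p.1.proj)).contMDiffAt
      (e.open_target.mem_nhds hk)

end Bundle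

/-! ### The invariant forms on the bundle -/

section Coordinates

variable {E : Type*} [NormedAddCommGroup E] [NormedSpace ℝ E]
  {H : Type*} [TopologicalSpace H] {I : ModelWithCorners ℝ E H}
  {N : Type*} [TopologicalSpace N] [ChartedSpace H N]

theorem eq_zero_of_mfderiv_mk_model {n : N} {f : N → EuclideanSpace ℝ (Fin 4)} {g : N → ℝ}
    (hf : MDifferentiableAt I (𝓡 4) f n) (hg : MDifferentiableAt I 𝓘(ℝ, ℝ) g n)
    (hi : Function.Injective (mfderiv I J5 (M' := ModelProd (EuclideanSpace ℝ (Fin 4)) ℝ)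
      (fun m => (f m, g m)) n)) {v : TangentSpace I n} (h1 : mfderiv I (𝓡 4) f n v = 0)
    (h2 : mfderiv I 𝓘(ℝ, ℝ) g n v = 0) : v = 0 := by
  have h := mfderiv_prodMk hf hg
  rw [chartedSpaceSelf_prod] at h
  apply hi
  rw [map_zero]
  refine (DFunLike.congr_fun h v).trans ?_
  exact Prod.ext h1 h2

/-- The two forms agree since ρ∧ζ + ρ∧ζ̄ = 2ρ∧ξ and iζ∧ζ̄ = 2ξ∧η; the equation for dζ̄ is the
conjugate of the one for dζ. -/
theorem structureEquations_of_structureRel {N : Type*} [TopologicalSpace N]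
    [ChartedSpace (ModelProd (EuclideanSpace ℝ (Fin 4)) ℝ) N] [IsManifold J5 ∞ N]
    {t : VForm J5 N (Fin 5 → ℝ)} {J : Fin 6 → N → ℂ} (ht : ∀ p, FormSmoothAt J5 t p)
    (h : ∀ p u v, StructureRel (fun k => J k p) (vD J5 t p u v) (t p u) (t p v)) :
    StructureEquations (fun p => complexTuple.comp (t p)) J := by
  intro p u v
  have hd : ∀ j, extD J5 (comp J5 (fun p => complexTuple.comp (t p)) j) p u v =
      complexTuple (vD J5 t p u v) j := fun j =>
    vD_clm_comp (ht p) ((ContinuousLinearMap.proj j : (Fin 5 → ℂ) →L[ℝ] ℂ).comp complexTuple) u v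
  have hw : ∀ i j, wedge J5 (comp J5 (fun p => complexTuple.comp (t p)) i)
      (comp J5 (fun p => complexTuple.comp (t p)) j) p u v =
      complexTuple (t p u) i * complexTuple (t p v) j -
        complexTuple (t p v) i * complexTuple (t p u) j := fun i j => rfl
  obtain ⟨h1, h2, h3, h4⟩ := h p u v
  have h1' := congrArg ((↑) : ℝ → ℂ) h1
  have h2' := congrArg ((↑) : ℝ → ℂ) h2
  have h3' := congrArg star h3
  simp only [hd, hw, complexTuple_apply]
  simp at h1' h2' h3' h3 h4 ⊢
  have hI := Complex.I_mul_I
  refine ⟨?_, ?_, ?_, ?_, ?_⟩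
  · linear_combination h1'
  · linear_combination h2' + 2 * (t p u 3 * t p v 4 - t p u 4 * t p v 3) * hI
  · linear_combination h3
  · linear_combination h3'
  · linear_combination h4

end Coordinates

section Lift

variable {M : Type*} [TopologicalSpace M] [ChartedSpace (EuclideanSpace ℝ (Fin 4)) M]
  [IsManifold (𝓡 4) ∞ M] {S : CRStructure (𝓡 4) M 1}
  [ChartedSpace (ModelProd (EuclideanSpace ℝ (Fin 4)) ℝ) S.normalizedBundle]
  {t t' : VForm (𝓡 4) M (Fin 5 → ℝ)} {p : S.normalizedBundle}

/-- The projection of the bundle of normalized coframes. -/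
def CRStructure.baseProj (S : CRStructure (𝓡 4) M 1) (p : S.normalizedBundle) : M := p.1.proj

/-- A normalized tuple near the base point of `p`. -/
def CRStructure.tupleAt (S : CRStructure (𝓡 4) M 1) (p : S.normalizedBundle) :
    VForm (𝓡 4) M (Fin 5 → ℝ) := p.2.choose

omit [ChartedSpace (ModelProd (EuclideanSpace ℝ (Fin 4)) ℝ) S.normalizedBundle] in
theorem CRStructure.isNormalizedAt_tupleAt (p : S.normalizedBundle) :
    ∀ᶠ y in 𝓝 (S.baseProj p), S.IsNormalizedAt (S.tupleAt p) y := p.2.choose_spec.1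

/-- The tuple of forms on the bundle of normalized coframes that is defined by a tuple on the
base. -/
def CRStructure.liftForm (S : CRStructure (𝓡 4) M 1)
    [ChartedSpace (ModelProd (EuclideanSpace ℝ (Fin 4)) ℝ) S.normalizedBundle]
    (t : VForm (𝓡 4) M (Fin 5 → ℝ)) : VForm J5 S.normalizedBundle (Fin 5 → ℝ) :=
  vscale J5 (fun q => fibreCoord t q.1) (vpull (𝓡 4) J5 S.baseProj t)

/-- The coefficients on the bundle of normalized coframes that are defined by a tuple on the
base. -/
def CRStructure.liftCoeff (S : CRStructure (𝓡 4) M 1) (t : VForm (𝓡 4) M (Fin 5 → ℝ)) (k : Fin 6)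
    (q : S.normalizedBundle) : ℂ :=
  ((fibreCoord t q.1 ^ coeffWeight k)⁻¹ : ℝ) * structureCoeff t k (S.baseProj q)

/-- The invariant tuple of forms on the bundle of normalized coframes. -/
def CRStructure.tautForm (S : CRStructure (𝓡 4) M 1)
    [ChartedSpace (ModelProd (EuclideanSpace ℝ (Fin 4)) ℝ) S.normalizedBundle] :
    VForm J5 S.normalizedBundle (Fin 5 → ℝ) := fun p => S.liftForm (S.tupleAt p) p

/-- The invariant coefficients on the bundle of normalized coframes. -/
def CRStructure.tautCoeff (S : CRStructure (𝓡 4) M 1) (k : Fin 6) (p : S.normalizedBundle) : ℂ :=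
  S.liftCoeff (S.tupleAt p) k p

-- One coframe is written as a multiple of two local coframes that themselves differ by a factor, so
-- the group parameters differ by that factor.
omit [ChartedSpace (ModelProd (EuclideanSpace ℝ (Fin 4)) ℝ) S.normalizedBundle] in
theorem CRStructure.fibreCoord_change (h : ∀ᶠ y in 𝓝 (S.baseProj p), S.IsNormalizedAt t y)
    (h' : ∀ᶠ y in 𝓝 (S.baseProj p), S.IsNormalizedAt t' y) :
    fibreCoord t p.1 = fibreCoord t' p.1 *
      t' (S.baseProj p) (fr t 2 (S.baseProj p)) 3 := by
  have e := (eq_orbitPoint p.2 h').2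
  have e2 : orbitPoint t' p.1.proj (fibreCoord t' p.1) = orbitPoint t p.1.proj
      (fibreCoord t' p.1 * t' p.1.proj (fr t 2 p.1.proj) 3) := by
    have e3 : complexPart.comp (t' p.1.proj) = weightAct (𝓡 4) (t' p.1.proj (fr t 2 p.1.proj) 3)
        (complexPart.comp (t p.1.proj)) := by
      conv_lhs => rw [IsNormalizedAt.eq_vscale (x := p.1.proj) h h']
      exact complexPart_vscale _ _ _
    unfold orbitPoint
    rw [e3, weightAct_weightAct]
  conv_lhs => rw [e, e2]
  exact fibreCoord_orbitPoint h.self_of_nhds.injective _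

-- The factors from the change of the fibre coordinate and from `coeff_eq` cancel, so the pointwise
-- choice in `tautCoeff` does not matter and smoothness can be read off from one tuple.
omit [ChartedSpace (ModelProd (EuclideanSpace ℝ (Fin 4)) ℝ) S.normalizedBundle] in
theorem CRStructure.liftCoeff_eq (h : ∀ᶠ y in 𝓝 (S.baseProj p), S.IsNormalizedAt t y)
    (h' : ∀ᶠ y in 𝓝 (S.baseProj p), S.IsNormalizedAt t' y) (k : Fin 6) :
    S.liftCoeff t' k p = S.liftCoeff t k p := by
  rw [liftCoeff, liftCoeff, fibreCoord_change h h', IsNormalizedAt.coeff_eq h h', mul_pow, mul_inv]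
  push_cast
  ring

omit [ChartedSpace (ModelProd (EuclideanSpace ℝ (Fin 4)) ℝ) S.normalizedBundle] in
theorem CRStructure.continuous_baseProj : Continuous S.baseProj :=
  (FiberBundle.continuous_proj _ _).comp continuous_subtype_val

omit [ChartedSpace (ModelProd (EuclideanSpace ℝ (Fin 4)) ℝ) S.normalizedBundle] in
theorem CRStructure.tautCoeff_eventuallyEq
    (h : ∀ᶠ y in 𝓝 (S.baseProj p), S.IsNormalizedAt t y) (k : Fin 6) :
    S.tautCoeff k =ᶠ[𝓝 p] S.liftCoeff t k := by
  filter_upwards [S.continuous_baseProj.continuousAt.eventually h.eventually_nhds] with q hq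
  exact liftCoeff_eq hq (S.isNormalizedAt_tupleAt q) k

section

variable (hv : ContMDiff J5 covectorModel ∞ (Subtype.val : S.normalizedBundle → _))
include hv

theorem CRStructure.contMDiff_baseProj : ContMDiff J5 (𝓡 4) ∞ S.baseProj :=
  (Bundle.contMDiff_proj _).comp hv

theorem CRStructure.contMDiffAt_coord (h : ∀ᶠ y in 𝓝 (S.baseProj p), S.IsNormalizedAt t y) :
    ContMDiffAt J5 𝓘(ℝ, ℝ) ∞ (fun q : S.normalizedBundle => fibreCoord t q.1) p :=
  (contMDiffAt_fibreCoord h.self_of_nhds.smooth h.self_of_nhds.injective).comp p (hv p)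

/-- Replacing t by t' scales the pulled back tuple by f and divides the fibre coordinate by f; the
two scalings compose to the original one. -/
theorem CRStructure.liftForm_eq (h : ∀ᶠ y in 𝓝 (S.baseProj p), S.IsNormalizedAt t y)
    (h' : ∀ᶠ y in 𝓝 (S.baseProj p), S.IsNormalizedAt t' y) :
    S.liftForm t' p = S.liftForm t p := by
  set f : M → ℝ := fun y => t' y (fr t 2 y) 3 with hf
  have hx := h.self_of_nhds
  have hfs : MDifferentiableAt (𝓡 4) 𝓘(ℝ, ℝ) f (S.baseProj p) :=
    (h'.self_of_nhds.smooth.coeff (fieldSmoothAt_fr hx.smooth hx.injective 2) 3).mdifferentiableAt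
      (by simp)
  have hf0 : f (S.baseProj p) ≠ 0 := (IsNormalizedAt.change h h').1
  have hpr : MDifferentiableAt J5 (𝓡 4) S.baseProj p :=
    (contMDiff_baseProj hv p).mdifferentiableAt (by simp)
  have e : vpull (𝓡 4) J5 S.baseProj t' p =
      vscale J5 (fun q => f (S.baseProj q)) (vpull (𝓡 4) J5 S.baseProj t) p := by
    rw [← vpull_vscale hpr hfs hf0]
    unfold vpull
    rw [IsNormalizedAt.eq_vscale h h']
  have ec : (fun q : S.normalizedBundle => fibreCoord t q.1) =ᶠ[𝓝 p]
      fun q => fibreCoord t' q.1 * f (S.baseProj q) := by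
    filter_upwards [S.continuous_baseProj.continuousAt.eventually h.eventually_nhds,
      S.continuous_baseProj.continuousAt.eventually h'.eventually_nhds] with q h1 h2
    exact fibreCoord_change h1 h2
  unfold liftForm
  rw [vscale_congr (Filter.EventuallyEq.refl _ _) e,
    vscale_vscale (f := fun q => f (S.baseProj q)) (hfs.comp p hpr) hf0
    ((contMDiffAt_coord hv h').mdifferentiableAt (by simp)) (eq_orbitPoint p.2 h').1]
  exact vscale_congr ec.symm rfl

theorem CRStructure.tautForm_eventuallyEq (h : ∀ᶠ y in 𝓝 (S.baseProj p), S.IsNormalizedAt t y) :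
    ∀ᶠ q in 𝓝 p, S.tautForm q = S.liftForm t q := by
  filter_upwards [S.continuous_baseProj.continuousAt.eventually h.eventually_nhds] with q hq
  exact liftForm_eq hv hq (S.isNormalizedAt_tupleAt q)

theorem CRStructure.contMDiff_tautCoeff (k : Fin 6) : ContMDiff J5 𝓘(ℝ, ℂ) ∞ (S.tautCoeff k) := by
  intro p
  have h := S.isNormalizedAt_tupleAt p
  refine ContMDiffAt.congr_of_eventuallyEq ?_ (tautCoeff_eventuallyEq h k)
  have h1 : ContMDiffAt J5 𝓘(ℝ, ℂ) ∞ (fun q => structureCoeff (S.tupleAt p) k (S.baseProj q)) p :=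
    (contMDiffAt_structureCoeff (h.mono fun y hy => hy.toIsPrenormalizedAt) k).comp p
      (contMDiff_baseProj hv p)
  have h2 : ContMDiffAt J5 𝓘(ℝ, ℝ) ∞ (fun q : S.normalizedBundle =>
      (fibreCoord (S.tupleAt p) q.1 ^ coeffWeight k)⁻¹) p :=
    ContMDiffAt.comp p (contDiffAt_inv ℝ (pow_ne_zero _ (eq_orbitPoint p.2 h).1)).contMDiffAt
      ((contMDiffAt_coord hv h).pow _)
  exact (h2.smul h1).congr_of_eventuallyEq
    (Filter.Eventually.of_forall fun q => Complex.real_smul.symm)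

variable [IsManifold J5 ∞ S.normalizedBundle]

theorem CRStructure.formSmoothAt_liftForm
    (h : ∀ᶠ y in 𝓝 (S.baseProj p), S.IsNormalizedAt t y) : FormSmoothAt J5 (S.liftForm t) p :=
  FormSmoothAt.vscale (contMDiffAt_coord hv h) (eq_orbitPoint p.2 h).1
    (FormSmoothAt.vpull (contMDiff_baseProj hv p) h.self_of_nhds.smooth)

theorem CRStructure.formSmoothAt_tautForm (p : S.normalizedBundle) :
    FormSmoothAt J5 S.tautForm p :=
  (formSmoothAt_liftForm hv (S.isNormalizedAt_tupleAt p)).congr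
    (tautForm_eventuallyEq hv (S.isNormalizedAt_tupleAt p))

theorem CRStructure.structureRel_tautForm (p : S.normalizedBundle) (u v : TangentSpace J5 p) :
    StructureRel (fun k => S.tautCoeff k p) (vD J5 S.tautForm p u v) (S.tautForm p u)
      (S.tautForm p v) := by
  have h := S.isNormalizedAt_tupleAt p
  rw [vD_congr (tautForm_eventuallyEq hv h)]
  refine structureRel_vscale (contMDiffAt_coord hv h) (eq_orbitPoint p.2 h).1
    (FormSmoothAt.vpull (contMDiff_baseProj hv p) h.self_of_nhds.smooth) ?_
  rw [vD_vpull (contMDiff_baseProj hv p) h.self_of_nhds.smooth]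
  exact IsNormalizedAt.structureRel h _ _

end

theorem CRStructure.liftForm_apply (v : TangentSpace J5 p) (j : Fin 5) :
    S.liftForm t p v j = fibreCoord t p.1 ^ formWeight j *
      t (S.baseProj p) (mfderiv J5 (𝓡 4) S.baseProj p v) j +
      (Pi.single 0 1 : Fin 5 → ℝ) j *
        mvfderiv J5 (fun q : S.normalizedBundle => Real.log (fibreCoord t q.1)) p v := rfl

/-- At p the lifted forms are the coframe of the tuple scaled by the fibre coordinate of p, and this
scaled coframe is p itself. -/
theorem CRStructure.complexTuple_tautForm_succ (v : TangentSpace J5 p) (j : Fin 4) :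
    complexTuple (S.tautForm p v) j.succ =
      (p.1.snd : TangentSpace (𝓡 4) p.1.proj →L[ℝ] (Fin 4 → ℂ))
        (mfderiv J5 (𝓡 4) S.baseProj p v) j := by
  have h := S.isNormalizedAt_tupleAt p
  have e2 := (eq_orbitPoint p.2 h).2
  have e3 : p.1.snd = weightAct (𝓡 4) (fibreCoord (S.tupleAt p) p.1)
      (complexPart.comp (S.tupleAt p p.1.proj)) := by
    -- The covector part has a type depending on the base point, so it is extracted after
    -- destructuring the point.
    have key : ∀ (q : CovectorTuples (𝓡 4) M 4) (ψ : TangentSpace (𝓡 4) q.proj →L[ℝ] (Fin 4 → ℂ)),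
        q = ⟨q.proj, ψ⟩ → q.snd = ψ := by
      rintro ⟨y, φ⟩ ψ hq
      simpa using hq
    exact key _ _ e2
  have e := congrFun (DFunLike.congr_fun (complexPart_vscale (I := J5)
    (fun q : S.normalizedBundle => fibreCoord (S.tupleAt p) q.1)
    (vpull (𝓡 4) J5 S.baseProj (S.tupleAt p)) p) v) j
  rw [weightAct_apply] at e
  rw [complexTuple_succ, e3]
  exact e.trans (weightAct_apply (fibreCoord (S.tupleAt p) p.1)
    (complexPart.comp (S.tupleAt p p.1.proj)) (mfderiv J5 (𝓡 4) S.baseProj p v) j).symm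

/-- If all five forms vanish on v, the last four show that v is vertical. Then Λ(v) reduces to
da(v)/a, so da(v) = 0, and the coordinates on P detect v. -/
theorem CRStructure.tautForm_injective
    (hv : ContMDiff J5 covectorModel ∞ (Subtype.val : S.normalizedBundle → _))
    (h : ∀ᶠ y in 𝓝 (S.baseProj p), S.IsNormalizedAt t y)
    (hi : Function.Injective (mfderiv J5 J5 (M' := ModelProd (EuclideanSpace ℝ (Fin 4)) ℝ)
      (fun q : S.normalizedBundle =>
        (chartAt (EuclideanSpace ℝ (Fin 4)) (S.baseProj p) (S.baseProj q), fibreCoord t q.1)) p))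
    (v : TangentSpace J5 p) (h0 : S.tautForm p v = 0) : v = 0 := by
  rw [(tautForm_eventuallyEq hv h).self_of_nhds] at h0
  have hA := (eq_orbitPoint p.2 h).1
  have hcd : MDifferentiableAt J5 𝓘(ℝ, ℝ) (fun q : S.normalizedBundle => fibreCoord t q.1) p :=
    (contMDiffAt_coord hv h).mdifferentiableAt (by simp)
  have hpd : MDifferentiableAt J5 (𝓡 4) S.baseProj p :=
    (contMDiff_baseProj hv p).mdifferentiableAt (by simp)
  have hchd : MDifferentiableAt (𝓡 4) (𝓡 4)
      (chartAt (EuclideanSpace ℝ (Fin 4)) (S.baseProj p)) (S.baseProj p) :=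
    mdifferentiableAt_atlas (chart_mem_atlas _ _) (mem_chart_source _ _)
  have hp : mfderiv J5 (𝓡 4) S.baseProj p v = 0 := by
    apply h.self_of_nhds.injective
    rw [map_zero]
    funext j
    have := congrFun h0 j.succ
    rw [liftForm_apply] at this
    have h1 : t (S.baseProj p) (mfderiv J5 (𝓡 4) S.baseProj p v) j.succ = 0 := by
      simpa [hA] using this
    exact h1
  refine eq_zero_of_mfderiv_mk_model (hchd.comp p hpd) hcd hi ?_ ?_
  · rw [mfderiv_comp p hchd hpd]
    change mfderiv (𝓡 4) (𝓡 4) _ _ (mfderiv J5 (𝓡 4) S.baseProj p v) = 0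
    rw [hp, map_zero]
  · have := congrFun h0 0
    rw [liftForm_apply, hp, mvfderiv_real_comp hcd (Real.hasDerivAt_log hA)] at this
    have h1 : mvfderiv J5 (fun q : S.normalizedBundle => fibreCoord t q.1) p v = 0 := by
      simpa [hA] using this
    exact h1

end Lift

/-! ### Lifts of CR-diffeomorphisms -/

section Diffeo

variable {M : Type*} [TopologicalSpace M] [ChartedSpace (EuclideanSpace ℝ (Fin 4)) M]
  [IsManifold (𝓡 4) ∞ M] {S : CRStructure (𝓡 4) M 1}
  {t : VForm (𝓡 4) M (Fin 5 → ℝ)} {x : M}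

/-- The differential of `g` preserves membership in the CR-bundle. -/
def CRStructure.Preserves (S : CRStructure (𝓡 4) M 1) (g : M → M) : Prop :=
  ∀ (x : M) (u v : TangentSpace (𝓡 4) x), cmk (𝓡 4) u v ∈ S.L x ↔
    cmk (𝓡 4) (mfderiv (𝓡 4) (𝓡 4) g x u) (mfderiv (𝓡 4) (𝓡 4) g x v) ∈ S.L (g x)

omit [IsManifold (𝓡 4) ∞ M] in
theorem baseChange_cmk {y : M} (A : TangentSpace (𝓡 4) x →ₗ[ℝ] TangentSpace (𝓡 4) y)
    (u v : TangentSpace (𝓡 4) x) : A.baseChange ℂ (cmk (𝓡 4) u v) = cmk (𝓡 4) (A u) (A v) := by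
  simp [cmk]

theorem CRStructure.IsCRDiffeo.preserves {h : M ≃ₘ^∞⟮𝓡 4, 𝓡 4⟯ M} (hh : S.IsCRDiffeo h) :
    S.Preserves h := by
  intro x u v
  have hi : Function.Injective (mfderiv (𝓡 4) (𝓡 4) h x) :=
    (h.mfderivToContinuousLinearEquiv (by simp) x).injective
  rw [← hh x, Submodule.mem_map]
  constructor
  · exact fun hm => ⟨_, hm, baseChange_cmk _ u v⟩
  · rintro ⟨w, hw, e⟩
    rw [← cmk_cre_cim w, baseChange_cmk, cmk_eq_iff] at e
    rwa [← hi e.1, ← hi e.2, cmk_cre_cim]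

omit [IsManifold (𝓡 4) ∞ M] in
theorem vpull_symm_vpull {F : Type*} [NormedAddCommGroup F] [NormedSpace ℝ F]
    (h : M ≃ₘ^∞⟮𝓡 4, 𝓡 4⟯ M) (η : VForm (𝓡 4) M F) :
    vpull (𝓡 4) (𝓡 4) h (vpull (𝓡 4) (𝓡 4) h.symm η) = η := by
  funext x
  rw [← vpull_comp η (h.symm.contMDiff.mdifferentiable (by simp) _)
    (h.contMDiff.mdifferentiable (by simp) _),
    vpull_congr η (Filter.Eventually.of_forall fun y => h.symm_apply_apply y :
      (h.symm ∘ h) =ᶠ[𝓝 x] id)]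
  ext v
  rw [vpull_apply, mfderiv_id]
  rfl

omit [IsManifold (𝓡 4) ∞ M] in
theorem mfderiv_mfderiv_symm (h : M ≃ₘ^∞⟮𝓡 4, 𝓡 4⟯ M) (y : M) (u : EuclideanSpace ℝ (Fin 4)) :
    (mfderiv (𝓡 4) (𝓡 4) h (h.symm y) : EuclideanSpace ℝ (Fin 4) →L[ℝ] EuclideanSpace ℝ (Fin 4))
      ((mfderiv (𝓡 4) (𝓡 4) h.symm y :
        EuclideanSpace ℝ (Fin 4) →L[ℝ] EuclideanSpace ℝ (Fin 4)) u) = u := by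
  have e : (h ∘ h.symm) =ᶠ[𝓝 y] id := Filter.Eventually.of_forall fun z => h.apply_symm_apply z
  have h1 := mfderiv_comp y (h.contMDiff.mdifferentiable (by simp) (h.symm y))
    (h.symm.contMDiff.mdifferentiable (by simp) y)
  rw [e.mfderiv_eq, mfderiv_id] at h1
  exact (DFunLike.congr_fun h1 u).symm

theorem CRStructure.Preserves.symm {h : M ≃ₘ^∞⟮𝓡 4, 𝓡 4⟯ M} (hh : S.Preserves h) :
    S.Preserves h.symm := by
  intro y u v
  rw [hh (h.symm y)]
  -- Membership in L is transported along h (h⁻¹ y) = y with vectors read in the model space.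
  have key : ∀ (z : M) (u₁ v₁ u₂ v₂ : EuclideanSpace ℝ (Fin 4)), z = y → u₁ = u₂ → v₁ = v₂ →
      (cmk (𝓡 4) (x := y) u₁ v₁ ∈ S.L y ↔ cmk (𝓡 4) (x := z) u₂ v₂ ∈ S.L z) := by
    rintro z u₁ v₁ u₂ v₂ rfl rfl rfl
    rfl
  exact key _ _ _ _ _ (h.apply_symm_apply y) (mfderiv_mfderiv_symm h y u).symm
    (mfderiv_mfderiv_symm h y v).symm

theorem CRStructure.Preserves.structureRel_vpull {g : M → M} (hs : ContMDiff (𝓡 4) (𝓡 4) ∞ g)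
    (h : ∀ᶠ y in 𝓝 (g x), S.IsNormalizedAt t y) (u v : TangentSpace (𝓡 4) x) :
    StructureRel (fun k => structureCoeff t k (g x)) (vD (𝓡 4) (vpull (𝓡 4) (𝓡 4) g t) x u v)
      (vpull (𝓡 4) (𝓡 4) g t x u) (vpull (𝓡 4) (𝓡 4) g t x v) := by
  rw [vD_vpull (hs x) h.self_of_nhds.smooth]
  exact IsNormalizedAt.structureRel h _ _

/-- The structure equations are natural under pullback, and g preserves adaptedness because it
preserves L. -/
theorem CRStructure.Preserves.isNormalizedAt_vpull {g : M → M} (hg : S.Preserves g)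
    (hs : ContMDiff (𝓡 4) (𝓡 4) ∞ g) (h : ∀ᶠ y in 𝓝 (g x), S.IsNormalizedAt t y) :
    ∀ᶠ y in 𝓝 x, S.IsNormalizedAt (vpull (𝓡 4) (𝓡 4) g t) y := by
  filter_upwards [hs.continuous.continuousAt.eventually h.eventually_nhds] with y hy
  refine isNormalizedAt_of_structureRel (FormSmoothAt.vpull (hs y) hy.self_of_nhds.smooth) ?_
    (structureRel_vpull hs hy)
  intro u v
  rw [hg y]
  exact hy.self_of_nhds.adapted _ _

/-- The pulled back tuple satisfies the structure equations with the pulled back coefficients, and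
these are unique. -/
theorem CRStructure.Preserves.structureCoeff_vpull {g : M → M} (hg : S.Preserves g)
    (hs : ContMDiff (𝓡 4) (𝓡 4) ∞ g) (h : ∀ᶠ y in 𝓝 (g x), S.IsNormalizedAt t y) (k : Fin 6) :
    structureCoeff (vpull (𝓡 4) (𝓡 4) g t) k x = structureCoeff t k (g x) :=
  congrFun (structureRel_unique (hg.isNormalizedAt_vpull hs h).self_of_nhds.injective
    (IsNormalizedAt.structureRel (hg.isNormalizedAt_vpull hs h)) (structureRel_vpull hs h)) k

/-- The natural action commutes with the structure group: it changes the tuple by pullback under h⁻¹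
and leaves the group parameter unchanged. -/
theorem naturalLift_orbitPoint (h : M ≃ₘ^∞⟮𝓡 4, 𝓡 4⟯ M) (t : VForm (𝓡 4) M (Fin 5 → ℝ)) (x : M)
    (a : ℝ) : naturalLift (𝓡 4) h (orbitPoint t x a) =
      orbitPoint (vpull (𝓡 4) (𝓡 4) h.symm t) (h x) a := by
  have e : (t x).comp (h.mfderivToContinuousLinearEquiv (by simp) x).symm.toContinuousLinearMap =
      vpull (𝓡 4) (𝓡 4) h.symm t (h x) := by
    conv_lhs => rw [← vpull_symm_vpull h t]
    ext u : 1
    exact congrArg (vpull (𝓡 4) (𝓡 4) h.symm t (h x))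
      ((h.mfderivToContinuousLinearEquiv (by simp) x).apply_symm_apply u)
  unfold orbitPoint
  rw [← e]
  rfl

end Diffeo

section Lift

variable {M : Type*} [TopologicalSpace M] [ChartedSpace (EuclideanSpace ℝ (Fin 4)) M]
  [IsManifold (𝓡 4) ∞ M] {S : CRStructure (𝓡 4) M 1} {h : M ≃ₘ^∞⟮𝓡 4, 𝓡 4⟯ M}
  {t : VForm (𝓡 4) M (Fin 5 → ℝ)} {p : S.normalizedBundle}

theorem CRStructure.Preserves.isNormalizedAt_symm (hh : S.Preserves h) {x : M}
    (ht : ∀ᶠ y in 𝓝 x, S.IsNormalizedAt t y) :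
    ∀ᶠ y in 𝓝 (h x), S.IsNormalizedAt (vpull (𝓡 4) (𝓡 4) h.symm t) y :=
  hh.symm.isNormalizedAt_vpull h.symm.contMDiff (by rwa [h.symm_apply_apply])

theorem CRStructure.naturalLift_eq (ht : ∀ᶠ y in 𝓝 (S.baseProj p), S.IsNormalizedAt t y) :
    naturalLift (𝓡 4) h p.1 =
      orbitPoint (vpull (𝓡 4) (𝓡 4) h.symm t) (h (S.baseProj p)) (fibreCoord t p.1) := by
  conv_lhs => rw [(eq_orbitPoint p.2 ht).2]
  exact naturalLift_orbitPoint _ _ _ _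

/-- The lift of a CR-diffeomorphism to the bundle of normalized coframes. -/
def CRStructure.Preserves.lift (hh : S.Preserves h) (p : S.normalizedBundle) :
    S.normalizedBundle :=
  ⟨naturalLift (𝓡 4) h p.1, by
    have ht := S.isNormalizedAt_tupleAt p
    rw [naturalLift_eq ht]
    exact orbitPoint_mem (hh.isNormalizedAt_symm ht) (eq_orbitPoint p.2 ht).1⟩

theorem CRStructure.Preserves.lift_symm_lift (hh : S.Preserves h) (p : S.normalizedBundle) :
    hh.symm.lift (hh.lift p) = p := by
  have ht := S.isNormalizedAt_tupleAt p
  apply Subtype.ext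
  change naturalLift (𝓡 4) h.symm (naturalLift (𝓡 4) h p.1) = p.1
  rw [naturalLift_eq ht, naturalLift_orbitPoint]
  change orbitPoint (vpull (𝓡 4) (𝓡 4) h (vpull (𝓡 4) (𝓡 4) h.symm (S.tupleAt p))) _ _ = _
  rw [vpull_symm_vpull, h.symm_apply_apply]
  exact (eq_orbitPoint p.2 ht).2.symm

theorem CRStructure.Preserves.fibreCoord_lift (hh : S.Preserves h)
    (ht : ∀ᶠ y in 𝓝 (S.baseProj p), S.IsNormalizedAt t y) :
    fibreCoord (vpull (𝓡 4) (𝓡 4) h.symm t) (hh.lift p).1 = fibreCoord t p.1 := by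
  change fibreCoord _ (naturalLift (𝓡 4) h p.1) = _
  rw [naturalLift_eq ht]
  exact fibreCoord_orbitPoint (hh.isNormalizedAt_symm ht).self_of_nhds.injective _

theorem CRStructure.Preserves.tautCoeff_lift (hh : S.Preserves h) (k : Fin 6)
    (p : S.normalizedBundle) : S.tautCoeff k (hh.lift p) = S.tautCoeff k p := by
  have ht := S.isNormalizedAt_tupleAt p
  have ht' := hh.isNormalizedAt_symm ht
  rw [(tautCoeff_eventuallyEq (p := hh.lift p) ht' k).eq_of_nhds, tautCoeff, liftCoeff, liftCoeff,
    hh.fibreCoord_lift ht]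
  congr 1
  have := hh.symm.structureCoeff_vpull (x := h (S.baseProj p)) (t := S.tupleAt p) h.symm.contMDiff
    (by rwa [h.symm_apply_apply]) k
  rw [h.symm_apply_apply] at this
  exact this

variable [ChartedSpace (ModelProd (EuclideanSpace ℝ (Fin 4)) ℝ) S.normalizedBundle]
  (hv : ContMDiff J5 covectorModel ∞ (Subtype.val : S.normalizedBundle → _))
include hv

theorem CRStructure.Preserves.contMDiff_val_lift (hh : S.Preserves h) :
    ContMDiff J5 covectorModel ∞ (fun q => (hh.lift q).1) := by
  intro p
  have ht := S.isNormalizedAt_tupleAt p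
  refine (contMDiffAt_orbitPoint (t := vpull (𝓡 4) (𝓡 4) h.symm (S.tupleAt p))
    (h.contMDiff.contMDiffAt.comp p (contMDiff_baseProj hv p)) (contMDiffAt_coord hv ht)
    (hh.isNormalizedAt_symm ht).self_of_nhds.smooth).congr_of_eventuallyEq ?_
  filter_upwards [S.continuous_baseProj.continuousAt.eventually ht.eventually_nhds] with q hq
  exact naturalLift_eq hq

/-- Near the image point the forms may be computed from the tuple transported by h. In terms of it,
the lift covers h and keeps the fibre coordinate, so pulling back returns the expression in the
original tuple. -/
theorem CRStructure.Preserves.tautForm_lift (hh : S.Preserves h)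
    (hs : ContMDiff J5 J5 ∞ hh.lift) (p : S.normalizedBundle) (v : TangentSpace J5 p) :
    S.tautForm (hh.lift p) (mfderiv J5 J5 hh.lift p v) = S.tautForm p v := by
  have ht := S.isNormalizedAt_tupleAt p
  have ht' := hh.isNormalizedAt_symm ht
  set t := S.tupleAt p
  set t' := vpull (𝓡 4) (𝓡 4) h.symm t with ht'_def
  have hd : MDifferentiableAt J5 J5 hh.lift p := (hs p).mdifferentiableAt (by simp)
  have hb : ∀ q, MDifferentiableAt J5 (𝓡 4) S.baseProj q := fun q =>
    (contMDiff_baseProj hv q).mdifferentiableAt (by simp)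
  have e1 : vpull J5 J5 hh.lift (vpull (𝓡 4) J5 S.baseProj t') p = vpull (𝓡 4) J5 S.baseProj t p := by
    rw [← vpull_comp t' (hb _) hd]
    change vpull (𝓡 4) J5 (h ∘ S.baseProj) t' p = _
    rw [vpull_comp t' (h.contMDiff.mdifferentiable (by simp) _) (hb p), ht'_def, vpull_symm_vpull]
  have e2 : (fun q : S.normalizedBundle => fibreCoord t' (hh.lift q).1) =ᶠ[𝓝 p]
      fun q => fibreCoord t q.1 := by
    filter_upwards [S.continuous_baseProj.continuousAt.eventually ht.eventually_nhds] with q hq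
    exact hh.fibreCoord_lift hq
  have e3 : vpull J5 J5 hh.lift (S.liftForm t') p = S.liftForm t p := by
    unfold liftForm
    rw [vpull_vscale hd ((contMDiffAt_coord (p := hh.lift p) hv ht').mdifferentiableAt (by simp))
      (eq_orbitPoint (hh.lift p).2 ht').1]
    exact vscale_congr e2 e1
  rw [(tautForm_eventuallyEq (p := hh.lift p) hv ht').self_of_nhds]
  exact DFunLike.congr_fun e3 v

end Lift

end EngelCR

end

/-! ### The canonical bundle and its coframe -/

theorem theorem1 {M : Type*} [TopologicalSpace M] [T2Space M] [SecondCountableTopology M]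
    [ChartedSpace (EuclideanSpace ℝ (Fin 4)) M] [IsManifold (𝓡 4) ∞ M]
    (S : EngelCR.CRStructure (𝓡 4) M 1) (hS : S.SpansUpToOrderThree) :
    ∃ (P : Set (EngelCR.CovectorTuples (𝓡 4) M 4))
      (_ : ChartedSpace (ModelProd (EuclideanSpace ℝ (Fin 4)) ℝ) P)
      (_ : IsManifold EngelCR.J5 ∞ P)
      (θ : ∀ p : P, TangentSpace EngelCR.J5 p →L[ℝ] (Fin 5 → ℂ))
      (𝔍 : Fin 6 → P → ℂ),
      -- `P` is a subbundle of the bundle of coframes, adapted to the CR-structure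
      EngelCR.IsWeightedReduction (𝓡 4) P ∧
      (∀ p ∈ P, S.IsAdapted p.snd) ∧
      -- `P` is an embedded submanifold of dimension `5`
      ContMDiff EngelCR.J5 ((𝓡 4).prod 𝓘(ℝ, EuclideanSpace ℝ (Fin 4) →L[ℝ] (Fin 4 → ℂ))) ∞
        (Subtype.val : P → EngelCR.CovectorTuples (𝓡 4) M 4) ∧
      (∀ p : P, Function.Injective
        (mfderiv EngelCR.J5 ((𝓡 4).prod 𝓘(ℝ, EuclideanSpace ℝ (Fin 4) →L[ℝ] (Fin 4 → ℂ)))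
          (Subtype.val : P → EngelCR.CovectorTuples (𝓡 4) M 4) p)) ∧
      -- `θ = (Λ, σ, ρ, ζ, ζ̄)` is a smooth coframe on `P` with `Λ` real and
      -- `σ, ρ, ζ, ζ̄` tautological
      EngelCR.SmoothFormsOn EngelCR.J5 θ Set.univ ∧
      (∀ p : P, EngelCR.IsCoframeAt EngelCR.J5 (θ p)) ∧
      (∀ (p : P) (v : TangentSpace EngelCR.J5 p), (θ p v 0).im = 0) ∧
      EngelCR.IsTautological P θ ∧
      -- the structure equations, with smooth coefficients
      (∀ k, ContMDiff EngelCR.J5 𝓘(ℝ, ℂ) ∞ (𝔍 k)) ∧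
      EngelCR.StructureEquations θ 𝔍 ∧
      -- every CR-diffeomorphism lifts to `P` and preserves `θ` and the coefficients
      ∀ h : M ≃ₘ^∞⟮𝓡 4, 𝓡 4⟯ M, S.IsCRDiffeo h →
        ∃ Hl : P ≃ₘ^∞⟮EngelCR.J5, EngelCR.J5⟯ P,
          (∀ p : P, (Hl p : EngelCR.CovectorTuples (𝓡 4) M 4) =
            EngelCR.naturalLift (𝓡 4) h p) ∧
          (∀ (p : P) (v : TangentSpace EngelCR.J5 p),
            θ (Hl p) (mfderiv EngelCR.J5 EngelCR.J5 Hl p v) = θ p v) ∧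
          ∀ (k : Fin 6) (p : P), 𝔍 k (Hl p) = 𝔍 k p := by
  classical
  have hn := S.exists_normalized hS
  -- One chart is fixed for each point of P. The equation hΦ retains its explicit coordinates, which
  -- are needed for the independence of the five forms.
  choose c t hc ht hΦ using EngelCR.CRStructure.exists_subChart hn
  let cs : ChartedSpace (ModelProd (EuclideanSpace ℝ (Fin 4)) ℝ) S.normalizedBundle :=
    EngelCR.subChartedSpace c hc
  have hm : IsManifold EngelCR.J5 ∞ S.normalizedBundle := EngelCR.isManifold_sub c hc
  have hv : ContMDiff EngelCR.J5 EngelCR.covectorModel ∞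
      (Subtype.val : S.normalizedBundle → EngelCR.CovectorTuples (𝓡 4) M 4) :=
    EngelCR.contMDiff_val_sub c hc
  have hinj : ∀ (p : S.normalizedBundle) (v : TangentSpace EngelCR.J5 p),
      S.tautForm p v = 0 → v = 0 := by
    intro p
    refine EngelCR.CRStructure.tautForm_injective hv (ht p) ?_
    have := EngelCR.mfderiv_coord_injective_sub c hc p
    rw [hΦ p] at this
    exact this
  refine ⟨S.normalizedBundle, cs, hm, fun p => EngelCR.complexTuple.comp (S.tautForm p),
    S.tautCoeff, EngelCR.CRStructure.isWeightedReduction_normalizedBundle hn,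
    fun p hp => EngelCR.CRStructure.isAdapted_of_mem hp, hv,
    EngelCR.mfderiv_val_injective_sub c hc, fun p _ =>
      ((EngelCR.CRStructure.formSmoothAt_tautForm hv p).clm_comp _).contMDiffWithinAt,
    fun p => EngelCR.isCoframeAt_complexTuple ?_ (hinj p), fun p v => ?_,
    fun p v j => EngelCR.CRStructure.complexTuple_tautForm_succ v j,
    EngelCR.CRStructure.contMDiff_tautCoeff hv,
    EngelCR.structureEquations_of_structureRel (EngelCR.CRStructure.formSmoothAt_tautForm hv)
      (EngelCR.CRStructure.structureRel_tautForm hv), fun h hh => ?_⟩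
  · simp
  · change (EngelCR.complexTuple (S.tautForm p v) 0).im = 0
    rw [EngelCR.complexTuple_apply]
    exact Complex.ofReal_im _
  · have hp := hh.preserves
    have hs : ContMDiff EngelCR.J5 EngelCR.J5 ∞ hp.lift := fun p =>
      EngelCR.contMDiffAt_into_sub c hc (hp.contMDiff_val_lift hv p)
    have hs' : ContMDiff EngelCR.J5 EngelCR.J5 ∞ hp.symm.lift := fun p =>
      EngelCR.contMDiffAt_into_sub c hc (hp.symm.contMDiff_val_lift hv p)
    exact ⟨⟨⟨hp.lift, hp.symm.lift, hp.lift_symm_lift, hp.symm.lift_symm_lift⟩, hs, hs'⟩,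
      fun p => rfl, fun p v => congrArg EngelCR.complexTuple (hp.tautForm_lift hv hs p v), fun k p => hp.tautCoeff_lift k p⟩
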